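/- Let $n\ge 2$, $I=\{0,\dots,n\}$, $0\le k\le n$, and let $\mathfrak g$ be the affine Kac–Moody algebra of type $C_n^{(1)}$: $P^\vee=\bigoplus_{i\in I}\mathbb Z h_i\oplus\mathbb Z d$; the simple roots $\alpha_j$ satisfy $\alpha_j(h_i)=a_{ij}$, $\alpha_j(d)=\delta_{0j}$, where $a_{ii}=2$, $a_{10}=a_{n-1,n}=-2$, $a_{ij}=-1$ for all other pairs with $|i-j|=1$, and $a_{ij}=0$ if $|i-j|\ge2$. Put $s_0=s_n=2$ and $s_i=1$ otherwise, $q_i=q^{s_i}$, and let $P=\mathrm{Hom}(P^\vee,\mathbb Z)$. Let $U_q(\mathfrak g)$ be the $\mathbb Q(q)$-algebra with generators $e_i,f_i$ $(i\in I)$, $q^h$ $(h\in P^\vee)$ and the usual relations: $q^0=1$, $q^hq^{h'}=q^{h+h'}$, $q^he_iq^{-h}=q^{\alpha_i(h)}e_i$, $q^hf_iq^{-h}=q^{-\alpha_i(h)}f_i$, $e_if_j-f_je_i=\delta_{ij}\frac{k_i-k_i^{-1}}{q_i-q_i^{-1}}$ with $k_i=q^{s_ih_i}$, and the quantum Serre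 relations. **Fock space.** A Young diagram of charge $k$ is an integer sequence $Y=(y_l)_{l\ge0}$ with $y_l\le y_{l+1}$ and $y_l=k$ for $l\gg0$; its boxes are the $(l,m)$ with $y_l<m\le k$. Let $\mathcal Y(\Lambda_k)$ be the set of these diagrams and $\mathcal F(\Lambda_k)=\bigoplus_{Y\in\mathcal Y(\Lambda_k)}\mathbb Q(q)Y$. A site $(l,y)\in\mathbb N\times\mathbb Z$ has colour $i\in I$ if $l+y\equiv\pm i \pmod{2n}$, and so does a box $(l,y)$; write $(l,y)>(l',y')$ if $l+y>l'+y'$. The diagram $Y$ has a concave corner at $(0,y_0)$ and, whenever $y_l\ne y_{l+1}$, a concave corner at $(l+1,y_{l+1})$ and a convex corner at $(l+1,y_l)$. Let $E_{(l,y)}Y$ be $Y$ with $y_{l-1}$ increased by $1$ if $Y$ has a convex corner at $(l,y)$, and $0$ otherwise; let $F_{(l,y)}Y$ be $Y$ with $y_l$ decreased by $1$ if $Y$ has a concave corner at $(l,y)$, and $0$ otherwise. For a site $s$ of colour $i$ let $T_s^{\pm}Y=q_i^{\pm1}Y$, $q_i^{\mp1}Y$ or $Y$ according to whether $Y$ has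 a concave corner, a convex corner or no corner at $s$. With $s,t$ running over the sites of colour $i$, set $$E_i=\sum_{s}\Big(\prod_{t>s}T^+_t\Big)E_s,\qquad F_i=\sum_{s}\Big(\prod_{t<s}T^-_t\Big)F_s,$$ $$E_i'=\sum_{s}\Big(\prod_{t<s}T^-_t\Big)E_s,\qquad F_i'=\sum_{s}\Big(\prod_{t>s}T^+_t\Big)F_s .$$ Let $q^{h_i}$ act by $q^{h_i}Y=q^{c_i(Y)}Y$, where $c_i(Y)$ is the number of concave minus the number of convex $i$-coloured corners of $Y$ (so $k_i$ acts as $\prod_sT_s^+$), and let $q^dY=q^{-b(Y)}Y$, where $b(Y)$ is the number of $0$-coloured boxes of $Y$. **Crystal bases.** A $U_q(\mathfrak g)$-module $M$ is called integrable here if it is the direct sum of finite-dimensional weight spaces $M_\mu=\{u: q^hu=q^{\mu(h)}u\ \forall h\in P^\vee\}$, $\mu\in P$; for each $i$ it is the union of finite-dimensional subspaces stable under $e_i,f_i,q^{\pm h_i}$; and its weights lie in $F-\sum_i\mathbb N\alpha_i$ for some finite $F\subset P$. Let $[m]_i=\frac{q_i^m-q_i^{-m}}{q_i-q_i^{-1}}$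 and $f_i^{(m)}=f_i^m/[m]_i!$. The lower (upper) Kashiwara operators $\tilde e_i,\tilde f_i$ are the linear operators on $M$ such that, for every $u\in M_\mu$ with $e_iu=0$ and $l=\mu(h_i)$, and all $0\le m<l$: $\tilde e_iu=0$, $\tilde f_if_i^{(l)}u=0$ and, in the lower case, $$\tilde e_if_i^{(m+1)}u=f_i^{(m)}u,\qquad \tilde f_if_i^{(m)}u=f_i^{(m+1)}u,$$ and in the upper case $$\tilde e_if_i^{(m+1)}u=\frac{[l-m]_i}{[m+1]_i}f_i^{(m)}u,\qquad \tilde f_if_i^{(m)}u=\frac{[m+1]_i}{[l-m]_i}f_i^{(m+1)}u .$$ Let $A=\{f/g: f,g\in\mathbb Q[q],\ g(0)\ne0\}$. A lower (upper) crystal base of $M$ is a pair $(L,B)$ where $L\subset M$ is a free $A$-submodule with $\mathbb Q(q)\otimes_AL\cong M$; $B$ is a basis of the $\mathbb Q$-vector space $L/qL$; with the lower (upper) operators, $\tilde e_iL\subset L$, $\tilde f_iL\subset L$, $\tilde e_iB\subset B\cup\{0\}$, $\tilde f_iB\subset B\cup\{0\}$; $L=\bigoplus_\mu L_\mu$ and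 $B=\bigsqcup_\mu B_\mu$ with $L_\mu=L\cap M_\mu$, $B_\mu=B\cap(L_\mu/qL_\mu)$; and, for $b,b'\in B$ and $i\in I$, $b'=\tilde f_ib$ if and only if $b=\tilde e_ib'$. **Theorem 3.1.** Let $L=\sum_{Y\in\mathcal Y(\Lambda_k)}AY\subset\mathcal F(\Lambda_k)$ and $B=\{Y+qL: Y\in\mathcal Y(\Lambda_k)\}\subset L/qL$. The classes $Y+qL$ are pairwise distinct, and: 1. the operators $E_i,F_i$ and $q^h$ make $\mathcal F(\Lambda_k)$ an integrable $U_q(\mathfrak g)$-module, and $(L,B)$ is an upper crystal base of it; 2. the operators $E_i',F_i'$ and $q^h$ make $\mathcal F(\Lambda_k)$ an integrable $U_q(\mathfrak g)$-module, and $(L,B)$ is a lower crystal base of it. -/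

import Mathlib

noncomputable section

namespace FockC

open scoped TensorProduct

/-! ## Scalars: the field `ℚ(q)` and its subring `A` of functions regular at `q = 0` -/

/-- The field `ℚ(q)`. -/
abbrev Qq : Type := RatFunc ℚ

/-- The indeterminate `q`. -/
def q : Qq := RatFunc.X

/-- The ring `A = {f/g : f, g ∈ ℚ[q], g(0) ≠ 0}`. -/
def A : Subalgebra ℚ Qq where
  carrier := {x | ∃ f g : Polynomial ℚ, g.eval 0 ≠ 0 ∧
    x = algebraMap (Polynomial ℚ) Qq f / algebraMap (Polynomial ℚ) Qq g}
  mul_mem' := by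
    rintro _ _ ⟨f, g, hg, rfl⟩ ⟨f', g', hg', rfl⟩
    refine ⟨f * f', g * g', by simp [hg, hg'], ?_⟩
    rw [map_mul, map_mul, div_mul_div_comm]
  add_mem' := by
    rintro _ _ ⟨f, g, hg, rfl⟩ ⟨f', g', hg', rfl⟩
    have h0 : ∀ p : Polynomial ℚ, p.eval 0 ≠ 0 → algebraMap (Polynomial ℚ) Qq p ≠ 0 := by
      intro p hp h
      rw [map_eq_zero_iff _ (RatFunc.algebraMap_injective ℚ)] at h
      simp [h] at hp
    refine ⟨f * g' + g * f', g * g', by simp [hg, hg'], ?_⟩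
    rw [div_add_div _ _ (h0 g hg) (h0 g' hg')]
    simp only [map_mul, map_add]
  algebraMap_mem' := by
    intro r
    refine ⟨Polynomial.C r, 1, by simp, ?_⟩
    rw [map_one, div_one, IsScalarTower.algebraMap_apply ℚ (Polynomial ℚ) Qq]
    rfl

/-- `q` as an element of `A`. -/
def qA : A := ⟨q, Polynomial.X, 1, by simp, by simp [q]⟩

/-- The quantum integer `[m]_x = (x^m - x^{-m}) / (x - x^{-1})`. -/
def qInt (x : Qq) (m : ℕ) : Qq := (x ^ m - x⁻¹ ^ m) / (x - x⁻¹)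

/-- The quantum factorial `[m]_x!`. -/
def qFact (x : Qq) (m : ℕ) : Qq := ∏ j ∈ Finset.range m, qInt x (j + 1)

/-- The quantum binomial coefficient. -/
def qBinom (x : Qq) (m r : ℕ) : Qq := qFact x m / (qFact x r * qFact x (m - r))

/-! ## Root datum of type `C_n^{(1)}`, with index set `I = {0, …, n}` -/

/-- The generalized Cartan matrix `a_{ij} = α_j(h_i)` of type `C_n^{(1)}`. -/
def cartan (n : ℕ) (i j : Fin (n + 1)) : ℤ :=
  if i = j then 2
  else if i.val + 1 = j.val ∨ j.val + 1 = i.val then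
    (if (i.val = 1 ∧ j.val = 0) ∨ (i.val + 1 = n ∧ j.val = n) then -2 else -1)
  else 0

/-- The symmetrizing integers `s_0 = s_n = 2`, and `s_i = 1` otherwise. -/
def sInt (n : ℕ) (i : Fin (n + 1)) : ℕ := if i.val = 0 ∨ i.val = n then 2 else 1

/-- `q_i = q^{s_i}`. -/
def qi (n : ℕ) (i : Fin (n + 1)) : Qq := q ^ sInt n i

/-- `P^∨ = ⨁ ℤ h_i ⊕ ℤ d`. -/
abbrev Coweight (n : ℕ) : Type := (Fin (n + 1) → ℤ) × ℤ

/-- The element `h_i` of `P^∨`. -/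
def hElt (n : ℕ) (i : Fin (n + 1)) : Coweight n := (Pi.single i 1, 0)

/-- The weight lattice `P`: an element of `𝔥^*` that is integral on `P^∨` is the same as a
homomorphism `P^∨ → ℤ`. -/
abbrev Weight (n : ℕ) : Type := Module.Dual ℤ (Coweight n)

/-- The simple root `α_j`, with `α_j(h_i) = a_{ij}` and `α_j(d) = δ_{0j}`. -/
def simpleRoot (n : ℕ) (j : Fin (n + 1)) : Weight n :=
  ∑ i, cartan n i j • (LinearMap.proj i ∘ₗ LinearMap.fst ℤ (Fin (n + 1) → ℤ) ℤ)
    + (if j = 0 then (1 : ℤ) else 0) • LinearMap.snd ℤ (Fin (n + 1) → ℤ) ℤ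

/-! ## The quantized enveloping algebra `U_q(𝔤)` -/

/-- Generators of `U_q(𝔤)`. -/
inductive Gen (n : ℕ) : Type
  | e (i : Fin (n + 1)) : Gen n
  | f (i : Fin (n + 1)) : Gen n
  | qpow (h : Coweight n) : Gen n

/-- Generators inside the free algebra. -/
abbrev ge (n : ℕ) (i : Fin (n + 1)) : FreeAlgebra Qq (Gen n) := FreeAlgebra.ι Qq (Gen.e i)
abbrev gf (n : ℕ) (i : Fin (n + 1)) : FreeAlgebra Qq (Gen n) := FreeAlgebra.ι Qq (Gen.f i)
abbrev gq (n : ℕ) (h : Coweight n) : FreeAlgebra Qq (Gen n) := FreeAlgebra.ι Qq (Gen.qpow h)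

/-- The quantum Serre element
`∑_{r=0}^{1-a_{ij}} (-1)^r [1-a_{ij} choose r]_{q_i} x_i^{1-a_{ij}-r} x_j x_i^r`. -/
def serre (n : ℕ) (x : Fin (n + 1) → FreeAlgebra Qq (Gen n)) (i j : Fin (n + 1)) :
    FreeAlgebra Qq (Gen n) :=
  ∑ r ∈ Finset.range ((1 - cartan n i j).toNat + 1),
    ((-1) ^ r * qBinom (qi n i) (1 - cartan n i j).toNat r) •
      (x i ^ ((1 - cartan n i j).toNat - r) * x j * x i ^ r)

/-- The defining relations of `U_q(𝔤)`. -/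
inductive Rel (n : ℕ) : FreeAlgebra Qq (Gen n) → FreeAlgebra Qq (Gen n) → Prop
  | qpow_zero : Rel n (gq n 0) 1
  | qpow_add (h h' : Coweight n) : Rel n (gq n h * gq n h') (gq n (h + h'))
  | qpow_e (h : Coweight n) (i : Fin (n + 1)) :
      Rel n (gq n h * ge n i * gq n (-h)) (q ^ (simpleRoot n i h) • ge n i)
  | qpow_f (h : Coweight n) (i : Fin (n + 1)) :
      Rel n (gq n h * gf n i * gq n (-h)) (q ^ (-simpleRoot n i h) • gf n i)
  | e_f_same (i : Fin (n + 1)) :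
      Rel n (ge n i * gf n i - gf n i * ge n i)
        ((qi n i - (qi n i)⁻¹)⁻¹ •
          (gq n ((sInt n i : ℤ) • hElt n i) - gq n (-((sInt n i : ℤ) • hElt n i))))
  | e_f_ne (i j : Fin (n + 1)) (hij : i ≠ j) :
      Rel n (ge n i * gf n j - gf n j * ge n i) 0
  | serre_e (i j : Fin (n + 1)) (hij : i ≠ j) : Rel n (serre n (ge n) i j) 0
  | serre_f (i j : Fin (n + 1)) (hij : i ≠ j) : Rel n (serre n (gf n) i j) 0

/-- The quantized universal enveloping algebra `U_q(𝔤)`, `𝔤` of type `C_n^{(1)}`. -/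
abbrev Uq (n : ℕ) : Type := RingQuot (Rel n)

/-- The generators `e_i`, `f_i`, `q^h` of `U_q(𝔤)`. -/
def Uq.e (n : ℕ) (i : Fin (n + 1)) : Uq n := RingQuot.mkAlgHom Qq (Rel n) (ge n i)
def Uq.f (n : ℕ) (i : Fin (n + 1)) : Uq n := RingQuot.mkAlgHom Qq (Rel n) (gf n i)
def Uq.qpow (n : ℕ) (h : Coweight n) : Uq n := RingQuot.mkAlgHom Qq (Rel n) (gq n h)

/-! ## Integrable modules and crystal bases

A `U_q(𝔤)`-module is a `ℚ(q)`-vector space `M` with an algebra homomorphism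
`ρ : U_q(𝔤) → End M`. -/

section Modules

variable {n : ℕ} {M : Type*} [AddCommGroup M] [Module Qq M]

/-- The weight space `M_μ = {u : q^h u = q^{μ(h)} u for all h ∈ P^∨}`. -/
def weightSpace (ρ : Uq n →ₐ[Qq] Module.End Qq M) (μ : Weight n) : Submodule Qq M where
  carrier := {u | ∀ h : Coweight n, ρ (Uq.qpow n h) u = q ^ (μ h) • u}
  add_mem' := by
    intro u v hu hv h
    rw [map_add, hu h, hv h, smul_add]
  zero_mem' := by
    intro h
    rw [map_zero, smul_zero]
  smul_mem' := by
    intro c u hu h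
    rw [map_smul, hu h, smul_comm]

/-- Integrable modules: the category `𝒪_int`. -/
structure IsIntegrable (ρ : Uq n →ₐ[Qq] Module.End Qq M) : Prop where
  /-- `M` is the direct sum of its weight spaces. -/
  indep : iSupIndep (weightSpace ρ)
  iSup_eq_top : ⨆ μ, weightSpace ρ μ = ⊤
  /-- The weight spaces are finite dimensional. -/
  finite : ∀ μ, Module.Finite Qq (weightSpace ρ μ)
  /-- For each `i`, `M` is the union of its finite dimensional submodules over the subalgebra
  generated by `e_i`, `f_i`, `q^{h_i}`, `q^{-h_i}`. -/
  locally_finite : ∀ (i : Fin (n + 1)) (u : M), ∃ N : Submodule Qq M, u ∈ N ∧ Module.Finite Qq N ∧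
    ∀ v ∈ N, ρ (Uq.e n i) v ∈ N ∧ ρ (Uq.f n i) v ∈ N ∧
      ρ (Uq.qpow n (hElt n i)) v ∈ N ∧ ρ (Uq.qpow n (-hElt n i)) v ∈ N
  /-- All weights lie in `F + Q_-` for a finite set `F`. -/
  bounded : ∃ F : Finset (Weight n), ∀ μ, weightSpace ρ μ ≠ ⊥ →
    ∃ ν ∈ F, ∃ c : Fin (n + 1) → ℕ, μ = ν - ∑ i, c i • simpleRoot n i

/-- The divided power `f_i^{(m)} = f_i^m / [m]_{q_i}!` acting on `M`. -/
def fDiv (ρ : Uq n →ₐ[Qq] Module.End Qq M) (i : Fin (n + 1)) (m : ℕ) : Module.End Qq M :=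
  (qFact (qi n i) m)⁻¹ • (ρ (Uq.f n i)) ^ m

/-- `et`, `ft` are the upper Kashiwara operators `ẽ_i`, `f̃_i` on `M`.  When `M` is integrable it is
spanned by the vectors `f_i^{(m)} u`, with `u` a weight vector killed by `e_i`, of weight `μ` with
`μ(h_i) = l`, and `m ≤ l`; so `et` and `ft` are determined by these conditions. -/
structure IsUpperKashiwara (ρ : Uq n →ₐ[Qq] Module.End Qq M) (i : Fin (n + 1))
    (et ft : Module.End Qq M) : Prop where
  e_zero : ∀ (μ : Weight n) (u : M), u ∈ weightSpace ρ μ → ρ (Uq.e n i) u = 0 → et u = 0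
  e_succ : ∀ (μ : Weight n) (u : M), u ∈ weightSpace ρ μ → ρ (Uq.e n i) u = 0 →
    ∀ l m : ℕ, μ (hElt n i) = l → m < l →
      et (fDiv ρ i (m + 1) u) =
        (qInt (qi n i) (l - m) / qInt (qi n i) (m + 1)) • fDiv ρ i m u
  f_lt : ∀ (μ : Weight n) (u : M), u ∈ weightSpace ρ μ → ρ (Uq.e n i) u = 0 →
    ∀ l m : ℕ, μ (hElt n i) = l → m < l →
      ft (fDiv ρ i m u) =
        (qInt (qi n i) (m + 1) / qInt (qi n i) (l - m)) • fDiv ρ i (m + 1) u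
  f_last : ∀ (μ : Weight n) (u : M), u ∈ weightSpace ρ μ → ρ (Uq.e n i) u = 0 →
    ∀ l : ℕ, μ (hElt n i) = l → ft (fDiv ρ i l u) = 0

/-- `et`, `ft` are the lower Kashiwara operators `ẽ_i`, `f̃_i` on `M`; they are again determined by
these conditions when `M` is integrable. -/
structure IsLowerKashiwara (ρ : Uq n →ₐ[Qq] Module.End Qq M) (i : Fin (n + 1))
    (et ft : Module.End Qq M) : Prop where
  e_zero : ∀ (μ : Weight n) (u : M), u ∈ weightSpace ρ μ → ρ (Uq.e n i) u = 0 → et u = 0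
  e_succ : ∀ (μ : Weight n) (u : M), u ∈ weightSpace ρ μ → ρ (Uq.e n i) u = 0 →
    ∀ l m : ℕ, μ (hElt n i) = l → m < l → et (fDiv ρ i (m + 1) u) = fDiv ρ i m u
  f_lt : ∀ (μ : Weight n) (u : M), u ∈ weightSpace ρ μ → ρ (Uq.e n i) u = 0 →
    ∀ l m : ℕ, μ (hElt n i) = l → m < l → ft (fDiv ρ i m u) = fDiv ρ i (m + 1) u
  f_last : ∀ (μ : Weight n) (u : M), u ∈ weightSpace ρ μ → ρ (Uq.e n i) u = 0 →
    ∀ l : ℕ, μ (hElt n i) = l → ft (fDiv ρ i l u) = 0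

/-- The submodule `qL` of `L`. -/
def qMul (L : Submodule A M) : Submodule A L := LinearMap.range (LinearMap.lsmul A L qA)

/-- The space `L / qL`. -/
abbrev ModQ (L : Submodule A M) : Type _ := L ⧸ qMul L

/-- The operator on `L / qL` induced by an operator `T` on `M` with `T L ⊆ L`. -/
def inducedOp (L : Submodule A M) (T : Module.End Qq M) (hT : ∀ x ∈ L, T x ∈ L) :
    ModQ L →ₗ[A] ModQ L :=
  (qMul L).mapQ (qMul L) ((T.restrictScalars A).restrict hT) (by
    rintro _ ⟨x, rfl⟩
    refine ⟨(T.restrictScalars A).restrict hT x, ?_⟩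
    simp only [LinearMap.lsmul_apply, map_smul])

variable [Module ℚ M] [IsScalarTower ℚ Qq M]

/-- The conditions on a pair `(L, B)`, `B ⊆ L / qL`, relative to operators `ẽ_i`, `f̃_i`. -/
structure IsCrystalPair (ρ : Uq n →ₐ[Qq] Module.End Qq M)
    (et ft : Fin (n + 1) → Module.End Qq M) (L : Submodule A M) (B : Set (ModQ L)) : Prop where
  /-- `L` is a free `A`-module with `ℚ(q) ⊗_A L ≅ M`. -/
  free : Module.Free A L
  baseChange : IsBaseChange Qq L.subtype
  /-- `B` is a basis of the `ℚ`-vector space `L / qL`. -/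
  linearIndependent : LinearIndependent ℚ (fun b : B => (b : ModQ L))
  span_eq_top : Submodule.span ℚ B = ⊤
  /-- `L` and `B ∪ {0}` are stable under `ẽ_i`, `f̃_i`. -/
  e_lattice : ∀ i, ∀ x ∈ L, et i x ∈ L
  f_lattice : ∀ i, ∀ x ∈ L, ft i x ∈ L
  e_basis : ∀ i, ∀ b ∈ B, inducedOp L (et i) (e_lattice i) b ∈ B ∪ {0}
  f_basis : ∀ i, ∀ b ∈ B, inducedOp L (ft i) (f_lattice i) b ∈ B ∪ {0}
  /-- `L` is the direct sum of the `L_μ = L ∩ M_μ`. -/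
  weight_indep : iSupIndep fun μ => L ⊓ (weightSpace ρ μ).restrictScalars A
  weight_iSup : ⨆ μ, L ⊓ (weightSpace ρ μ).restrictScalars A = L
  /-- `B` is the disjoint union of the `B_μ = B ∩ (L_μ / qL_μ)`. -/
  basis_weight : ∀ b ∈ B, ∃! μ : Weight n,
    ∃ x : L, (x : M) ∈ weightSpace ρ μ ∧ (qMul L).mkQ x = b
  /-- `b' = f̃_i b` if and only if `b = ẽ_i b'`. -/
  e_iff_f : ∀ i, ∀ b ∈ B, ∀ b' ∈ B,
    b' = inducedOp L (ft i) (f_lattice i) b ↔ b = inducedOp L (et i) (e_lattice i) b'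

/-- `(L, B)` is an upper crystal base of the integrable module `(M, ρ)`. -/
def IsUpperCrystalBase (ρ : Uq n →ₐ[Qq] Module.End Qq M)
    (L : Submodule A M) (B : Set (ModQ L)) : Prop :=
  ∃ et ft : Fin (n + 1) → Module.End Qq M,
    (∀ i, IsUpperKashiwara ρ i (et i) (ft i)) ∧ IsCrystalPair ρ et ft L B

/-- `(L, B)` is a lower crystal base of the integrable module `(M, ρ)`. -/
def IsLowerCrystalBase (ρ : Uq n →ₐ[Qq] Module.End Qq M)
    (L : Submodule A M) (B : Set (ModQ L)) : Prop :=
  ∃ et ft : Fin (n + 1) → Module.End Qq M,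
    (∀ i, IsLowerKashiwara ρ i (et i) (ft i)) ∧ IsCrystalPair ρ et ft L B

end Modules

/-! ## Young diagrams of charge `k` and the Fock space -/

/-- A Young diagram of charge `k`: a weakly increasing integer sequence `y_0 ≤ y_1 ≤ …` that is
eventually equal to `k`. Its boxes are the `(l, m)` (the unit square with right edge `x = l + 1` and
top edge `y = m`) with `y_l < m ≤ k`. -/
@[ext]
structure Diagram (k : ℕ) : Type where
  y : ℕ → ℤ
  le_succ : ∀ l, y l ≤ y (l + 1)
  eventually_eq : ∃ N, ∀ l, N ≤ l → y l = k

/-- The site or box with coordinate sum `m` has colour `i` if `m ≡ ± i mod 2n`. -/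
def HasColour (n : ℕ) (i : Fin (n + 1)) (m : ℤ) : Prop :=
  m ≡ (i.val : ℤ) [ZMOD (2 * n : ℤ)] ∨ m ≡ -(i.val : ℤ) [ZMOD (2 * n : ℤ)]

/-- The sites `(l, y)` of colour `i`. -/
def sites (n : ℕ) (i : Fin (n + 1)) : Set (ℕ × ℤ) := {s | HasColour n i (s.1 + s.2)}

/-- The order on sites: `s < t` means `l + y < l' + y'`. -/
def siteLT (s t : ℕ × ℤ) : Prop := (s.1 : ℤ) + s.2 < t.1 + t.2

section Fock

variable {k : ℕ}

/-- `Y` has a concave corner at the site `s`: `s = (0, y_0)`, or `s = (l + 1, y_{l+1})` with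
`y_l ≠ y_{l+1}`. -/
def Diagram.IsConcave (Y : Diagram k) (s : ℕ × ℤ) : Prop :=
  Y.y s.1 = s.2 ∧ (s.1 = 0 ∨ Y.y (s.1 - 1) ≠ Y.y s.1)

/-- `Y` has a convex corner at the site `s`: `s = (l + 1, y_l)` with `y_l ≠ y_{l+1}`. -/
def Diagram.IsConvex (Y : Diagram k) (s : ℕ × ℤ) : Prop :=
  1 ≤ s.1 ∧ Y.y (s.1 - 1) = s.2 ∧ Y.y (s.1 - 1) ≠ Y.y s.1

/-- Remove the convex corner at `s = (l + 1, y_l)`: replace `y_l` by `y_l + 1`. -/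
def Diagram.remove (Y : Diagram k) (s : ℕ × ℤ) (hs : Y.IsConvex s) : Diagram k where
  y := Function.update Y.y (s.1 - 1) (s.2 + 1)
  le_succ := by
    obtain ⟨h1, h2, h3⟩ := hs
    intro l
    have ha := Y.le_succ l
    have hb := Y.le_succ (s.1 - 1)
    rw [Nat.sub_add_cancel h1] at hb
    simp only [Function.update_apply]
    split_ifs with c1 c2 c2
    · omega
    · have : l + 1 = s.1 := by omega
      rw [this]
      omega
    · rw [c2] at ha
      omega
    · exact ha
  eventually_eq := by
    obtain ⟨N, hN⟩ := Y.eventually_eq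
    refine ⟨max N (s.1 + 1), fun l hl => ?_⟩
    rw [Function.update_apply, if_neg (by omega)]
    exact hN l (by omega)

/-- Fill the concave corner at `s = (l, y_l)`, creating a convex corner at `(l + 1, y_l - 1)`:
replace `y_l` by `y_l - 1`. -/
def Diagram.add (Y : Diagram k) (s : ℕ × ℤ) (hs : Y.IsConcave s) : Diagram k where
  y := Function.update Y.y s.1 (s.2 - 1)
  le_succ := by
    obtain ⟨h1, h2⟩ := hs
    intro l
    have ha := Y.le_succ l
    simp only [Function.update_apply]
    split_ifs with c1 c2 c2
    · omega
    · subst c1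
      omega
    · have hl : s.1 - 1 = l := by omega
      rw [hl, ← c2] at h2
      rw [← c2] at h1
      omega
    · exact ha
  eventually_eq := by
    obtain ⟨N, hN⟩ := Y.eventually_eq
    refine ⟨max N (s.1 + 1), fun l hl => ?_⟩
    rw [Function.update_apply, if_neg (by omega)]
    exact hN l (by omega)

/-- The Fock space `ℱ(Λ_k)`: the `ℚ(q)`-vector space with basis the Young diagrams of charge `k`. -/
abbrev Fock (k : ℕ) : Type := Diagram k →₀ Qq

/-- The linear operator on the Fock space with given values on the basis of diagrams. -/
def extend (g : Diagram k → Fock k) : Module.End Qq (Fock k) := Finsupp.linearCombination Qq g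

open Classical in
/-- `E_{(l,y)}`. -/
def EBox (s : ℕ × ℤ) : Module.End Qq (Fock k) :=
  extend fun Y => if h : Y.IsConvex s then Finsupp.single (Y.remove s h) 1 else 0

open Classical in
/-- `F_{(l,y)}`. -/
def FBox (s : ℕ × ℤ) : Module.End Qq (Fock k) :=
  extend fun Y => if h : Y.IsConcave s then Finsupp.single (Y.add s h) 1 else 0

open Classical in
/-- `1`, `-1` or `0` according to whether `Y` has a concave corner, a convex corner or no corner
at `s`. For a site `s` of colour `i`, `T_s^± Y = q_i^{± cornerSign Y s} Y`. -/
def cornerSign (Y : Diagram k) (s : ℕ × ℤ) : ℤ :=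
  if Y.IsConcave s then 1 else if Y.IsConvex s then -1 else 0

/-- The operator `∏_{s ∈ S} T_s^ε`, for a set `S` of sites of colour `i` and a sign `ε = ±1`.
On each diagram only finitely many factors differ from `1`. -/
def TProd (n : ℕ) (i : Fin (n + 1)) (ε : ℤ) (S : Set (ℕ × ℤ)) : Module.End Qq (Fock k) :=
  extend fun Y => (∏ᶠ s ∈ S, qi n i ^ (ε * cornerSign Y s)) • Finsupp.single Y 1

/-- `E_i = ∑_s (∏_{t > s} T_t^+) E_s`, over sites `s`, `t` of colour `i`. On each diagram the sum is
finite. -/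
def EUpper (n : ℕ) (i : Fin (n + 1)) : Module.End Qq (Fock k) :=
  extend fun Y => ∑ᶠ s ∈ sites n i,
    TProd n i 1 {t | t ∈ sites n i ∧ siteLT s t} (EBox s (Finsupp.single Y 1))

/-- `F_i = ∑_s (∏_{t < s} T_t^-) F_s`, over sites `s`, `t` of colour `i`. -/
def FUpper (n : ℕ) (i : Fin (n + 1)) : Module.End Qq (Fock k) :=
  extend fun Y => ∑ᶠ s ∈ sites n i,
    TProd n i (-1) {t | t ∈ sites n i ∧ siteLT t s} (FBox s (Finsupp.single Y 1))

/-- The modified `E_i = ∑_s (∏_{t < s} T_t^-) E_s`, over sites `s`, `t` of colour `i`. -/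
def ELower (n : ℕ) (i : Fin (n + 1)) : Module.End Qq (Fock k) :=
  extend fun Y => ∑ᶠ s ∈ sites n i,
    TProd n i (-1) {t | t ∈ sites n i ∧ siteLT t s} (EBox s (Finsupp.single Y 1))

/-- The modified `F_i = ∑_s (∏_{t > s} T_t^+) F_s`, over sites `s`, `t` of colour `i`. -/
def FLower (n : ℕ) (i : Fin (n + 1)) : Module.End Qq (Fock k) :=
  extend fun Y => ∑ᶠ s ∈ sites n i,
    TProd n i 1 {t | t ∈ sites n i ∧ siteLT s t} (FBox s (Finsupp.single Y 1))

/-- The number of concave minus the number of convex `i`-coloured corners of `Y`. -/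
def cornerDiff (n : ℕ) (i : Fin (n + 1)) (Y : Diagram k) : ℤ := ∑ᶠ s ∈ sites n i, cornerSign Y s

/-- The number of `0`-coloured boxes of `Y`. -/
def zeroBoxes (n : ℕ) (Y : Diagram k) : ℕ :=
  Set.ncard {s : ℕ × ℤ | Y.y s.1 < s.2 ∧ s.2 ≤ k ∧ HasColour n 0 (s.1 + s.2)}

/-- The action of `q^h`: `q^{h_i} Y = q^{c} Y` with `c` the number of concave minus the number of
convex `i`-coloured corners (so that `q^{s_i h_i}` acts as `T_i = ∏_s T_s^+`), and
`q^d Y = q^{-b} Y` with `b` the number of `0`-coloured boxes. -/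
def qpowOp (n : ℕ) (h : Coweight n) : Module.End Qq (Fock k) :=
  extend fun Y =>
    q ^ ((∑ i, h.1 i * cornerDiff n i Y) - h.2 * (zeroBoxes n Y : ℤ)) • Finsupp.single Y 1

/-- The lattice `L = ∑_Y A Y`. -/
def lattice (k : ℕ) : Submodule A (Fock k) :=
  Submodule.span A (Set.range fun Y : Diagram k => Finsupp.single Y (1 : Qq))

/-- The class `Y + qL`. -/
def diagramClass (Y : Diagram k) : ModQ (lattice k) :=
  (qMul (lattice k)).mkQ ⟨Finsupp.single Y 1, Submodule.subset_span ⟨Y, rfl⟩⟩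

/-- The set `B` of all classes `Y + qL`. -/
def diagramBasis (k : ℕ) : Set (ModQ (lattice k)) := Set.range diagramClass

end Fock

end FockC

end

open FockC

/-!
The Fock space carries the asserted crystal bases because, for each colour `i`, it is a direct sum of
tensor powers of the two-dimensional module of `U_{q_i}(sl_2)`.

A diagram `Y` is determined by the set of integers `l + y_l` (the "beads"), and its corners are the
integers `m` at which the indicator function of this set jumps. So a diagram is encoded by the
finitely supported function `Diagram.corner : ℤ →₀ ℤ` with values `1` (concave), `-1` (convex) and
`0`, and removing the convex corner at `m` adds `2δ_m - δ_{m-1} - δ_{m+1}` to it. Two corners of the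
same colour are never adjacent. Hence moves of colour `i` keep the set of places of the `i`-coloured
corners and only flip signs: the diagrams with given `i`-coloured corner places and given other data
span a tensor power of `V(1)`, on which `E_i`, `F_i` act through the coproduct.

Adding the tensor factors one at a time and decomposing `V(1) ⊗ V(l)` by Clebsch–Gordan
(`clebsch`) gives a change of basis `stringsEquiv`. It is the identity modulo `q`, preserves the
lattice together with its inverse, and turns the diagrams into vectors `G_Y` with
`E_i G_Y = [ε(Y)] G_{ẽY}` and `F_i G_Y = [φ(Y)] G_{f̃Y}` (`EUpper_strings`, `FUpper_strings`), where
`ẽ`, `f̃` are given by the signature rule. Everything about one index `i` follows from such a basis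
(`StringBasis`): the relation between `e_i` and `f_i`, local finiteness, the explicit form of both
kinds of Kashiwara operators, and the quantum Serre relations. For the latter, the Serre element in
`e_i`, `e_j` commutes with `f_i` and raises the `h_i`-weight of a highest weight vector to a degree in
which a large power of `f_i` is still injective (`StringBasis.serreOp_eq_zero`).

For `i ≠ j` the relation `E_i F_j = F_j E_i` is checked corner by corner. The modified operators are
`E_i' = q_i k_i⁻¹ E_i` and `F_i' = q_i k_i F_i`, and `q_i^{ε(Y) φ(Y)} G_Y` is a basis of strings for
them (`StringBasis.twist`). In terms of the `G_Y`, the upper operators `ẽ_i`, `f̃_i` of the first action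
have coefficients `1` and the lower ones of the second action have coefficients in `1 + qA`
(`oneModQ_lower`), so both permute the diagrams modulo `q`. Weight spaces are finite dimensional
since the number of boxes of colour `0` bounds the first row and the first column of a diagram.
-/

noncomputable section

namespace FockC

/-! ### Quantum integers and the ring `A` -/

/-- `x` is nonzero and not a root of unity, so that no quantum integer `[m]_x`, `m > 0`,
vanishes. -/
def Generic (x : Qq) : Prop := x ≠ 0 ∧ ∀ m : ℕ, 0 < m → x ^ m ≠ 1

/-- The quantum integer `[z]_x` for an integer `z`. -/
def qIntZ (x : Qq) (z : ℤ) : Qq := (x ^ z - x ^ (-z)) / (x - x⁻¹)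

theorem qInt_eq (x : Qq) (m : ℕ) : qInt x m = qIntZ x m := by
  simp [qInt, qIntZ]

theorem Generic.ne_zero {x : Qq} (h : Generic x) : x ≠ 0 := h.1

theorem Generic.sub_inv_ne_zero {x : Qq} (h : Generic x) : x - x⁻¹ ≠ 0 := by
  intro h0
  apply h.2 2 (by norm_num)
  have : x = x⁻¹ := sub_eq_zero.1 h0
  nth_rewrite 1 [pow_two, this]
  exact inv_mul_cancel₀ h.1

theorem Generic.qInt_ne_zero {x : Qq} (h : Generic x) {m : ℕ} (hm : 0 < m) : qInt x m ≠ 0 := by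
  refine div_ne_zero ?_ h.sub_inv_ne_zero
  intro h0
  apply h.2 (m + m) (by omega)
  have : x ^ m = x⁻¹ ^ m := sub_eq_zero.1 h0
  rw [pow_add]
  nth_rewrite 1 [this]
  rw [← mul_pow, inv_mul_cancel₀ h.1, one_pow]

theorem qInt_zero (x : Qq) : qInt x 0 = 0 := by simp [qInt]

theorem Generic.qInt_one {x : Qq} (h : Generic x) : qInt x 1 = 1 := by
  simp [qInt, div_self h.sub_inv_ne_zero]

theorem qFact_succ (x : Qq) (m : ℕ) : qFact x (m + 1) = qFact x m * qInt x (m + 1) := by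
  simp [qFact, Finset.prod_range_succ]

theorem Generic.qFact_ne_zero {x : Qq} (h : Generic x) (m : ℕ) : qFact x m ≠ 0 :=
  Finset.prod_ne_zero_iff.2 fun _ _ => h.qInt_ne_zero (Nat.succ_pos _)

theorem qBinom_succ_mul {x : Qq} (h : Generic x) {N r : ℕ} (hr : r < N) :
    qBinom x N (r + 1) * qInt x (r + 1) = qBinom x N r * qInt x (N - r) := by
  obtain ⟨d, rfl⟩ : ∃ d, N = r + 1 + d := ⟨N - (r + 1), by omega⟩
  have e1 : r + 1 + d - (r + 1) = d := by omega
  have e2 : r + 1 + d - r = d + 1 := by omega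
  rw [qBinom, qBinom, e1, e2, qFact_succ x r, qFact_succ x d]
  have := h.qFact_ne_zero r
  have := h.qFact_ne_zero d
  have := h.qInt_ne_zero (Nat.succ_pos r)
  have := h.qInt_ne_zero (Nat.succ_pos d)
  field_simp

theorem qIntZ_neg (x : Qq) (z : ℤ) : qIntZ x (-z) = -qIntZ x z := by
  simp only [qIntZ, neg_neg]; ring

theorem qIntZ_add {x : Qq} (h : x ≠ 0) (a b : ℤ) :
    qIntZ x (a + b) = x ^ (-a) * qIntZ x b + x ^ b * qIntZ x a := by
  simp only [qIntZ, neg_add, zpow_add₀ h]; ring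

/-- The commutator identity behind `[e^m, f]` on a weight vector. -/
theorem qIntZ_mul_sub {x : Qq} (h : x ≠ 0) (a b : ℤ) :
    qIntZ x (a + 1) * qIntZ x b - qIntZ x a * qIntZ x (b + 1) = qIntZ x 1 * qIntZ x (b - a) := by
  simp only [qIntZ, div_mul_div_comm, ← sub_div]
  congr 1
  have h1 := zpow_ne_zero a h
  have h2 := zpow_ne_zero b h
  simp only [neg_add, neg_sub, zpow_add₀ h, zpow_sub₀ h, zpow_neg, zpow_one]
  field_simp
  ring

theorem Generic.qIntZ_one {x : Qq} (h : Generic x) : qIntZ x 1 = 1 := by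
  simpa [qInt_eq] using h.qInt_one

theorem q_ne_zero : q ≠ 0 := RatFunc.X_ne_zero

theorem q_pow_eq (m : ℕ) : q ^ m = algebraMap (Polynomial ℚ) Qq (Polynomial.X ^ m) := by
  simp [q]

theorem q_pow_injective : Function.Injective fun m : ℕ => q ^ m := by
  intro a b hab
  simp only [q_pow_eq] at hab
  have := congrArg Polynomial.natDegree (RatFunc.algebraMap_injective ℚ hab)
  simpa using this

theorem q_zpow_injective : Function.Injective fun z : ℤ => q ^ z := by
  have key : ∀ z : ℤ, q ^ z = 1 → z = 0 := by
    intro z hz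
    rcases Int.eq_nat_or_neg z with ⟨m, rfl | rfl⟩
    · have : m = 0 := q_pow_injective (by simpa using hz)
      simp [this]
    · have : m = 0 := q_pow_injective (by simpa using hz)
      simp [this]
  intro a b hab
  have : q ^ (a - b) = 1 := by
    rw [zpow_sub₀ q_ne_zero]
    exact div_eq_one_iff_eq (zpow_ne_zero _ q_ne_zero) |>.2 hab
  linarith [key _ this]

theorem generic_q_pow {s : ℕ} (hs : 0 < s) : Generic (q ^ s) := by
  refine ⟨pow_ne_zero _ q_ne_zero, fun m hm h => ?_⟩
  rw [← pow_mul] at h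
  have : s * m = 0 := q_pow_injective (by simpa using h)
  rcases Nat.mul_eq_zero.1 this with h | h <;> omega

theorem sInt_pos (n : ℕ) (i : Fin (n + 1)) : 0 < sInt n i := by
  unfold sInt; split_ifs <;> norm_num

theorem generic_qi (n : ℕ) (i : Fin (n + 1)) : Generic (qi n i) := generic_q_pow (sInt_pos n i)

theorem q_mem_A : q ∈ A := qA.2

theorem algebraMap_ne_zero_of_eval {p : Polynomial ℚ} (hp : p.eval 0 ≠ 0) :
    algebraMap (Polynomial ℚ) Qq p ≠ 0 := by
  intro h
  rw [map_eq_zero_iff _ (RatFunc.algebraMap_injective ℚ)] at h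
  simp [h] at hp

/-- The elements of `1 + qA`. -/
def OneModQ (r : Qq) : Prop := ∃ a ∈ A, r = 1 + q * a

theorem OneModQ.mem {r : Qq} (h : OneModQ r) : r ∈ A := by
  obtain ⟨a, ha, rfl⟩ := h
  exact add_mem (one_mem _) (mul_mem q_mem_A ha)

theorem oneModQ_one : OneModQ 1 := ⟨0, zero_mem _, by simp⟩

theorem OneModQ.mul {r r' : Qq} (h : OneModQ r) (h' : OneModQ r') : OneModQ (r * r') := by
  obtain ⟨a, ha, rfl⟩ := h
  obtain ⟨b, hb, rfl⟩ := h'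
  exact ⟨a + b + q * (a * b), add_mem (add_mem ha hb) (mul_mem q_mem_A (mul_mem ha hb)), by ring⟩

theorem OneModQ.inv {r : Qq} (h : OneModQ r) : OneModQ r⁻¹ := by
  obtain ⟨a, ⟨f, g, hg, rfl⟩, rfl⟩ := h
  have hg' : (g + Polynomial.X * f).eval 0 ≠ 0 := by simpa using hg
  refine ⟨_, ⟨-f, g + Polynomial.X * f, hg', rfl⟩, ?_⟩
  have h1 := algebraMap_ne_zero_of_eval hg
  have h2 := algebraMap_ne_zero_of_eval hg'
  have hX : q = algebraMap (Polynomial ℚ) Qq Polynomial.X := by simp [q]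
  rw [map_add, map_mul, ← hX] at h2 ⊢
  rw [map_neg]
  have e : 1 + q * (algebraMap (Polynomial ℚ) Qq f / algebraMap (Polynomial ℚ) Qq g) =
      (algebraMap (Polynomial ℚ) Qq g + q * algebraMap (Polynomial ℚ) Qq f) /
        algebraMap (Polynomial ℚ) Qq g := by field_simp
  rw [e, inv_div]
  field_simp
  ring

/-- `[p + 1]_x x^p = 1 + x^2 + ⋯ + x^{2p}` lies in `1 + qA` when `x` is a positive power
of `q`. -/
theorem oneModQ_qInt {s : ℕ} (hs : 0 < s) (p : ℕ) :
    OneModQ (qInt (q ^ s) (p + 1) * (q ^ s) ^ p) := by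
  have hx := generic_q_pow hs
  induction p with
  | zero => simpa [hx.qInt_one] using oneModQ_one
  | succ p ih =>
    obtain ⟨a, ha, h⟩ := ih
    obtain ⟨t, rfl⟩ : ∃ t, s = t + 1 := ⟨s - 1, by omega⟩
    set x := q ^ (t + 1) with hxd
    have h1 : qInt x (p + 1 + 1) = x⁻¹ * qInt x (p + 1) + x ^ (p + 1) := by
      rw [qInt_eq, qInt_eq, show (((p + 1 + 1 : ℕ)) : ℤ) = 1 + ((p + 1 : ℕ) : ℤ) by push_cast; ring,
        qIntZ_add hx.1, hx.qIntZ_one, zpow_natCast, zpow_neg, zpow_one, mul_one]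
    have h2 : x⁻¹ * x ^ (p + 1) = x ^ p := by
      rw [pow_succ', inv_mul_cancel_left₀ hx.1]
    refine ⟨a + q ^ t * x ^ p * x ^ (p + 1), add_mem ha ?_, ?_⟩
    · exact mul_mem (mul_mem (pow_mem q_mem_A _) (pow_mem (pow_mem q_mem_A _) _))
        (pow_mem (pow_mem q_mem_A _) _)
    · have h3 : x = q * q ^ t := by rw [hxd, pow_succ']
      calc qInt x (p + 1 + 1) * x ^ (p + 1)
          = qInt x (p + 1) * (x⁻¹ * x ^ (p + 1)) + x * x ^ p * x ^ (p + 1) := by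
            rw [h1, pow_succ' x p]; ring
        _ = _ := by rw [h2, h]; nth_rewrite 2 [h3]; ring

/-- The Clebsch–Gordan coefficient `x^{-e} [p+1] / [e+p+1]` lies in `1 + qA`. -/
theorem oneModQ_clebsch {s : ℕ} (hs : 0 < s) (e p : ℕ) :
    OneModQ ((q ^ s) ^ (-(e : ℤ)) * qInt (q ^ s) (p + 1) / qInt (q ^ s) (e + p + 1)) := by
  have hx := generic_q_pow hs
  convert (oneModQ_qInt hs p).mul (oneModQ_qInt hs (e + p)).inv using 1
  have := hx.qInt_ne_zero (Nat.succ_pos (e + p))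
  have := hx.1
  rw [zpow_neg, zpow_natCast, pow_add]
  field_simp

/-- The Clebsch–Gordan coefficient `[e] / [e+p+1]` lies in `qA`. -/
theorem qInt_div_mem {s : ℕ} (hs : 0 < s) (e p : ℕ) :
    ∃ a ∈ A, qInt (q ^ s) e / qInt (q ^ s) (e + p + 1) = q * a := by
  have hx := generic_q_pow hs
  cases e with
  | zero => exact ⟨0, zero_mem _, by simp [qInt_zero]⟩
  | succ e =>
    have h1 := (oneModQ_qInt hs e).mul (oneModQ_qInt hs (e + 1 + p)).inv
    obtain ⟨t, rfl⟩ : ∃ t, s = t + 1 := ⟨s - 1, by omega⟩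
    refine ⟨_, mul_mem h1.mem (mul_mem (pow_mem q_mem_A t)
      (pow_mem (pow_mem q_mem_A (t + 1)) (p))), ?_⟩
    have h3 : q ^ (t + 1) = q * q ^ t := by rw [pow_succ']
    have := hx.qInt_ne_zero (Nat.succ_pos (e + 1 + p))
    have := hx.1
    have h4 : (q ^ (t + 1)) ^ (e + 1 + p) =
        (q ^ (t + 1)) ^ e * (q * q ^ t) * (q ^ (t + 1)) ^ p := by
      rw [← h3]; ring
    rw [mul_inv, h4]
    have := q_ne_zero
    field_simp

/-! ### Diagrams as configurations of beads on the integers -/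

section Beads

variable {k : ℕ}

/-- The position `l + y_l` of the `l`-th bead. -/
def Diagram.pos (Y : Diagram k) (l : ℕ) : ℤ := l + Y.y l

theorem Diagram.pos_strictMono (Y : Diagram k) : StrictMono Y.pos := by
  refine strictMono_nat_of_lt_succ fun l => ?_
  have := Y.le_succ l
  simp only [Diagram.pos]; push_cast; omega

/-- There is a bead at the integer `m`. -/
def Diagram.Bead (Y : Diagram k) (m : ℤ) : Prop := m ∈ Set.range Y.pos

theorem Diagram.ext_bead {Y Z : Diagram k} (h : ∀ m, Y.Bead m ↔ Z.Bead m) : Y = Z := by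
  have := (Y.pos_strictMono.range_inj Z.pos_strictMono).1 (Set.ext h)
  ext l
  have := congrFun this l
  simp only [Diagram.pos] at this
  omega

theorem Diagram.bead_large (Y : Diagram k) : ∃ N : ℤ, ∀ m, N ≤ m → Y.Bead m := by
  obtain ⟨N, hN⟩ := Y.eventually_eq
  refine ⟨N + k, fun m hm => ⟨(m - k).toNat, ?_⟩⟩
  simp only [Diagram.pos]
  rw [hN _ (by omega)]; omega

theorem Diagram.not_bead_small (Y : Diagram k) {m : ℤ} (hm : m < Y.y 0) : ¬ Y.Bead m := by
  rintro ⟨l, rfl⟩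
  have := Y.pos_strictMono.monotone (Nat.zero_le l)
  simp only [Diagram.pos, Nat.cast_zero] at this hm
  omega

theorem Diagram.isConcave_iff (Y : Diagram k) (s : ℕ × ℤ) :
    Y.IsConcave s ↔ Y.pos s.1 = s.1 + s.2 ∧ ¬ Y.Bead (s.1 + s.2 - 1) := by
  obtain ⟨l, y⟩ := s
  simp only [Diagram.IsConcave]
  constructor
  · rintro ⟨h1, h2⟩
    refine ⟨by simp [Diagram.pos, h1], ?_⟩
    rintro ⟨j, hj⟩
    have hjl : j < l := Y.pos_strictMono.lt_iff_lt.1 (by simp only [Diagram.pos] at *; omega)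
    have h3 := Y.pos_strictMono.monotone (show j ≤ l - 1 by omega)
    have h4 := Y.le_succ (l - 1)
    rw [Nat.sub_add_cancel (by omega)] at h4
    simp only [Diagram.pos] at *
    omega
  · rintro ⟨h1, h2⟩
    refine ⟨by simp only [Diagram.pos] at h1; omega, ?_⟩
    by_contra! h
    apply h2
    refine ⟨l - 1, ?_⟩
    simp only [Diagram.pos] at *
    omega

theorem Diagram.isConvex_iff (Y : Diagram k) (s : ℕ × ℤ) :
    Y.IsConvex s ↔ 1 ≤ s.1 ∧ Y.pos (s.1 - 1) = s.1 + s.2 - 1 ∧ ¬ Y.Bead (s.1 + s.2) := by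
  obtain ⟨l, y⟩ := s
  simp only [Diagram.IsConvex]
  constructor
  · rintro ⟨h0, h1, h2⟩
    refine ⟨h0, by simp only [Diagram.pos]; omega, ?_⟩
    rintro ⟨j, hj⟩
    have hjl : l - 1 < j := Y.pos_strictMono.lt_iff_lt.1 (by simp only [Diagram.pos] at *; omega)
    have h3 := Y.pos_strictMono.monotone (show l ≤ j by omega)
    have h4 := Y.le_succ (l - 1)
    rw [Nat.sub_add_cancel (by omega)] at h4
    simp only [Diagram.pos] at *
    omega
  · rintro ⟨h0, h1, h2⟩
    refine ⟨h0, by simp only [Diagram.pos] at h1; omega, ?_⟩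
    intro h
    apply h2
    refine ⟨l, ?_⟩
    simp only [Diagram.pos] at *
    omega

/-- The antidiagonal `l + y` of the site `(l, y)`. -/
def siteSum (s : ℕ × ℤ) : ℤ := s.1 + s.2

open Classical in
/-- The number of beads at `m`. -/
def Diagram.occ (Y : Diagram k) (m : ℤ) : ℤ := if Y.Bead m then 1 else 0

theorem Diagram.occ_eq (Y : Diagram k) (m : ℤ) :
    (Y.Bead m ∧ Y.occ m = 1) ∨ (¬ Y.Bead m ∧ Y.occ m = 0) := by
  by_cases h : Y.Bead m <;> simp [Diagram.occ, h]

open Classical in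
theorem Diagram.occ_congr {Y Z : Diagram k} {m : ℤ} (h : Y.Bead m ↔ Z.Bead m) :
    Y.occ m = Z.occ m := if_congr h rfl rfl

/-- The corner on the antidiagonal `m`: `1`, `-1` or `0` according to whether it is concave,
convex or absent. An antidiagonal carries at most one corner. -/
def Diagram.corner (Y : Diagram k) : ℤ →₀ ℤ :=
  Finsupp.ofSupportFinite (fun m => Y.occ m - Y.occ (m - 1)) (by
    obtain ⟨N, hN⟩ := Y.bead_large
    refine (Set.finite_Icc (Y.y 0) N).subset fun m hm => ?_
    simp only [Function.mem_support] at hm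
    by_contra h
    simp only [Set.mem_Icc, not_and_or, not_le] at h
    apply hm
    rcases h with h | h
    · have h1 := Y.not_bead_small h
      have h2 := Y.not_bead_small (m := m - 1) (by omega)
      simp [Diagram.occ, h1, h2]
    · have h1 := hN m (by omega)
      have h2 := hN (m - 1) (by omega)
      simp [Diagram.occ, h1, h2])

theorem Diagram.corner_apply (Y : Diagram k) (m : ℤ) :
    Y.corner m = Y.occ m - Y.occ (m - 1) := rfl

theorem Diagram.corner_cases (Y : Diagram k) (m : ℤ) :
    Y.corner m = 1 ∨ Y.corner m = -1 ∨ Y.corner m = 0 := by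
  rw [Y.corner_apply]
  rcases Y.occ_eq m with h | h <;> rcases Y.occ_eq (m - 1) with h' | h' <;>
    simp [h.2, h'.2]

theorem Diagram.corner_eq_one (Y : Diagram k) (m : ℤ) :
    Y.corner m = 1 ↔ Y.Bead m ∧ ¬ Y.Bead (m - 1) := by
  rw [Y.corner_apply]
  rcases Y.occ_eq m with h | h <;> rcases Y.occ_eq (m - 1) with h' | h' <;>
    simp [h.1, h'.1, h.2, h'.2]

theorem Diagram.corner_eq_neg_one (Y : Diagram k) (m : ℤ) :
    Y.corner m = -1 ↔ ¬ Y.Bead m ∧ Y.Bead (m - 1) := by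
  rw [Y.corner_apply]
  rcases Y.occ_eq m with h | h <;> rcases Y.occ_eq (m - 1) with h' | h' <;>
    simp [h.1, h'.1, h.2, h'.2]

theorem Diagram.corner_injective : Function.Injective (Diagram.corner (k := k)) := by
  intro Y Z h
  obtain ⟨N, hN⟩ := Y.bead_large
  obtain ⟨N', hN'⟩ := Z.bead_large
  have key : ∀ j : ℕ, Y.occ (max N N' - j) = Z.occ (max N N' - j) := by
    intro j
    induction j with
    | zero =>
      have h1 := hN (max N N') (le_max_left _ _)
      have h2 := hN' (max N N') (le_max_right _ _)
      simp [Diagram.occ, h1, h2]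
    | succ j ih =>
      have := DFunLike.congr_fun h (max N N' - j)
      rw [Y.corner_apply, Z.corner_apply] at this
      rw [show max N N' - ((j + 1 : ℕ) : ℤ) = max N N' - j - 1 by push_cast; ring]
      linarith
  refine Diagram.ext_bead fun m => ?_
  by_cases hm : max N N' ≤ m
  · exact iff_of_true (hN m (le_trans (le_max_left _ _) hm))
      (hN' m (le_trans (le_max_right _ _) hm))
  · have := key (max N N' - m).toNat
    rw [show max N N' - ((max N N' - m).toNat : ℤ) = m by omega] at this
    rcases Y.occ_eq m with h | h <;> rcases Z.occ_eq m with h' | h' <;>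
      simp_all

/-- The change `2δ_m - δ_{m-1} - δ_{m+1}` of the corners when the convex corner on the
antidiagonal `m` is removed. -/
def rootVec (m : ℤ) : ℤ →₀ ℤ :=
  Finsupp.single m 2 - Finsupp.single (m - 1) 1 - Finsupp.single (m + 1) 1

theorem rootVec_apply (m m' : ℤ) :
    rootVec m m' = if m' = m then 2 else if m' = m - 1 ∨ m' = m + 1 then -1 else 0 := by
  simp only [rootVec, Finsupp.coe_sub, Pi.sub_apply, Finsupp.single_apply]
  split_ifs <;> omega

theorem rootVec_self (m : ℤ) : rootVec m m = 2 := by simp [rootVec_apply]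

theorem Diagram.bead_remove (Y : Diagram k) (s : ℕ × ℤ) (hs : Y.IsConvex s) (m : ℤ) :
    (Y.remove s hs).Bead m ↔ (Y.Bead m ∧ m ≠ siteSum s - 1) ∨ m = siteSum s := by
  obtain ⟨h1, h2, h3⟩ := (Y.isConvex_iff s).1 hs
  have hp : ∀ l, (Y.remove s hs).pos l = if l = s.1 - 1 then siteSum s else Y.pos l := by
    intro l
    simp only [Diagram.pos, Diagram.remove, Function.update_apply, siteSum]
    split_ifs <;> omega
  constructor
  · rintro ⟨l, rfl⟩
    rw [hp]
    split_ifs with h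
    · exact Or.inr rfl
    · refine Or.inl ⟨⟨l, rfl⟩, fun h' => h ?_⟩
      apply Y.pos_strictMono.injective
      rw [h2, h', siteSum]
  · rintro (⟨⟨l, rfl⟩, hl⟩ | rfl)
    · refine ⟨l, ?_⟩
      rw [hp, if_neg]
      rintro rfl
      exact hl (by rw [h2, siteSum])
    · exact ⟨s.1 - 1, by rw [hp, if_pos rfl]⟩

theorem Diagram.corner_remove (Y : Diagram k) (s : ℕ × ℤ) (hs : Y.IsConvex s) :
    (Y.remove s hs).corner = Y.corner + rootVec (siteSum s) := by
  obtain ⟨h1, h2, h3⟩ := (Y.isConvex_iff s).1 hs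
  have hb : Y.Bead (siteSum s - 1) := ⟨_, h2⟩
  have ho : ∀ m, (Y.remove s hs).occ m = Y.occ m + (if m = siteSum s then 1 else 0) -
      (if m = siteSum s - 1 then 1 else 0) := by
    intro m
    have := Y.bead_remove s hs m
    by_cases c1 : m = siteSum s
    · subst c1
      have h3' : ¬ Y.Bead (siteSum s) := h3
      rw [Diagram.occ, Diagram.occ, if_pos (this.2 (Or.inr rfl)), if_neg h3', if_pos rfl,
        if_neg (by omega)]
      norm_num
    · by_cases c2 : m = siteSum s - 1
      · subst c2
        simp [Diagram.occ, this, hb]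
      · have e : (Y.remove s hs).occ m = Y.occ m := Diagram.occ_congr (by simp [this, c1, c2])
        simp [e, c1, c2]
  ext m
  rw [Finsupp.add_apply, Diagram.corner_apply, Diagram.corner_apply, ho, ho, rootVec_apply]
  split_ifs <;> omega

theorem Diagram.bead_add (Y : Diagram k) (s : ℕ × ℤ) (hs : Y.IsConcave s) (m : ℤ) :
    (Y.add s hs).Bead m ↔ (Y.Bead m ∧ m ≠ siteSum s) ∨ m = siteSum s - 1 := by
  obtain ⟨h1, h2⟩ := (Y.isConcave_iff s).1 hs
  have hp : ∀ l, (Y.add s hs).pos l = if l = s.1 then siteSum s - 1 else Y.pos l := by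
    intro l
    simp only [Diagram.pos, Diagram.add, Function.update_apply, siteSum]
    split_ifs with h
    · subst h; omega
    · rfl
  constructor
  · rintro ⟨l, rfl⟩
    rw [hp]
    split_ifs with h
    · exact Or.inr rfl
    · refine Or.inl ⟨⟨l, rfl⟩, fun h' => h ?_⟩
      apply Y.pos_strictMono.injective
      rw [h1, h', siteSum]
  · rintro (⟨⟨l, rfl⟩, hl⟩ | rfl)
    · refine ⟨l, ?_⟩
      rw [hp, if_neg]
      rintro rfl
      exact hl (by rw [h1, siteSum])
    · exact ⟨s.1, by rw [hp, if_pos rfl]⟩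

theorem Diagram.corner_add (Y : Diagram k) (s : ℕ × ℤ) (hs : Y.IsConcave s) :
    (Y.add s hs).corner = Y.corner - rootVec (siteSum s) := by
  obtain ⟨h1, h2⟩ := (Y.isConcave_iff s).1 hs
  have hb : Y.Bead (siteSum s) := ⟨_, h1⟩
  have h2' : ¬ Y.Bead (siteSum s - 1) := h2
  have ho : ∀ m, (Y.add s hs).occ m = Y.occ m - (if m = siteSum s then 1 else 0) +
      (if m = siteSum s - 1 then 1 else 0) := by
    intro m
    have := Y.bead_add s hs m
    by_cases c1 : m = siteSum s
    · subst c1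
      simp [Diagram.occ, this, hb]
    · by_cases c2 : m = siteSum s - 1
      · subst c2
        simp [Diagram.occ, this, h2']
      · have e : (Y.add s hs).occ m = Y.occ m := Diagram.occ_congr (by simp [this, c1, c2])
        simp [e, c1, c2]
  ext m
  rw [Finsupp.sub_apply, Diagram.corner_apply, Diagram.corner_apply, ho, ho, rootVec_apply]
  split_ifs <;> omega

theorem Diagram.IsConcave.corner {Y : Diagram k} {s : ℕ × ℤ} (h : Y.IsConcave s) :
    Y.corner (siteSum s) = 1 := by
  rw [Y.isConcave_iff] at h
  exact (Y.corner_eq_one _).2 ⟨⟨_, h.1⟩, h.2⟩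

theorem Diagram.IsConvex.corner {Y : Diagram k} {s : ℕ × ℤ} (h : Y.IsConvex s) :
    Y.corner (siteSum s) = -1 := by
  rw [Y.isConvex_iff] at h
  exact (Y.corner_eq_neg_one _).2 ⟨h.2.2, ⟨_, h.2.1⟩⟩

theorem Diagram.exists_isConcave {Y : Diagram k} {m : ℤ} (h : Y.corner m = 1) :
    ∃ s, siteSum s = m ∧ Y.IsConcave s := by
  obtain ⟨⟨l, hl⟩, h2⟩ := (Y.corner_eq_one m).1 h
  refine ⟨(l, m - l), by simp [siteSum], (Y.isConcave_iff _).2 ⟨?_, ?_⟩⟩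
  · simp [hl]
  · simpa using h2

theorem Diagram.exists_isConvex {Y : Diagram k} {m : ℤ} (h : Y.corner m = -1) :
    ∃ s, siteSum s = m ∧ Y.IsConvex s := by
  obtain ⟨h2, ⟨l, hl⟩⟩ := (Y.corner_eq_neg_one m).1 h
  refine ⟨(l + 1, m - (l + 1)), by simp [siteSum], (Y.isConvex_iff _).2 ⟨by simp, ?_, ?_⟩⟩
  · simp [hl]
  · simpa using h2

theorem cornerSign_eq_zero_or (Y : Diagram k) (s : ℕ × ℤ) :
    cornerSign Y s = 0 ∨ cornerSign Y s = Y.corner (siteSum s) := by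
  unfold cornerSign
  split_ifs with h1 h2
  · exact Or.inr h1.corner.symm
  · exact Or.inr h2.corner.symm
  · exact Or.inl rfl

theorem cornerSign_ne_zero {Y : Diagram k} {s : ℕ × ℤ} :
    cornerSign Y s ≠ 0 ↔ Y.IsConcave s ∨ Y.IsConvex s := by
  unfold cornerSign
  split_ifs with h1 h2 <;> simp_all

/-- On each antidiagonal with a corner there is exactly one site that carries a corner. -/
theorem exists_unique_site {Y : Diagram k} {m : ℤ} (h : Y.corner m ≠ 0) :
    ∃ s, siteSum s = m ∧ cornerSign Y s ≠ 0 ∧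
      ∀ t, siteSum t = m → cornerSign Y t ≠ 0 → t = s := by
  have hex : ∃ s, siteSum s = m ∧ cornerSign Y s ≠ 0 := by
    rcases Y.corner_cases m with h' | h' | h'
    · obtain ⟨s, h1, h2⟩ := Diagram.exists_isConcave h'
      exact ⟨s, h1, cornerSign_ne_zero.2 (Or.inl h2)⟩
    · obtain ⟨s, h1, h2⟩ := Diagram.exists_isConvex h'
      exact ⟨s, h1, cornerSign_ne_zero.2 (Or.inr h2)⟩
    · exact absurd h' h
  obtain ⟨s, h1, h2⟩ := hex
  refine ⟨s, h1, h2, fun t h3 h4 => ?_⟩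
  have hst : siteSum s = siteSum t := h1.trans h3.symm
  rw [cornerSign_ne_zero] at h2 h4
  have hc : ∀ {s}, Y.IsConcave s → Y.corner (siteSum s) = 1 := fun h => h.corner
  have hv : ∀ {s}, Y.IsConvex s → Y.corner (siteSum s) = -1 := fun h => h.corner
  have : t.1 = s.1 := by
    rcases h2 with h2 | h2 <;> rcases h4 with h4 | h4
    · have a := ((Y.isConcave_iff s).1 h2).1
      have b := ((Y.isConcave_iff t).1 h4).1
      apply Y.pos_strictMono.injective
      rw [a, b]; exact hst.symm
    · have a := hc h2
      have b := hv h4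
      rw [hst] at a; omega
    · have a := hv h2
      have b := hc h4
      rw [hst] at a; omega
    · have a := ((Y.isConvex_iff s).1 h2)
      have b := ((Y.isConvex_iff t).1 h4)
      have : t.1 - 1 = s.1 - 1 := by
        apply Y.pos_strictMono.injective
        rw [a.2.1, b.2.1]
        simp only [siteSum] at hst
        omega
      omega
  refine Prod.ext this ?_
  simp only [siteSum] at hst
  omega

open Classical in
/-- Products over sites that only see the corners of `Y` are products over antidiagonals. -/
@[to_additive]
theorem finprod_sites {M : Type*} [CommMonoid M] (Y : Diagram k) (p : ℤ → Prop)
    (g : ℕ × ℤ → M) (h : ℤ → M) (S : Finset ℤ) (hS : Y.corner.support ⊆ S)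
    (hg : ∀ s, cornerSign Y s = 0 → g s = 1) (hh : ∀ m, Y.corner m = 0 → h m = 1)
    (hgh : ∀ s, cornerSign Y s ≠ 0 → g s = h (siteSum s)) :
    ∏ᶠ s ∈ {s | p (siteSum s)}, g s = ∏ m ∈ S with p m, h m := by
  have e1 : ∏ᶠ s ∈ {s | p (siteSum s)}, g s =
      ∏ᶠ s ∈ {s | p (siteSum s) ∧ cornerSign Y s ≠ 0}, g s := by
    refine finprod_mem_inter_mulSupport_eq' _ _ _ fun s hs => ?_
    have : cornerSign Y s ≠ 0 := fun h0 => hs (hg s h0)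
    simp [this]
  have e2 : ∏ᶠ m ∈ {m | p m ∧ Y.corner m ≠ 0}, h m = ∏ m ∈ S with p m, h m := by
    refine finprod_mem_eq_prod_of_inter_mulSupport_eq _ ?_
    ext m
    simp only [Set.mem_inter_iff, Set.mem_ofPred_eq, Finset.coe_filter, Function.mem_mulSupport]
    constructor
    · rintro ⟨⟨h1, h2⟩, h3⟩
      exact ⟨⟨hS (Finsupp.mem_support_iff.2 h2), h1⟩, h3⟩
    · rintro ⟨⟨-, h1⟩, h3⟩
      exact ⟨⟨h1, fun h0 => h3 (hh m h0)⟩, h3⟩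
  rw [e1, ← e2]
  refine finprod_mem_eq_of_bijOn siteSum ⟨?_, ?_, ?_⟩ fun s hs => hgh s hs.2
  · rintro s ⟨h1, h2⟩
    refine ⟨h1, ?_⟩
    rcases cornerSign_eq_zero_or Y s with h3 | h3
    · exact absurd h3 h2
    · rwa [← h3]
  · rintro s ⟨-, h1⟩ t ⟨-, h2⟩ hst
    have h3 : Y.corner (siteSum s) ≠ 0 := by
      rcases cornerSign_eq_zero_or Y s with h3 | h3
      · exact absurd h3 h1
      · rwa [← h3]
    obtain ⟨r, -, -, hr⟩ := exists_unique_site h3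
    rw [hr s rfl h1, hr t hst.symm h2]
  · rintro m ⟨h1, h2⟩
    obtain ⟨s, rfl, h4, -⟩ := exists_unique_site h2
    exact ⟨s, ⟨h1, h4⟩, rfl⟩

open Classical in
/-- Remove the convex corner on the antidiagonal `m`; the diagram is unchanged if there is no such
corner. -/
def Diagram.up (m : ℤ) (Y : Diagram k) : Diagram k :=
  if h : ∃ s, siteSum s = m ∧ Y.IsConvex s then Y.remove h.choose h.choose_spec.2 else Y

open Classical in
/-- Fill the concave corner on the antidiagonal `m`; the diagram is unchanged if there is no such
corner. -/
def Diagram.down (m : ℤ) (Y : Diagram k) : Diagram k :=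
  if h : ∃ s, siteSum s = m ∧ Y.IsConcave s then Y.add h.choose h.choose_spec.2 else Y

theorem Diagram.corner_up {m : ℤ} {Y : Diagram k} (h : Y.corner m = -1) :
    (Y.up m).corner = Y.corner + rootVec m := by
  have h' := Diagram.exists_isConvex h
  rw [Diagram.up, dif_pos h', Diagram.corner_remove, h'.choose_spec.1]

theorem Diagram.corner_down {m : ℤ} {Y : Diagram k} (h : Y.corner m = 1) :
    (Y.down m).corner = Y.corner - rootVec m := by
  have h' := Diagram.exists_isConcave h
  rw [Diagram.down, dif_pos h', Diagram.corner_add, h'.choose_spec.1]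

theorem Diagram.up_of_ne {m : ℤ} {Y : Diagram k} (h : Y.corner m ≠ -1) : Y.up m = Y := by
  rw [Diagram.up, dif_neg]
  rintro ⟨s, rfl, hs⟩
  exact h hs.corner

theorem Diagram.down_of_ne {m : ℤ} {Y : Diagram k} (h : Y.corner m ≠ 1) : Y.down m = Y := by
  rw [Diagram.down, dif_neg]
  rintro ⟨s, rfl, hs⟩
  exact h hs.corner

theorem Diagram.remove_eq_up {Y : Diagram k} {s : ℕ × ℤ} (hs : Y.IsConvex s) :
    Y.remove s hs = Y.up (siteSum s) :=
  Diagram.corner_injective (by rw [Diagram.corner_remove, Diagram.corner_up hs.corner])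

theorem Diagram.add_eq_down {Y : Diagram k} {s : ℕ × ℤ} (hs : Y.IsConcave s) :
    Y.add s hs = Y.down (siteSum s) :=
  Diagram.corner_injective (by rw [Diagram.corner_add, Diagram.corner_down hs.corner])

theorem Diagram.corner_up_self {m : ℤ} {Y : Diagram k} (h : Y.corner m = -1) :
    (Y.up m).corner m = 1 := by
  rw [Diagram.corner_up h, Finsupp.add_apply, h, rootVec_self]; norm_num

theorem Diagram.corner_down_self {m : ℤ} {Y : Diagram k} (h : Y.corner m = 1) :
    (Y.down m).corner m = -1 := by
  rw [Diagram.corner_down h, Finsupp.sub_apply, h, rootVec_self]; norm_num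

theorem Diagram.down_up {m : ℤ} {Y : Diagram k} (h : Y.corner m = -1) : (Y.up m).down m = Y :=
  Diagram.corner_injective (by
    rw [Diagram.corner_down (Diagram.corner_up_self h), Diagram.corner_up h, add_sub_cancel_right])

theorem Diagram.up_down {m : ℤ} {Y : Diagram k} (h : Y.corner m = 1) : (Y.down m).up m = Y :=
  Diagram.corner_injective (by
    rw [Diagram.corner_up (Diagram.corner_down_self h), Diagram.corner_down h, sub_add_cancel])

/-- Two antidiagonals are far apart if they are neither equal nor adjacent. -/
def Far (a b : ℤ) : Prop := a + 1 < b ∨ b + 1 < a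

theorem Far.symm {a b : ℤ} (h : Far a b) : Far b a := Or.symm h

theorem rootVec_of_far {a b : ℤ} (h : Far a b) : rootVec a b = 0 := by
  rw [rootVec_apply]
  unfold Far at h
  split_ifs <;> omega

theorem Diagram.corner_up_far {a b : ℤ} (h : Far a b) (Y : Diagram k) :
    (Y.up a).corner b = Y.corner b := by
  by_cases h1 : Y.corner a = -1
  · rw [Diagram.corner_up h1, Finsupp.add_apply, rootVec_of_far h, add_zero]
  · rw [Diagram.up_of_ne h1]

theorem Diagram.corner_down_far {a b : ℤ} (h : Far a b) (Y : Diagram k) :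
    (Y.down a).corner b = Y.corner b := by
  by_cases h1 : Y.corner a = 1
  · rw [Diagram.corner_down h1, Finsupp.sub_apply, rootVec_of_far h, sub_zero]
  · rw [Diagram.down_of_ne h1]

theorem Diagram.up_up_comm {a b : ℤ} (h : Far a b) (Y : Diagram k) :
    (Y.up a).up b = (Y.up b).up a := by
  by_cases h1 : Y.corner a = -1 <;> by_cases h2 : Y.corner b = -1
  · apply Diagram.corner_injective
    rw [Diagram.corner_up (by rwa [Diagram.corner_up_far h]), Diagram.corner_up h1,
      Diagram.corner_up (by rwa [Diagram.corner_up_far h.symm]), Diagram.corner_up h2,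
      add_right_comm]
  · rw [Diagram.up_of_ne h2, Diagram.up_of_ne (by rwa [Diagram.corner_up_far h])]
  · rw [Diagram.up_of_ne h1, Diagram.up_of_ne (m := a) (by rwa [Diagram.corner_up_far h.symm])]
  · rw [Diagram.up_of_ne h1, Diagram.up_of_ne h2, Diagram.up_of_ne h1]

theorem Diagram.down_down_comm {a b : ℤ} (h : Far a b) (Y : Diagram k) :
    (Y.down a).down b = (Y.down b).down a := by
  by_cases h1 : Y.corner a = 1 <;> by_cases h2 : Y.corner b = 1
  · apply Diagram.corner_injective
    rw [Diagram.corner_down (by rwa [Diagram.corner_down_far h]), Diagram.corner_down h1,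
      Diagram.corner_down (by rwa [Diagram.corner_down_far h.symm]), Diagram.corner_down h2,
      sub_right_comm]
  · rw [Diagram.down_of_ne h2, Diagram.down_of_ne (by rwa [Diagram.corner_down_far h])]
  · rw [Diagram.down_of_ne h1,
      Diagram.down_of_ne (m := a) (by rwa [Diagram.corner_down_far h.symm])]
  · rw [Diagram.down_of_ne h1, Diagram.down_of_ne h2, Diagram.down_of_ne h1]

theorem Diagram.up_down_comm {a b : ℤ} (h : Far a b) (Y : Diagram k) :
    (Y.up a).down b = (Y.down b).up a := by
  by_cases h1 : Y.corner a = -1 <;> by_cases h2 : Y.corner b = 1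
  · apply Diagram.corner_injective
    rw [Diagram.corner_down (by rwa [Diagram.corner_up_far h]), Diagram.corner_up h1,
      Diagram.corner_up (by rwa [Diagram.corner_down_far h.symm]), Diagram.corner_down h2,
      add_sub_right_comm]
  · rw [Diagram.down_of_ne h2, Diagram.down_of_ne (by rwa [Diagram.corner_up_far h])]
  · rw [Diagram.up_of_ne h1, Diagram.up_of_ne (m := a) (by rwa [Diagram.corner_down_far h.symm])]
  · rw [Diagram.up_of_ne h1, Diagram.down_of_ne h2, Diagram.up_of_ne h1]

/-! ### The operators of the Fock space in terms of beads -/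

theorem extend_single (g : Diagram k → Fock k) (Y : Diagram k) :
    extend g (Finsupp.single Y 1) = g Y := by
  simp [extend]

theorem fock_hom_ext {f g : Module.End Qq (Fock k)}
    (h : ∀ Y, f (Finsupp.single Y 1) = g (Finsupp.single Y 1)) : f = g :=
  Finsupp.lhom_ext' fun Y => LinearMap.ext_ring (h Y)

open Classical in
/-- The sum of the values of a finitely supported function at the integers satisfying `p`. -/
def sumOver (p : ℤ → Prop) : (ℤ →₀ ℤ) →+ ℤ :=
  Finsupp.liftAddHom fun m => if p m then AddMonoidHom.id ℤ else 0

open Classical in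
theorem sumOver_single (p : ℤ → Prop) (m a : ℤ) :
    sumOver p (Finsupp.single m a) = if p m then a else 0 := by
  simp only [sumOver, Finsupp.liftAddHom_apply_single]
  split_ifs <;> rfl

theorem sumOver_eq (p : ℤ → Prop) [DecidablePred p] (c : ℤ →₀ ℤ) (S : Finset ℤ)
    (hS : c.support ⊆ S) :
    sumOver p c = ∑ m ∈ S with p m, c m := by
  rw [sumOver, Finsupp.liftAddHom_apply, Finsupp.sum_of_support_subset c hS _ (by simp),
    Finset.sum_filter]
  refine Finset.sum_congr rfl fun m _ => ?_
  split_ifs <;> rfl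

open Classical in
theorem sumOver_rootVec (p : ℤ → Prop) (m : ℤ) :
    sumOver p (rootVec m) =
      (if p m then 2 else 0) - (if p (m - 1) then 1 else 0) - (if p (m + 1) then 1 else 0) := by
  simp [rootVec, sumOver_single]

/-- The operator that removes the convex corner on the antidiagonal `m`. -/
def stepUp (m : ℤ) : Module.End Qq (Fock k) :=
  extend fun Y => if Y.corner m = -1 then Finsupp.single (Y.up m) 1 else 0

/-- The operator that fills the concave corner on the antidiagonal `m`. -/
def stepDown (m : ℤ) : Module.End Qq (Fock k) :=
  extend fun Y => if Y.corner m = 1 then Finsupp.single (Y.down m) 1 else 0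

/-- The diagonal operator with eigenvalues `g Y`. -/
def diag (g : Diagram k → Qq) : Module.End Qq (Fock k) := extend fun Y => g Y • Finsupp.single Y 1

theorem stepUp_single (m : ℤ) (Y : Diagram k) : stepUp m (Finsupp.single Y 1) =
    if Y.corner m = -1 then Finsupp.single (Y.up m) 1 else 0 := extend_single _ _

theorem stepDown_single (m : ℤ) (Y : Diagram k) : stepDown m (Finsupp.single Y 1) =
    if Y.corner m = 1 then Finsupp.single (Y.down m) 1 else 0 := extend_single _ _

theorem diag_single (g : Diagram k → Qq) (Y : Diagram k) :
    diag g (Finsupp.single Y 1) = g Y • Finsupp.single Y 1 := extend_single _ _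

open Classical in
theorem TProd_eq (n : ℕ) (i : Fin (n + 1)) (ε : ℤ) (p : ℤ → Prop) :
    TProd (k := k) n i ε {t | p (siteSum t)} =
      diag fun Y => qi n i ^ (ε * sumOver p Y.corner) := by
  refine fock_hom_ext fun Y => ?_
  rw [TProd, extend_single, diag_single, finprod_sites Y p _ (fun m => qi n i ^ (ε * Y.corner m))
    Y.corner.support subset_rfl, sumOver_eq p _ _ subset_rfl, Finset.mul_sum]
  · congr 1
    generalize Finset.filter p Y.corner.support = T
    induction T using Finset.cons_induction with
    | empty => simp
    | cons a s ha ih =>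
      rw [Finset.prod_cons, Finset.sum_cons, ih, zpow_add₀ (generic_qi n i).1]
  · intro s hs; simp [hs]
  · intro m hm; simp [hm]
  · intro s hs
    rcases cornerSign_eq_zero_or Y s with h | h
    · exact absurd h hs
    · rw [h]

theorem EBox_single (s : ℕ × ℤ) (Y : Diagram k) (h : cornerSign Y s ≠ 0) :
    EBox s (Finsupp.single Y 1) = stepUp (siteSum s) (Finsupp.single Y 1) := by
  rw [EBox, extend_single, stepUp_single]
  rcases cornerSign_ne_zero.1 h with h | h
  · have h1 := h.corner
    rw [dif_neg (fun h' => by have := h'.corner; omega), if_neg (by omega)]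
  · rw [dif_pos h, if_pos h.corner, Diagram.remove_eq_up h]

theorem FBox_single (s : ℕ × ℤ) (Y : Diagram k) (h : cornerSign Y s ≠ 0) :
    FBox s (Finsupp.single Y 1) = stepDown (siteSum s) (Finsupp.single Y 1) := by
  rw [FBox, extend_single, stepDown_single]
  rcases cornerSign_ne_zero.1 h with h | h
  · rw [dif_pos h, if_pos h.corner, Diagram.add_eq_down h]
  · have h1 := h.corner
    rw [dif_neg (fun h' => by have := h'.corner; omega), if_neg (by omega)]

theorem EBox_single_zero (s : ℕ × ℤ) (Y : Diagram k) (h : cornerSign Y s = 0) :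
    EBox s (Finsupp.single Y 1) = 0 := by
  rw [EBox, extend_single, dif_neg (fun h' => cornerSign_ne_zero.2 (Or.inr h') h)]

theorem FBox_single_zero (s : ℕ × ℤ) (Y : Diagram k) (h : cornerSign Y s = 0) :
    FBox s (Finsupp.single Y 1) = 0 := by
  rw [FBox, extend_single, dif_neg (fun h' => cornerSign_ne_zero.2 (Or.inl h') h)]

theorem stepUp_single_zero (m : ℤ) (Y : Diagram k) (h : Y.corner m = 0) :
    stepUp m (Finsupp.single Y 1) = 0 := by
  rw [stepUp_single, if_neg (by omega)]

theorem stepDown_single_zero (m : ℤ) (Y : Diagram k) (h : Y.corner m = 0) :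
    stepDown m (Finsupp.single Y 1) = 0 := by
  rw [stepDown_single, if_neg (by omega)]

/-- The corners of colour `i` on antidiagonals above `m`. -/
def above (n : ℕ) (i : Fin (n + 1)) (m : ℤ) (t : ℤ) : Prop := HasColour n i t ∧ m < t

/-- The corners of colour `i` on antidiagonals below `m`. -/
def below (n : ℕ) (i : Fin (n + 1)) (m : ℤ) (t : ℤ) : Prop := HasColour n i t ∧ t < m

open Classical in
theorem EUpper_single (n : ℕ) (i : Fin (n + 1)) (Y : Diagram k) (S : Finset ℤ)
    (hS : Y.corner.support ⊆ S) :
    EUpper n i (Finsupp.single Y 1) = ∑ m ∈ S with HasColour n i m,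
    diag (fun Z => qi n i ^ (1 * sumOver (above n i m) Z.corner))
      (stepUp m (Finsupp.single Y 1)) := by
  rw [EUpper, extend_single]
  exact finsum_sites Y (HasColour n i) _ _ S hS (fun s h => by simp [EBox_single_zero s Y h])
    (fun m h => by simp [stepUp_single_zero m Y h])
    (fun s h => by rw [EBox_single s Y h, ← TProd_eq]; rfl)

open Classical in
theorem FUpper_single (n : ℕ) (i : Fin (n + 1)) (Y : Diagram k) (S : Finset ℤ)
    (hS : Y.corner.support ⊆ S) :
    FUpper n i (Finsupp.single Y 1) = ∑ m ∈ S with HasColour n i m,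
    diag (fun Z => qi n i ^ (-1 * sumOver (below n i m) Z.corner))
      (stepDown m (Finsupp.single Y 1)) := by
  rw [FUpper, extend_single]
  exact finsum_sites Y (HasColour n i) _ _ S hS (fun s h => by simp [FBox_single_zero s Y h])
    (fun m h => by simp [stepDown_single_zero m Y h])
    (fun s h => by rw [FBox_single s Y h, ← TProd_eq]; rfl)

open Classical in
theorem ELower_single (n : ℕ) (i : Fin (n + 1)) (Y : Diagram k) (S : Finset ℤ)
    (hS : Y.corner.support ⊆ S) :
    ELower n i (Finsupp.single Y 1) = ∑ m ∈ S with HasColour n i m,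
    diag (fun Z => qi n i ^ (-1 * sumOver (below n i m) Z.corner))
      (stepUp m (Finsupp.single Y 1)) := by
  rw [ELower, extend_single]
  exact finsum_sites Y (HasColour n i) _ _ S hS (fun s h => by simp [EBox_single_zero s Y h])
    (fun m h => by simp [stepUp_single_zero m Y h])
    (fun s h => by rw [EBox_single s Y h, ← TProd_eq]; rfl)

open Classical in
theorem FLower_single (n : ℕ) (i : Fin (n + 1)) (Y : Diagram k) (S : Finset ℤ)
    (hS : Y.corner.support ⊆ S) :
    FLower n i (Finsupp.single Y 1) = ∑ m ∈ S with HasColour n i m,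
    diag (fun Z => qi n i ^ (1 * sumOver (above n i m) Z.corner))
      (stepDown m (Finsupp.single Y 1)) := by
  rw [FLower, extend_single]
  exact finsum_sites Y (HasColour n i) _ _ S hS (fun s h => by simp [FBox_single_zero s Y h])
    (fun m h => by simp [stepDown_single_zero m Y h])
    (fun s h => by rw [FBox_single s Y h, ← TProd_eq]; rfl)

theorem cornerDiff_eq (n : ℕ) (i : Fin (n + 1)) (Y : Diagram k) :
    cornerDiff n i Y = sumOver (HasColour n i) Y.corner := by
  classical
  exact (finsum_sites Y (HasColour n i) (cornerSign Y) Y.corner _ subset_rfl (fun s h => h)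
    (fun m h => h) fun s h => (cornerSign_eq_zero_or Y s).resolve_left h).trans
    (sumOver_eq _ _ _ subset_rfl).symm

end Beads

/-! ### The crystal of a list of antidiagonals -/

section Crystal

variable {k : ℕ}

/-- The number of unmatched concave corners on the antidiagonals in `P`, when each convex corner
is matched with a concave corner above it. -/
def phi : List ℤ → Diagram k → ℕ
  | [], _ => 0
  | p :: P, Y =>
    if Y.corner p = 1 then phi P Y + 1 else if Y.corner p = -1 then phi P Y - 1 else phi P Y

/-- The number of unmatched convex corners on the antidiagonals in `P`. -/
def eps : List ℤ → Diagram k → ℕ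
  | [], _ => 0
  | p :: P, Y => if Y.corner p = -1 ∧ phi P Y = 0 then eps P Y + 1 else eps P Y

/-- Remove the lowest unmatched convex corner. -/
def et : List ℤ → Diagram k → Diagram k
  | [], Y => Y
  | p :: P, Y => if Y.corner p = -1 ∧ phi P Y = 0 then Y.up p else et P Y

/-- Fill the highest unmatched concave corner. -/
def ft : List ℤ → Diagram k → Diagram k
  | [], Y => Y
  | p :: P, Y => if Y.corner p = 1 ∧ phi P Y = 0 then Y.down p else ft P Y

/-- The antidiagonals in `P` are increasing and no two of them are adjacent. -/
abbrev Spread (P : List ℤ) : Prop := P.Pairwise fun a b => a + 1 < b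

theorem Spread.far {p : ℤ} {P : List ℤ} (h : Spread (p :: P)) : ∀ b ∈ P, Far p b :=
  fun b hb => Or.inl ((List.pairwise_cons.1 h).1 b hb)

theorem Spread.tail {p : ℤ} {P : List ℤ} (h : Spread (p :: P)) : Spread P :=
  (List.pairwise_cons.1 h).2

/-- The map `σ` on diagrams does not interact with the antidiagonals in `P`. -/
structure Compat (P : List ℤ) (σ : Diagram k → Diagram k) : Prop where
  corner : ∀ b ∈ P, ∀ Y, (σ Y).corner b = Y.corner b
  up : ∀ b ∈ P, ∀ Y, σ (Y.up b) = (σ Y).up b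
  down : ∀ b ∈ P, ∀ Y, σ (Y.down b) = (σ Y).down b

theorem Compat.tail {p : ℤ} {P : List ℤ} {σ : Diagram k → Diagram k} (h : Compat (p :: P) σ) :
    Compat P σ :=
  ⟨fun b hb => h.corner b (by simp [hb]), fun b hb => h.up b (by simp [hb]),
    fun b hb => h.down b (by simp [hb])⟩

theorem compat_up {a : ℤ} {P : List ℤ} (h : ∀ b ∈ P, Far a b) :
    Compat P (Diagram.up a (k := k)) :=
  ⟨fun b hb Y => Diagram.corner_up_far (h b hb) Y,
    fun b hb Y => (Diagram.up_up_comm (h b hb) Y).symm,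
    fun b hb Y => (Diagram.up_down_comm (h b hb) Y).symm⟩

theorem compat_down {a : ℤ} {P : List ℤ} (h : ∀ b ∈ P, Far a b) :
    Compat P (Diagram.down a (k := k)) :=
  ⟨fun b hb Y => Diagram.corner_down_far (h b hb) Y,
    fun b hb Y => Diagram.up_down_comm (h b hb).symm Y,
    fun b hb Y => (Diagram.down_down_comm (h b hb) Y).symm⟩

theorem compat_id (P : List ℤ) : Compat P (id : Diagram k → Diagram k) :=
  ⟨fun _ _ _ => rfl, fun _ _ _ => rfl, fun _ _ _ => rfl⟩

theorem Compat.phi {P : List ℤ} {σ : Diagram k → Diagram k} (h : Compat P σ) (Y : Diagram k) :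
    phi P (σ Y) = phi P Y := by
  induction P with
  | nil => rfl
  | cons p P ih => simp only [FockC.phi, h.corner p (by simp), ih h.tail]

theorem Compat.eps {P : List ℤ} {σ : Diagram k → Diagram k} (h : Compat P σ) (Y : Diagram k) :
    eps P (σ Y) = eps P Y := by
  induction P with
  | nil => rfl
  | cons p P ih => simp only [FockC.eps, h.corner p (by simp), ih h.tail, h.tail.phi]

theorem Compat.et {P : List ℤ} {σ : Diagram k → Diagram k} (h : Compat P σ) (Y : Diagram k) :
    et P (σ Y) = σ (et P Y) := by
  induction P with
  | nil => rfl
  | cons p P ih =>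
    simp only [FockC.et, h.corner p (by simp), ih h.tail, h.tail.phi]
    split_ifs
    · exact (h.up p (by simp) Y).symm
    · rfl

theorem Compat.ft {P : List ℤ} {σ : Diagram k → Diagram k} (h : Compat P σ) (Y : Diagram k) :
    ft P (σ Y) = σ (ft P Y) := by
  induction P with
  | nil => rfl
  | cons p P ih =>
    simp only [FockC.ft, h.corner p (by simp), ih h.tail, h.tail.phi]
    split_ifs
    · exact (h.down p (by simp) Y).symm
    · rfl

/-- A property of pairs of diagrams that holds for single moves on `P` holds for `et P`. -/
theorem et_induction {P : List ℤ} {r : Diagram k → Diagram k → Prop} (hr : ∀ Y, r Y Y)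
    (hup : ∀ b ∈ P, ∀ Y, r Y (Y.up b)) (Y : Diagram k) : r Y (et P Y) := by
  induction P with
  | nil => exact hr Y
  | cons p P ih =>
    simp only [et]
    split_ifs
    · exact hup p (by simp) Y
    · exact ih fun b hb => hup b (by simp [hb])

theorem ft_induction {P : List ℤ} {r : Diagram k → Diagram k → Prop} (hr : ∀ Y, r Y Y)
    (hdown : ∀ b ∈ P, ∀ Y, r Y (Y.down b)) (Y : Diagram k) : r Y (ft P Y) := by
  induction P with
  | nil => exact hr Y
  | cons p P ih =>
    simp only [ft]
    split_ifs
    · exact hdown p (by simp) Y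
    · exact ih fun b hb => hdown b (by simp [hb])

theorem corner_et {a : ℤ} {P : List ℤ} (h : ∀ b ∈ P, Far a b) (Y : Diagram k) :
    (et P Y).corner a = Y.corner a :=
  et_induction (r := fun Y Z => Z.corner a = Y.corner a) (fun _ => rfl)
    (fun b hb Y => Diagram.corner_up_far (h b hb).symm Y) Y

theorem corner_ft {a : ℤ} {P : List ℤ} (h : ∀ b ∈ P, Far a b) (Y : Diagram k) :
    (ft P Y).corner a = Y.corner a :=
  ft_induction (r := fun Y Z => Z.corner a = Y.corner a) (fun _ => rfl)
    (fun b hb Y => Diagram.corner_down_far (h b hb).symm Y) Y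

theorem ft_spec {P : List ℤ} (hP : Spread P) (Y : Diagram k) (h : 0 < phi P Y) :
    eps P (ft P Y) = eps P Y + 1 ∧ phi P (ft P Y) + 1 = phi P Y ∧ et P (ft P Y) = Y := by
  induction P with
  | nil => simp [phi] at h
  | cons p P ih =>
    have hc := corner_ft hP.far Y
    have hd := compat_down (k := k) hP.far
    rcases Y.corner_cases p with c | c | c
    · by_cases h0 : phi P Y = 0
      · have := Diagram.corner_down_self c
        simp [ft, phi, eps, et, c, h0, this, hd.phi, hd.eps, Diagram.up_down c]
      · obtain ⟨h1, h2, h3⟩ := ih hP.tail (by omega)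
        simp [ft, phi, eps, et, c, h0, hc, h1, h3, h2]
    · have h' : 0 < phi P Y - 1 := by simpa [phi, c] using h
      obtain ⟨h1, h2, h3⟩ := ih hP.tail (by omega)
      have h4 : phi P (ft P Y) ≠ 0 := by omega
      have h5 : phi P Y ≠ 0 := by omega
      simp [ft, phi, eps, et, c, hc, h1, h3, h4, h5]
      omega
    · have h' : 0 < phi P Y := by simpa [phi, c] using h
      obtain ⟨h1, h2, h3⟩ := ih hP.tail h'
      simp [ft, phi, eps, et, c, hc, h1, h3, h2]

theorem et_spec {P : List ℤ} (hP : Spread P) (Y : Diagram k) (h : 0 < eps P Y) :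
    eps P (et P Y) + 1 = eps P Y ∧ phi P (et P Y) = phi P Y + 1 ∧ ft P (et P Y) = Y := by
  induction P with
  | nil => simp [eps] at h
  | cons p P ih =>
    have hc := corner_et hP.far Y
    have hd := compat_up (k := k) hP.far
    rcases Y.corner_cases p with c | c | c
    · have h' : 0 < eps P Y := by simpa [eps, c] using h
      obtain ⟨h1, h2, h3⟩ := ih hP.tail h'
      simp [ft, phi, eps, et, c, hc, h1, h2, h3]
    · by_cases h0 : phi P Y = 0
      · have := Diagram.corner_up_self c
        simp [ft, phi, eps, et, c, h0, this, hd.phi, hd.eps, Diagram.down_up c]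
      · have h' : 0 < eps P Y := by simpa [eps, c, h0] using h
        obtain ⟨h1, h2, h3⟩ := ih hP.tail h'
        simp [ft, phi, eps, et, c, hc, h1, h2, h3, h0]
        omega
    · have h' : 0 < eps P Y := by simpa [eps, c] using h
      obtain ⟨h1, h2, h3⟩ := ih hP.tail h'
      simp [ft, phi, eps, et, c, hc, h1, h2, h3]

/-- The weight of a diagram on the antidiagonals in `P`. -/
def wtSum (P : List ℤ) (Y : Diagram k) : ℤ := (P.map Y.corner).sum

theorem wtSum_cons (p : ℤ) (P : List ℤ) (Y : Diagram k) :
    wtSum (p :: P) Y = Y.corner p + wtSum P Y := by simp [wtSum]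

theorem wtSum_eq (P : List ℤ) (Y : Diagram k) : wtSum P Y = (phi P Y : ℤ) - eps P Y := by
  induction P with
  | nil => simp [wtSum, phi, eps]
  | cons p P ih =>
    rw [wtSum_cons, ih]
    rcases Y.corner_cases p with c | c | c
    · simp [phi, eps, c]; ring
    · by_cases h0 : phi P Y = 0
      · simp [phi, eps, c, h0]
      · simp [phi, eps, c, h0]; omega
    · simp [phi, eps, c]

/-! ### Adding one antidiagonal: the decomposition of `V(1) ⊗ V(l)` -/

/-- The change of basis for `V(1) ⊗ V(l)`: it turns products of a vector on the antidiagonal `p`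
with basis vectors of the strings for `P` into basis vectors of the strings for `p :: P`. The
second term is absent when its coefficient `[eps]` vanishes or when `phi = 0`. -/
def clebsch (x : Qq) (p : ℤ) (P : List ℤ) : Module.End Qq (Fock k) :=
  extend fun Y =>
    if Y.corner p = 1 then
      (x ^ (-(eps P Y : ℤ)) * qInt x (phi P Y + 1) / qInt x (eps P Y + phi P Y + 1)) •
          Finsupp.single Y 1 +
        (qInt x (eps P Y) / qInt x (eps P Y + phi P Y + 1)) • Finsupp.single ((et P Y).down p) 1
    else if Y.corner p = -1 ∧ phi P Y ≠ 0 then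
      Finsupp.single Y 1 - x ^ phi P Y • Finsupp.single ((ft P Y).up p) 1
    else Finsupp.single Y 1

/-- The inverse of `clebsch`; the blocks of `clebsch` have determinant `1`. -/
def clebschInv (x : Qq) (p : ℤ) (P : List ℤ) : Module.End Qq (Fock k) :=
  extend fun Y =>
    if Y.corner p = 1 then
      Finsupp.single Y 1 -
        (qInt x (eps P Y) / qInt x (eps P Y + phi P Y + 1)) • Finsupp.single ((et P Y).down p) 1
    else if Y.corner p = -1 ∧ phi P Y ≠ 0 then
      (x ^ (-((eps P Y + 1 : ℕ) : ℤ)) * qInt x (phi P Y) / qInt x (eps P Y + phi P Y + 1)) •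
          Finsupp.single Y 1 + x ^ phi P Y • Finsupp.single ((ft P Y).up p) 1
    else Finsupp.single Y 1

variable {x : Qq}

theorem clebsch_one {p : ℤ} {P : List ℤ} {Y : Diagram k} (c : Y.corner p = 1) :
    clebsch x p P (Finsupp.single Y 1) =
      (x ^ (-(eps P Y : ℤ)) * qInt x (phi P Y + 1) / qInt x (eps P Y + phi P Y + 1)) •
          Finsupp.single Y 1 +
        (qInt x (eps P Y) / qInt x (eps P Y + phi P Y + 1)) •
          Finsupp.single ((et P Y).down p) 1 := by
  rw [clebsch, extend_single, if_pos c]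

theorem clebsch_neg_one {p : ℤ} {P : List ℤ} {Y : Diagram k} (c : Y.corner p = -1)
    (h : phi P Y ≠ 0) : clebsch x p P (Finsupp.single Y 1) =
      Finsupp.single Y 1 - x ^ phi P Y • Finsupp.single ((ft P Y).up p) 1 := by
  rw [clebsch, extend_single, if_neg (by omega), if_pos ⟨c, h⟩]

theorem clebsch_else {p : ℤ} {P : List ℤ} {Y : Diagram k} (c : Y.corner p ≠ 1)
    (h : ¬ (Y.corner p = -1 ∧ phi P Y ≠ 0)) :
    clebsch x p P (Finsupp.single Y 1) = Finsupp.single Y 1 := by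
  rw [clebsch, extend_single, if_neg c, if_neg h]

theorem clebschInv_one {p : ℤ} {P : List ℤ} {Y : Diagram k} (c : Y.corner p = 1) :
    clebschInv x p P (Finsupp.single Y 1) = Finsupp.single Y 1 -
        (qInt x (eps P Y) / qInt x (eps P Y + phi P Y + 1)) •
          Finsupp.single ((et P Y).down p) 1 := by
  rw [clebschInv, extend_single, if_pos c]

theorem clebschInv_neg_one {p : ℤ} {P : List ℤ} {Y : Diagram k} (c : Y.corner p = -1)
    (h : phi P Y ≠ 0) : clebschInv x p P (Finsupp.single Y 1) =
      (x ^ (-((eps P Y + 1 : ℕ) : ℤ)) * qInt x (phi P Y) / qInt x (eps P Y + phi P Y + 1)) •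
          Finsupp.single Y 1 + x ^ phi P Y • Finsupp.single ((ft P Y).up p) 1 := by
  rw [clebschInv, extend_single, if_neg (by omega), if_pos ⟨c, h⟩]

theorem clebschInv_else {p : ℤ} {P : List ℤ} {Y : Diagram k} (c : Y.corner p ≠ 1)
    (h : ¬ (Y.corner p = -1 ∧ phi P Y ≠ 0)) :
    clebschInv x p P (Finsupp.single Y 1) = Finsupp.single Y 1 := by
  rw [clebschInv, extend_single, if_neg c, if_neg h]

/-- The partner of a diagram with a concave corner at `p` in its block of `V(1) ⊗ V(l)`. -/
theorem partner_of_one {p : ℤ} {P : List ℤ} (hP : Spread (p :: P)) {Y : Diagram k}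
    (c : Y.corner p = 1) (he : 0 < eps P Y) :
    ((et P Y).down p).corner p = -1 ∧ eps P ((et P Y).down p) + 1 = eps P Y ∧
      phi P ((et P Y).down p) = phi P Y + 1 ∧ ft P ((et P Y).down p) = Y.down p ∧
      et P ((et P Y).down p) = (et P (et P Y)).down p := by
  have hd := compat_down (k := k) hP.far
  obtain ⟨h1, h2, h3⟩ := et_spec hP.tail Y he
  exact ⟨Diagram.corner_down_self (by rwa [corner_et hP.far]), by rw [hd.eps, h1],
    by rw [hd.phi, h2], by rw [hd.ft, h3], by rw [hd.et]⟩

/-- The partner of a diagram with a convex corner at `p` in its block of `V(1) ⊗ V(l)`. -/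
theorem partner_of_neg_one {p : ℤ} {P : List ℤ} (hP : Spread (p :: P)) {Y : Diagram k}
    (c : Y.corner p = -1) (hf : 0 < phi P Y) :
    ((ft P Y).up p).corner p = 1 ∧ eps P ((ft P Y).up p) = eps P Y + 1 ∧
      phi P ((ft P Y).up p) + 1 = phi P Y ∧ et P ((ft P Y).up p) = Y.up p ∧
      ft P ((ft P Y).up p) = (ft P (ft P Y)).up p := by
  have hd := compat_up (k := k) hP.far
  obtain ⟨h1, h2, h3⟩ := ft_spec hP.tail Y hf
  exact ⟨Diagram.corner_up_self (by rwa [corner_ft hP.far]), by rw [hd.eps, h1],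
    by rw [hd.phi, h2], by rw [hd.et, h3], by rw [hd.ft]⟩

theorem qInt_add {x : Qq} (h : x ≠ 0) (a b : ℕ) :
    qInt x (a + b) = x ^ (-(a : ℤ)) * qInt x b + x ^ b * qInt x a := by
  rw [qInt_eq, qInt_eq, qInt_eq, Nat.cast_add, qIntZ_add h, zpow_natCast]

theorem clebsch_det (hx : Generic x) (e f : ℕ) :
    x ^ (-(e : ℤ)) * qInt x (f + 1) / qInt x (e + f + 1) +
      qInt x e / qInt x (e + f + 1) * x ^ (f + 1) = 1 := by
  have := hx.qInt_ne_zero (Nat.succ_pos (e + f))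
  have h := qInt_add hx.1 e (f + 1)
  rw [← add_assoc] at h
  rw [div_mul_eq_mul_div, ← add_div, div_eq_one_iff_eq this, h]
  ring

theorem clebsch_zero (hx : Generic x) (f : ℕ) :
    x ^ (-((0 : ℕ) : ℤ)) * qInt x (f + 1) / qInt x (0 + f + 1) = 1 := by
  rw [zero_add]
  have := hx.qInt_ne_zero (Nat.succ_pos f)
  simp [div_self this]

theorem block_cancel_left {K M : Type*} [Field K] [AddCommGroup M] [Module K M] {a b y : K}
    (h : a + b * y = 1) (u v : M) : a • (u - b • v) + b • (a • v + y • u) = u := by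
  linear_combination (norm := module) h • u

theorem block_cancel_right {K M : Type*} [Field K] [AddCommGroup M] [Module K M] {a b y : K}
    (h : a + b * y = 1) (u v : M) : (a • u + b • v) - b • (v - y • u) = u := by
  linear_combination (norm := module) h • u

theorem clebschInv_comp_clebsch (hx : Generic x) {p : ℤ} {P : List ℤ} (hP : Spread (p :: P)) :
    clebschInv (k := k) x p P ∘ₗ clebsch x p P = LinearMap.id := by
  refine fock_hom_ext fun Y => ?_
  rw [LinearMap.comp_apply, LinearMap.id_apply]
  by_cases c : Y.corner p = 1
  · rw [clebsch_one c, map_add, map_smul, map_smul, clebschInv_one c]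
    rcases Nat.eq_zero_or_pos (eps P Y) with he | he
    · rw [he, qInt_zero, zero_div, clebsch_zero hx]; simp
    · obtain ⟨h1, h2, h3, h4, h5⟩ := partner_of_one hP c he
      rw [clebschInv_neg_one h1 (by omega), h2, h3, h4, Diagram.up_down c]
      have e1 : eps P ((et P Y).down p) + (phi P Y + 1) + 1 = eps P Y + phi P Y + 1 := by omega
      rw [e1]
      exact block_cancel_left (clebsch_det hx _ _) _ _
  · by_cases h : Y.corner p = -1 ∧ phi P Y ≠ 0
    · obtain ⟨c', hf⟩ := h
      obtain ⟨h1, h2, h3, h4, h5⟩ := partner_of_neg_one hP c' (Nat.pos_of_ne_zero hf)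
      rw [clebsch_neg_one c' hf, map_sub, map_smul, clebschInv_neg_one c' hf, clebschInv_one h1,
        h4, Diagram.down_up c', h2]
      obtain ⟨f, hf'⟩ : ∃ f, phi P Y = f + 1 := ⟨phi P Y - 1, by omega⟩
      rw [hf'] at h3 ⊢
      have e1 : eps P Y + 1 + phi P ((ft P Y).up p) + 1 = eps P Y + (f + 1) + 1 := by omega
      rw [e1]
      have := clebsch_det hx (eps P Y + 1) f
      rw [show eps P Y + 1 + f + 1 = eps P Y + (f + 1) + 1 by ring] at this
      exact block_cancel_right (by rw [mul_comm (x ^ (f + 1))]; exact this) _ _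
    · rw [clebsch_else c h, clebschInv_else c h]

theorem clebsch_comp_clebschInv (hx : Generic x) {p : ℤ} {P : List ℤ} (hP : Spread (p :: P)) :
    clebsch (k := k) x p P ∘ₗ clebschInv x p P = LinearMap.id := by
  refine fock_hom_ext fun Y => ?_
  rw [LinearMap.comp_apply, LinearMap.id_apply]
  by_cases c : Y.corner p = 1
  · rw [clebschInv_one c, map_sub, map_smul, clebsch_one c]
    rcases Nat.eq_zero_or_pos (eps P Y) with he | he
    · rw [he, qInt_zero, zero_div, clebsch_zero hx]; simp
    · obtain ⟨h1, h2, h3, h4, h5⟩ := partner_of_one hP c he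
      rw [clebsch_neg_one h1 (by omega), h3, h4, Diagram.up_down c]
      exact block_cancel_right (clebsch_det hx _ _) _ _
  · by_cases h : Y.corner p = -1 ∧ phi P Y ≠ 0
    · obtain ⟨c', hf⟩ := h
      obtain ⟨h1, h2, h3, h4, h5⟩ := partner_of_neg_one hP c' (Nat.pos_of_ne_zero hf)
      rw [clebschInv_neg_one c' hf, map_add, map_smul, map_smul, clebsch_neg_one c' hf,
        clebsch_one h1, h4, Diagram.down_up c', h2]
      obtain ⟨f, hf'⟩ : ∃ f, phi P Y = f + 1 := ⟨phi P Y - 1, by omega⟩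
      rw [hf'] at h3 ⊢
      have e1 : eps P Y + 1 + phi P ((ft P Y).up p) + 1 = eps P Y + (f + 1) + 1 := by omega
      rw [e1, h3]
      have := clebsch_det hx (eps P Y + 1) f
      rw [show eps P Y + 1 + f + 1 = eps P Y + (f + 1) + 1 by ring] at this
      exact block_cancel_left (by rw [mul_comm (x ^ (f + 1))]; exact this) _ _
    · rw [clebschInv_else c h, clebsch_else c h]

end Crystal

/-! ### The string basis attached to a list of antidiagonals -/

section Strings

-- For `ℚ(q)`, instance search otherwise finds `RatFunc.instAlgebraOfPolynomial`, which the
-- `module` tactic cannot match with the canonical algebra structures.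
attribute [local instance] Semiring.toNatAlgebra Ring.toIntAlgebra

variable {k : ℕ} {x : Qq}

/-- The operator `Y ↦ g(Y) σ(Y)`. -/
def mv (g : Diagram k → Qq) (σ : Diagram k → Diagram k) : Module.End Qq (Fock k) :=
  extend fun Y => g Y • Finsupp.single (σ Y) 1

theorem mv_single (g : Diagram k → Qq) (σ : Diagram k → Diagram k) (Y : Diagram k) :
    mv g σ (Finsupp.single Y 1) = g Y • Finsupp.single (σ Y) 1 := extend_single _ _

theorem stepUp_eq_mv (a : ℤ) :
    stepUp (k := k) a = mv (fun Y => if Y.corner a = -1 then 1 else 0) (Diagram.up a) :=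
  fock_hom_ext fun Y => by rw [stepUp_single, mv_single, ite_smul, one_smul, zero_smul]

theorem stepDown_eq_mv (a : ℤ) :
    stepDown (k := k) a = mv (fun Y => if Y.corner a = 1 then 1 else 0) (Diagram.down a) :=
  fock_hom_ext fun Y => by rw [stepDown_single, mv_single, ite_smul, one_smul, zero_smul]

theorem mv_clebsch {p : ℤ} {P : List ℤ} {g : Diagram k → Qq} {σ : Diagram k → Diagram k}
    (hσ : Compat (p :: P) σ)
    (h1 : ∀ Y, Y.corner p = 1 → 0 < eps P Y → g ((et P Y).down p) = g Y)
    (h2 : ∀ Y, Y.corner p = -1 → 0 < phi P Y → g ((ft P Y).up p) = g Y) :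
    mv g σ ∘ₗ clebsch x p P = clebsch x p P ∘ₗ mv g σ := by
  refine fock_hom_ext fun Y => ?_
  have hc := hσ.corner p (by simp) Y
  rw [LinearMap.comp_apply, LinearMap.comp_apply, mv_single, map_smul]
  by_cases c : Y.corner p = 1
  · rw [clebsch_one c, clebsch_one (hc.trans c), map_add, map_smul, map_smul, mv_single, mv_single,
      hσ.tail.eps, hσ.tail.phi, hσ.tail.et, hσ.down p (by simp)]
    rcases Nat.eq_zero_or_pos (eps P Y) with he | he
    · rw [he, qInt_zero, zero_div]; module
    · rw [h1 Y c he]; module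
  · by_cases h : Y.corner p = -1 ∧ phi P Y ≠ 0
    · rw [clebsch_neg_one h.1 h.2, clebsch_neg_one (hc.trans h.1) (by rw [hσ.tail.phi]; exact h.2),
        map_sub, map_smul, mv_single, mv_single, hσ.tail.phi, hσ.tail.ft, hσ.up p (by simp),
        h2 Y h.1 (Nat.pos_of_ne_zero h.2)]
      module
    · rw [clebsch_else c h, clebsch_else (by rwa [hc]) (by rwa [hc, hσ.tail.phi]), mv_single]

/-- The change of basis from diagrams to the vectors of the strings for the antidiagonals
in `P`. -/
def strings (x : Qq) : List ℤ → Module.End Qq (Fock k)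
  | [] => LinearMap.id
  | p :: P => strings x P ∘ₗ clebsch x p P

/-- The inverse of `strings`. -/
def stringsInv (x : Qq) : List ℤ → Module.End Qq (Fock k)
  | [] => LinearMap.id
  | p :: P => clebschInv x p P ∘ₗ stringsInv x P

theorem strings_comp_stringsInv (hx : Generic x) {P : List ℤ} (hP : Spread P) :
    strings (k := k) x P ∘ₗ stringsInv x P = LinearMap.id := by
  induction P with
  | nil => rfl
  | cons p P ih =>
    rw [strings, stringsInv, LinearMap.comp_assoc,
      ← LinearMap.comp_assoc (stringsInv x P) (clebschInv x p P) (clebsch x p P),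
      clebsch_comp_clebschInv hx hP, LinearMap.id_comp, ih hP.tail]

theorem stringsInv_comp_strings (hx : Generic x) {P : List ℤ} (hP : Spread P) :
    stringsInv (k := k) x P ∘ₗ strings x P = LinearMap.id := by
  induction P with
  | nil => rfl
  | cons p P ih =>
    rw [strings, stringsInv, LinearMap.comp_assoc,
      ← LinearMap.comp_assoc (clebsch x p P) (strings x P) (stringsInv x P),
      ih hP.tail, LinearMap.id_comp, clebschInv_comp_clebsch hx hP]

/-- An operator that does not interact with `P` commutes with the change of basis. -/
theorem mv_strings {P : List ℤ} {g : Diagram k → Qq} {σ : Diagram k → Diagram k}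
    (hσ : Compat P σ) (hup : ∀ b ∈ P, ∀ Y, g (Y.up b) = g Y)
    (hdown : ∀ b ∈ P, ∀ Y, g (Y.down b) = g Y) :
    mv g σ ∘ₗ strings x P = strings x P ∘ₗ mv g σ := by
  induction P with
  | nil => rfl
  | cons p P ih =>
    have hup' : ∀ b ∈ P, ∀ Y, g (Y.up b) = g Y := fun b hb => hup b (by simp [hb])
    have hdown' : ∀ b ∈ P, ∀ Y, g (Y.down b) = g Y := fun b hb => hdown b (by simp [hb])
    rw [strings, ← LinearMap.comp_assoc, ih hσ.tail hup' hdown', LinearMap.comp_assoc,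
      mv_clebsch hσ, LinearMap.comp_assoc]
    · intro Y _ _
      rw [hdown p (by simp)]
      exact et_induction (r := fun Y Z => g Z = g Y) (fun _ => rfl) hup' Y
    · intro Y _ _
      rw [hup p (by simp)]
      exact ft_induction (r := fun Y Z => g Z = g Y) (fun _ => rfl) hdown' Y

theorem stepUp_strings {a : ℤ} {P : List ℤ} (h : ∀ b ∈ P, Far a b) :
    stepUp (k := k) a ∘ₗ strings x P = strings x P ∘ₗ stepUp a := by
  rw [stepUp_eq_mv]
  exact mv_strings (compat_up h) (fun b hb Y => by rw [Diagram.corner_up_far (h b hb).symm])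
    (fun b hb Y => by rw [Diagram.corner_down_far (h b hb).symm])

theorem stepDown_strings {a : ℤ} {P : List ℤ} (h : ∀ b ∈ P, Far a b) :
    stepDown (k := k) a ∘ₗ strings x P = strings x P ∘ₗ stepDown a := by
  rw [stepDown_eq_mv]
  exact mv_strings (compat_down h) (fun b hb Y => by rw [Diagram.corner_up_far (h b hb).symm])
    (fun b hb Y => by rw [Diagram.corner_down_far (h b hb).symm])

theorem diag_corner_strings (G : ℤ → Qq) {a : ℤ} {P : List ℤ} (h : ∀ b ∈ P, Far a b) :
    diag (k := k) (fun Y => G (Y.corner a)) ∘ₗ strings x P =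
      strings x P ∘ₗ diag (fun Y => G (Y.corner a)) :=
  mv_strings (compat_id P) (fun b hb Y => by rw [Diagram.corner_up_far (h b hb).symm])
    (fun b hb Y => by rw [Diagram.corner_down_far (h b hb).symm])

/-- The action of `k_i`, restricted to the antidiagonals in `P`. -/
def kList (x : Qq) (P : List ℤ) : Module.End Qq (Fock k) := diag fun Y => x ^ wtSum P Y

theorem kList_cons (hx : x ≠ 0) (p : ℤ) (P : List ℤ) :
    kList (k := k) x (p :: P) = diag (fun Y => x ^ Y.corner p) ∘ₗ kList x P :=
  fock_hom_ext fun Y => by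
    rw [LinearMap.comp_apply, kList, kList, diag_single, diag_single, map_smul, diag_single,
      smul_smul, wtSum_cons, zpow_add₀ hx, mul_comm]

theorem kList_strings {y : Qq} (hy : y ≠ 0) {P : List ℤ} (hP : Spread P) :
    kList (k := k) y P ∘ₗ strings x P = strings x P ∘ₗ kList y P := by
  induction P with
  | nil => rfl
  | cons p P ih =>
    have h1 : kList (k := k) y (p :: P) ∘ₗ strings x P = strings x P ∘ₗ kList y (p :: P) := by
      rw [kList_cons hy, LinearMap.comp_assoc, ih hP.tail, ← LinearMap.comp_assoc,
        diag_corner_strings (fun z => y ^ z) hP.far, LinearMap.comp_assoc]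
    rw [strings, ← LinearMap.comp_assoc, h1, LinearMap.comp_assoc, LinearMap.comp_assoc]
    congr 1
    refine mv_clebsch (compat_id _) (fun Y c he => ?_) (fun Y c hf => ?_)
    · obtain ⟨h1, h2, h3, -⟩ := partner_of_one hP c he
      rw [wtSum_cons, wtSum_cons, wtSum_eq, wtSum_eq, h1, c, h3]
      congr 1; push_cast; omega
    · obtain ⟨h1, h2, h3, -⟩ := partner_of_neg_one hP c hf
      rw [wtSum_cons, wtSum_cons, wtSum_eq, wtSum_eq, h1, c, h2]
      congr 1; push_cast; omega

/-- The action of `e_i`, restricted to the antidiagonals in `P`. -/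
def eList (x : Qq) : List ℤ → Module.End Qq (Fock k)
  | [] => 0
  | p :: P => kList x P ∘ₗ stepUp p + eList x P

/-- The action of `f_i`, restricted to the antidiagonals in `P`. -/
def fList (x : Qq) : List ℤ → Module.End Qq (Fock k)
  | [] => 0
  | p :: P => stepDown p + diag (fun Y => x ^ (-Y.corner p)) ∘ₗ fList x P

/-- The operator `Y ↦ [ε(Y)] ẽ Y`. -/
def eCrystal (x : Qq) (P : List ℤ) : Module.End Qq (Fock k) :=
  mv (fun Y => qInt x (eps P Y)) (et P)

/-- The operator `Y ↦ [φ(Y)] f̃ Y`. -/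
def fCrystal (x : Qq) (P : List ℤ) : Module.End Qq (Fock k) :=
  mv (fun Y => qInt x (phi P Y)) (ft P)

theorem eCrystal_clebsch (hx : Generic x) {p : ℤ} {P : List ℤ} (hP : Spread (p :: P)) :
    (kList (k := k) x P ∘ₗ stepUp p + eCrystal x P) ∘ₗ clebsch x p P =
      clebsch x p P ∘ₗ eCrystal x (p :: P) := by
  have hd := compat_up (k := k) hP.far
  set T : Module.End Qq (Fock k) := kList x P ∘ₗ stepUp p + eCrystal x P with hT
  have hup : ∀ Y : Diagram k, Y.corner p = -1 → T (Finsupp.single Y 1) =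
      x ^ ((phi P Y : ℤ) - eps P Y) • Finsupp.single (Y.up p) (1 : Qq) +
        qInt x (eps P Y) • Finsupp.single (et P Y) (1 : Qq) := by
    intro Y c
    rw [hT, LinearMap.add_apply, LinearMap.comp_apply, stepUp_single, if_pos c, kList, diag_single,
      eCrystal, mv_single, wtSum_eq, hd.phi, hd.eps]
  have hne : ∀ Y : Diagram k, Y.corner p ≠ -1 → T (Finsupp.single Y 1) =
      qInt x (eps P Y) • Finsupp.single (et P Y) (1 : Qq) := by
    intro Y c
    rw [hT, LinearMap.add_apply, LinearMap.comp_apply, stepUp_single, if_neg c, map_zero, zero_add,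
      eCrystal, mv_single]
  refine fock_hom_ext fun Y => ?_
  rw [LinearMap.comp_apply, LinearMap.comp_apply, eCrystal, mv_single, map_smul]
  have hc := corner_et hP.far Y
  by_cases c : Y.corner p = 1
  · have e1 : eps (p :: P) Y = eps P Y := by simp [eps, c]
    have e2 : et (p :: P) Y = et P Y := by simp [et, c]
    rw [e1, e2, clebsch_one c, clebsch_one (hc.trans c), map_add, map_smul, map_smul,
      hne Y (by omega)]
    rcases Nat.eq_zero_or_pos (eps P Y) with he | he
    · rw [he, qInt_zero]; module
    · obtain ⟨h1, h2, h3, h4, h5⟩ := partner_of_one hP c he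
      obtain ⟨g1, g2, g3⟩ := et_spec hP.tail Y he
      have h6 : ((et P Y).down p).up p = et P Y := Diagram.up_down (hc.trans c)
      rw [hup _ h1, h3, h5, h6, g2]
      obtain ⟨e, he'⟩ : ∃ e, eps P Y = e + 1 := ⟨eps P Y - 1, by omega⟩
      have g1' : eps P (et P Y) = e := by omega
      have h2' : eps P ((et P Y).down p) = e := by omega
      rw [g1', h2', he']
      generalize phi P Y = f
      have e3 : e + (f + 1) + 1 = e + 1 + f + 1 := by ring
      rw [e3]
      have key : x ^ (-((e + 1 : ℕ) : ℤ)) * qInt x (f + 1) + x ^ (((f + 1 : ℕ) : ℤ) - e) =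
          x ^ (-(e : ℤ)) * qInt x (f + 1 + 1) := by
        have := qInt_add hx.1 1 (f + 1)
        rw [hx.qInt_one, show 1 + (f + 1) = f + 1 + 1 by ring] at this
        rw [this, zpow_sub₀ hx.1, zpow_natCast, zpow_natCast, zpow_neg, zpow_neg, zpow_neg,
          zpow_natCast, zpow_natCast, zpow_natCast]
        have := hx.1
        field_simp
        ring
      linear_combination (norm := module)
        (qInt x (e + 1) / qInt x (e + 1 + f + 1)) • key • Finsupp.single (et P Y) (1 : Qq)
  · by_cases h : Y.corner p = -1 ∧ phi P Y ≠ 0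
    · obtain ⟨c', hf⟩ := h
      obtain ⟨h1, h2, h3, h4, h5⟩ := partner_of_neg_one hP c' (Nat.pos_of_ne_zero hf)
      have e1 : eps (p :: P) Y = eps P Y := by simp [eps, hf]
      have e2 : et (p :: P) Y = et P Y := by simp [et, hf]
      rw [e1, e2, clebsch_neg_one c' hf, map_sub, map_smul, hup Y c', hne _ (by omega), h2, h4]
      have key : x ^ ((phi P Y : ℤ) - eps P Y) - x ^ phi P Y * qInt x (eps P Y + 1) =
          - (qInt x (eps P Y) * x ^ (phi P Y + 1)) := by
        rw [qInt_add hx.1, hx.qInt_one, zpow_sub₀ hx.1, zpow_natCast, zpow_neg, zpow_natCast]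
        have := hx.1
        field_simp
        ring
      rcases Nat.eq_zero_or_pos (eps P Y) with he | he
      · rw [he] at key ⊢
        rw [qInt_zero] at key ⊢
        linear_combination (norm := module) key • Finsupp.single (Y.up p) (1 : Qq)
      · obtain ⟨g1, g2, g3⟩ := et_spec hP.tail Y he
        rw [clebsch_neg_one (hc.trans c') (by omega), g2, g3]
        linear_combination (norm := module) key • Finsupp.single (Y.up p) (1 : Qq)
    · by_cases c' : Y.corner p = -1
      · have hf : phi P Y = 0 := by by_contra h'; exact h ⟨c', h'⟩
        have e1 : eps (p :: P) Y = eps P Y + 1 := by simp [eps, c', hf]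
        have e2 : et (p :: P) Y = Y.up p := by simp [et, c', hf]
        rw [e1, e2, clebsch_else c h, hup Y c', clebsch_one (Diagram.corner_up_self c'), hd.eps,
          hd.phi, hd.et, hf]
        have e3 : ((et P Y).up p).down p = et P Y := Diagram.down_up (hc.trans c')
        rw [e3, smul_add, smul_smul, smul_smul, zero_add, hx.qInt_one, add_zero, mul_one]
        have := hx.qInt_ne_zero (Nat.succ_pos (eps P Y))
        rw [mul_div_cancel₀ _ this, mul_div_cancel₀ _ this]
        congr 2
        simp
      · have e1 : eps (p :: P) Y = eps P Y := by simp [eps, c']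
        have e2 : et (p :: P) Y = et P Y := by simp [et, c']
        rw [e1, e2, clebsch_else c h, hne Y c', clebsch_else (by rwa [hc]) (by rw [hc]; tauto)]

theorem fCrystal_clebsch (hx : Generic x) {p : ℤ} {P : List ℤ} (hP : Spread (p :: P)) :
    (stepDown (k := k) p + diag (fun Y => x ^ (-Y.corner p)) ∘ₗ fCrystal x P) ∘ₗ clebsch x p P =
      clebsch x p P ∘ₗ fCrystal x (p :: P) := by
  have hd := compat_down (k := k) hP.far
  set T : Module.End Qq (Fock k) :=
    stepDown p + diag (fun Y => x ^ (-Y.corner p)) ∘ₗ fCrystal x P with hT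
  have hdown : ∀ Y : Diagram k, Y.corner p = 1 → T (Finsupp.single Y 1) =
      Finsupp.single (Y.down p) (1 : Qq) +
        (x⁻¹ * qInt x (phi P Y)) • Finsupp.single (ft P Y) (1 : Qq) := by
    intro Y c
    rw [hT, LinearMap.add_apply, LinearMap.comp_apply, stepDown_single, if_pos c, fCrystal,
      mv_single,
      map_smul, diag_single, corner_ft hP.far, c, smul_smul, zpow_neg, zpow_one, mul_comm]
  have hne : ∀ Y : Diagram k, Y.corner p ≠ 1 → T (Finsupp.single Y 1) =
      (x ^ (-Y.corner p) * qInt x (phi P Y)) • Finsupp.single (ft P Y) (1 : Qq) := by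
    intro Y c
    rw [hT, LinearMap.add_apply, LinearMap.comp_apply, stepDown_single, if_neg c, fCrystal,
      mv_single,
      map_smul, diag_single, corner_ft hP.far, smul_smul, zero_add, mul_comm]
  have hx0 := hx.1
  refine fock_hom_ext fun Y => ?_
  rw [LinearMap.comp_apply, LinearMap.comp_apply, fCrystal, mv_single, map_smul]
  have hc := corner_ft hP.far Y
  by_cases c : Y.corner p = 1
  · have e1 : phi (p :: P) Y = phi P Y + 1 := by simp [phi, c]
    rw [e1, clebsch_one c, map_add, map_smul, map_smul, hdown Y c]
    have key : x ^ (-(eps P Y : ℤ)) * qInt x (phi P Y + 1) / qInt x (eps P Y + phi P Y + 1) +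
        qInt x (eps P Y) / qInt x (eps P Y + phi P Y + 1) * (x * qInt x (phi P Y + 1)) =
          qInt x (phi P Y + 1) * (qInt x (eps P Y + 1) / qInt x (eps P Y + phi P Y + 1)) := by
      rw [qInt_add hx0 (eps P Y) 1, hx.qInt_one, pow_one]
      ring
    have hZ : (qInt x (eps P Y) / qInt x (eps P Y + phi P Y + 1)) •
        T (Finsupp.single ((et P Y).down p) 1) =
        (qInt x (eps P Y) / qInt x (eps P Y + phi P Y + 1) * (x * qInt x (phi P Y + 1))) •
          Finsupp.single (Y.down p) (1 : Qq) := by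
      rcases Nat.eq_zero_or_pos (eps P Y) with he | he
      · rw [he, qInt_zero]; module
      · obtain ⟨h1, h2, h3, h4, h5⟩ := partner_of_one hP c he
        rw [hne _ (by omega), h1, h3, h4, neg_neg, zpow_one, smul_smul]
    rw [hZ]
    by_cases hf : phi P Y = 0
    · have e2 : ft (p :: P) Y = Y.down p := by simp [ft, c, hf]
      have h1 := Diagram.corner_down_self c
      have h2 : phi P (Y.down p) = 0 := by rw [hd.phi, hf]
      rw [e2, clebsch_else (by omega) (by simp [h2])]
      rw [hf] at key ⊢
      have := hx.qInt_ne_zero (Nat.succ_pos (eps P Y))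
      rw [add_zero, zero_add, hx.qInt_one, mul_one, mul_one, div_self this, mul_one] at key
      rw [add_zero, zero_add, hx.qInt_one, mul_one, mul_one, qInt_zero]
      linear_combination (norm := module) key • Finsupp.single (Y.down p) (1 : Qq)
    · obtain ⟨g1, g2, g3⟩ := ft_spec hP.tail Y (Nat.pos_of_ne_zero hf)
      have e2 : ft (p :: P) Y = ft P Y := by simp [ft, hf]
      rw [e2, clebsch_one (hc.trans c), g1, g3]
      obtain ⟨f, hf'⟩ : ∃ f, phi P Y = f + 1 := ⟨phi P Y - 1, by omega⟩
      have g2' : phi P (ft P Y) = f := by omega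
      rw [hf'] at key ⊢
      rw [g2']
      generalize eps P Y = e at *
      have e3 : e + 1 + f + 1 = e + (f + 1) + 1 := by ring
      rw [e3]
      have key2 : x ^ (-((e + 1 : ℕ) : ℤ)) = x ^ (-(e : ℤ)) * x⁻¹ := by
        rw [Nat.cast_add, neg_add, zpow_add₀ hx0, Nat.cast_one, zpow_neg_one]
      rw [key2]
      linear_combination (norm := module) key • Finsupp.single (Y.down p) (1 : Qq)
  · by_cases h : Y.corner p = -1 ∧ phi P Y ≠ 0
    · obtain ⟨c', hf⟩ := h
      obtain ⟨h1, h2, h3, h4, h5⟩ := partner_of_neg_one hP c' (Nat.pos_of_ne_zero hf)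
      obtain ⟨g1, g2, g3⟩ := ft_spec hP.tail Y (Nat.pos_of_ne_zero hf)
      have e1 : phi (p :: P) Y = phi P Y - 1 := by simp [phi, c']
      have e2 : ft (p :: P) Y = ft P Y := by simp [ft, hf]
      have e3 : ((ft P Y).up p).down p = ft P Y := Diagram.down_up (hc.trans c')
      rw [e1, e2, clebsch_neg_one c' hf, map_sub, map_smul, hne Y c, hdown _ h1, e3, h5, c',
        neg_neg, zpow_one]
      obtain ⟨f, hf'⟩ : ∃ f, phi P Y = f + 1 := ⟨phi P Y - 1, by omega⟩
      have g2' : phi P (ft P Y) = f := by omega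
      have h3' : phi P ((ft P Y).up p) = f := by omega
      rw [hf', h3', Nat.add_sub_cancel]
      have key : x * qInt x (f + 1) - x ^ (f + 1) = qInt x f := by
        rw [add_comm f 1, qInt_add hx0, hx.qInt_one, zpow_neg, Nat.cast_one, zpow_one]
        field_simp
        ring
      have key2 : x ^ (f + 1) * x⁻¹ = x ^ f := by
        rw [pow_succ, mul_inv_cancel_right₀ hx0]
      by_cases hf0 : f = 0
      · subst hf0
        rw [qInt_zero] at key ⊢
        linear_combination (norm := module) key • Finsupp.single (ft P Y) (1 : Qq)
      · rw [clebsch_neg_one (hc.trans c') (by omega), g2', ← key2]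
        linear_combination (norm := module) key • Finsupp.single (ft P Y) (1 : Qq)
    · rw [clebsch_else c h, hne Y c]
      by_cases c' : Y.corner p = -1
      · have hf : phi P Y = 0 := by by_contra h'; exact h ⟨c', h'⟩
        have e1 : phi (p :: P) Y = 0 := by simp [phi, c', hf]
        rw [e1, hf, qInt_zero]
        module
      · have c0 : Y.corner p = 0 := by have := Y.corner_cases p; omega
        have e1 : phi (p :: P) Y = phi P Y := by simp [phi, c0]
        have e2 : ft (p :: P) Y = ft P Y := by simp [ft, c0]
        rw [e1, e2, clebsch_else (by rwa [hc]) (by rw [hc]; tauto), c0]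
        simp

theorem eList_strings (hx : Generic x) {P : List ℤ} (hP : Spread P) :
    eList (k := k) x P ∘ₗ strings x P = strings x P ∘ₗ eCrystal x P := by
  induction P with
  | nil =>
    refine fock_hom_ext fun Y => ?_
    simp [eList, eCrystal, mv_single, eps, qInt_zero]
  | cons p P ih =>
    have h1 : eList (k := k) x (p :: P) ∘ₗ strings x P =
        strings x P ∘ₗ (kList x P ∘ₗ stepUp p + eCrystal x P) := by
      rw [eList, LinearMap.add_comp, ih hP.tail, LinearMap.comp_assoc, stepUp_strings hP.far,
        ← LinearMap.comp_assoc, kList_strings hx.1 hP.tail, LinearMap.comp_assoc,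
        LinearMap.comp_add]
    rw [strings, ← LinearMap.comp_assoc, h1, LinearMap.comp_assoc, eCrystal_clebsch hx hP,
      LinearMap.comp_assoc]

theorem fList_strings (hx : Generic x) {P : List ℤ} (hP : Spread P) :
    fList (k := k) x P ∘ₗ strings x P = strings x P ∘ₗ fCrystal x P := by
  induction P with
  | nil =>
    refine fock_hom_ext fun Y => ?_
    simp [fList, fCrystal, mv_single, phi, qInt_zero]
  | cons p P ih =>
    have h1 : fList (k := k) x (p :: P) ∘ₗ strings x P =
        strings x P ∘ₗ (stepDown p + diag (fun Y => x ^ (-Y.corner p)) ∘ₗ fCrystal x P) := by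
      rw [fList, LinearMap.add_comp, stepDown_strings hP.far, LinearMap.comp_assoc, ih hP.tail,
        ← LinearMap.comp_assoc, diag_corner_strings (fun z => x ^ (-z)) hP.far,
        LinearMap.comp_assoc, LinearMap.comp_add]
    rw [strings, ← LinearMap.comp_assoc, h1, LinearMap.comp_assoc, fCrystal_clebsch hx hP,
      LinearMap.comp_assoc]

end Strings

/-! ### The lattice -/

section Lattice

variable {k : ℕ}

theorem single_mem_lattice (Y : Diagram k) : Finsupp.single Y (1 : Qq) ∈ lattice k :=
  Submodule.subset_span ⟨Y, rfl⟩

theorem smul_mem_lattice {a : Qq} (ha : a ∈ A) {v : Fock k} (hv : v ∈ lattice k) :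
    a • v ∈ lattice k :=
  (lattice k).smul_mem (⟨a, ha⟩ : A) hv

theorem map_lattice {T : Module.End Qq (Fock k)}
    (hT : ∀ Y, T (Finsupp.single Y 1) ∈ lattice k) {v : Fock k} (hv : v ∈ lattice k) :
    T v ∈ lattice k := by
  induction hv using Submodule.span_induction with
  | mem v hv => obtain ⟨Y, rfl⟩ := hv; exact hT Y
  | zero => simp
  | add v w _ _ hv hw => rw [map_add]; exact add_mem hv hw
  | smul a v _ hv =>
    have : T (a • v) = (a : Qq) • T v := T.map_smul (a : Qq) v
    rw [this]; exact smul_mem_lattice a.2 hv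

/-- `T` preserves the lattice and induces the identity modulo `q`. -/
def NearId (T : Module.End Qq (Fock k)) : Prop :=
  ∀ v ∈ lattice k, ∃ w ∈ lattice k, T v = v + q • w

theorem nearId_of_single {T : Module.End Qq (Fock k)}
    (hT : ∀ Y, ∃ w ∈ lattice k, T (Finsupp.single Y 1) = Finsupp.single Y 1 + q • w) :
    NearId T := by
  intro v hv
  induction hv using Submodule.span_induction with
  | mem v hv => obtain ⟨Y, rfl⟩ := hv; exact hT Y
  | zero => exact ⟨0, zero_mem _, by simp⟩
  | add v w _ _ hv hw =>
    obtain ⟨v', hv', e1⟩ := hv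
    obtain ⟨w', hw', e2⟩ := hw
    exact ⟨v' + w', add_mem hv' hw', by rw [map_add, e1, e2, smul_add]; abel⟩
  | smul a v _ hv =>
    obtain ⟨v', hv', e1⟩ := hv
    have : T (a • v) = (a : Qq) • T v := T.map_smul (a : Qq) v
    refine ⟨(a : Qq) • v', smul_mem_lattice a.2 hv', ?_⟩
    rw [this, e1, smul_add, smul_comm]; rfl

theorem NearId.mem {T : Module.End Qq (Fock k)} (h : NearId T) {v : Fock k}
    (hv : v ∈ lattice k) : T v ∈ lattice k := by
  obtain ⟨w, hw, e⟩ := h v hv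
  rw [e]; exact add_mem hv (smul_mem_lattice q_mem_A hw)

theorem NearId.comp {T U : Module.End Qq (Fock k)} (hT : NearId T) (hU : NearId U) :
    NearId (T ∘ₗ U) := by
  intro v hv
  obtain ⟨w, hw, e⟩ := hU v hv
  obtain ⟨w', hw', e'⟩ := hT (U v) (hU.mem hv)
  exact ⟨w + w', add_mem hw hw', by rw [LinearMap.comp_apply, e', e, smul_add, add_assoc]⟩

theorem nearId_clebsch {s : ℕ} (hs : 0 < s) (p : ℤ) (P : List ℤ) :
    NearId (clebsch (k := k) (q ^ s) p P) := by
  refine nearId_of_single fun Y => ?_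
  by_cases c : Y.corner p = 1
  · obtain ⟨a, ha, e1⟩ := oneModQ_clebsch hs (eps P Y) (phi P Y)
    obtain ⟨b, hb, e2⟩ := qInt_div_mem hs (eps P Y) (phi P Y)
    rw [clebsch_one c, e1, e2]
    refine ⟨a • Finsupp.single Y 1 + b • Finsupp.single ((et P Y).down p) 1,
      add_mem (smul_mem_lattice ha (single_mem_lattice _))
        (smul_mem_lattice hb (single_mem_lattice _)), ?_⟩
    rw [add_smul, one_smul, smul_add, smul_smul, smul_smul, add_assoc]
  · by_cases h : Y.corner p = -1 ∧ phi P Y ≠ 0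
    · rw [clebsch_neg_one h.1 h.2]
      obtain ⟨t, ht⟩ : ∃ t, s * phi P Y = t + 1 :=
        ⟨s * phi P Y - 1, by have := Nat.mul_pos hs (Nat.pos_of_ne_zero h.2); omega⟩
      refine ⟨(-q ^ t) • Finsupp.single ((ft P Y).up p) 1,
        smul_mem_lattice (neg_mem (pow_mem q_mem_A t)) (single_mem_lattice _), ?_⟩
      rw [← pow_mul, ht, smul_smul, sub_eq_add_neg, ← neg_smul, pow_succ', mul_neg]
    · exact ⟨0, zero_mem _, by rw [clebsch_else c h, smul_zero, add_zero]⟩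

theorem clebschInv_mem {s : ℕ} (hs : 0 < s) (p : ℤ) (P : List ℤ) {v : Fock k}
    (hv : v ∈ lattice k) : clebschInv (q ^ s) p P v ∈ lattice k := by
  refine map_lattice (fun Y => ?_) hv
  by_cases c : Y.corner p = 1
  · obtain ⟨b, hb, e2⟩ := qInt_div_mem hs (eps P Y) (phi P Y)
    rw [clebschInv_one c, e2]
    exact sub_mem (single_mem_lattice _)
      (smul_mem_lattice (mul_mem q_mem_A hb) (single_mem_lattice _))
  · by_cases h : Y.corner p = -1 ∧ phi P Y ≠ 0
    · obtain ⟨f, hf⟩ : ∃ f, phi P Y = f + 1 := ⟨phi P Y - 1, by omega⟩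
      have h1 := oneModQ_clebsch hs (eps P Y + 1) f
      rw [clebschInv_neg_one h.1 h.2, hf]
      rw [show eps P Y + 1 + f + 1 = eps P Y + (f + 1) + 1 by ring] at h1
      exact add_mem (smul_mem_lattice h1.mem (single_mem_lattice _))
        (smul_mem_lattice (pow_mem (pow_mem q_mem_A _) _) (single_mem_lattice _))
    · rw [clebschInv_else c h]; exact single_mem_lattice _

theorem nearId_strings {s : ℕ} (hs : 0 < s) (P : List ℤ) :
    NearId (strings (k := k) (q ^ s) P) := by
  induction P with
  | nil => exact fun v _ => ⟨0, zero_mem _, by simp [strings]⟩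
  | cons p P ih => exact ih.comp (nearId_clebsch hs p P)

theorem stringsInv_mem {s : ℕ} (hs : 0 < s) (P : List ℤ) {v : Fock k}
    (hv : v ∈ lattice k) : stringsInv (q ^ s) P v ∈ lattice k := by
  induction P with
  | nil => exact hv
  | cons p P ih => exact clebschInv_mem hs p P ih

end Lattice

/-! ### Corners of a fixed colour -/

section Colour

variable {k : ℕ} {n : ℕ} {i : Fin (n + 1)}

theorem HasColour.even_sub {a : ℤ} (h : HasColour n i a) : ∃ t, a = i.val + 2 * t := by
  rcases h with h | h
  · obtain ⟨t, ht⟩ := h.symm.dvd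
    exact ⟨n * t, by linarith⟩
  · obtain ⟨t, ht⟩ := h.symm.dvd
    exact ⟨n * t - i.val, by linarith⟩

theorem HasColour.far {a b : ℤ} (ha : HasColour n i a) (hb : HasColour n i b) (h : a ≠ b) :
    Far a b := by
  obtain ⟨s, hs⟩ := ha.even_sub
  obtain ⟨t, ht⟩ := hb.even_sub
  unfold Far
  omega

open Classical in
/-- The antidiagonals of the corners of colour `i`. -/
def corners (n : ℕ) (i : Fin (n + 1)) (Y : Diagram k) : Finset ℤ :=
  Y.corner.support.filter (HasColour n i)

theorem mem_corners {Y : Diagram k} {m : ℤ} :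
    m ∈ corners n i Y ↔ Y.corner m ≠ 0 ∧ HasColour n i m := by
  simp [corners]

theorem corners_up {m : ℤ} (h : HasColour n i m) (Y : Diagram k) :
    corners n i (Y.up m) = corners n i Y := by
  by_cases c : Y.corner m = -1
  · ext t
    rw [mem_corners, mem_corners]
    refine and_congr_left fun ht => ?_
    by_cases hmt : m = t
    · subst hmt
      rw [Diagram.corner_up_self c, c]; simp
    · rw [Diagram.corner_up_far (h.far ht hmt)]
  · rw [Diagram.up_of_ne c]

theorem corners_down {m : ℤ} (h : HasColour n i m) (Y : Diagram k) :
    corners n i (Y.down m) = corners n i Y := by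
  by_cases c : Y.corner m = 1
  · ext t
    rw [mem_corners, mem_corners]
    refine and_congr_left fun ht => ?_
    by_cases hmt : m = t
    · subst hmt
      rw [Diagram.corner_down_self c, c]; simp
    · rw [Diagram.corner_down_far (h.far ht hmt)]
  · rw [Diagram.down_of_ne c]

/-- The antidiagonals of the corners of colour `i`, in increasing order. -/
def cornerList (n : ℕ) (i : Fin (n + 1)) (Y : Diagram k) : List ℤ := (corners n i Y).sort

theorem colour_of_mem_cornerList {Y : Diagram k} {m : ℤ} (h : m ∈ cornerList n i Y) :
    HasColour n i m := by
  rw [cornerList, Finset.mem_sort] at h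
  exact (mem_corners.1 h).2

theorem spread_cornerList (n : ℕ) (i : Fin (n + 1)) (Y : Diagram k) :
    Spread (cornerList n i Y) := by
  have h1 : (cornerList n i Y).Pairwise (· < ·) := (Finset.sortedLT_sort _).pairwise
  refine h1.imp_of_mem fun {a b} ha hb hab => ?_
  rcases (colour_of_mem_cornerList ha).far (colour_of_mem_cornerList hb) (by omega) with h | h <;>
    omega

/-- The span of the diagrams whose corners of colour `i` lie on the antidiagonals in `S`. -/
def colourClass (k n : ℕ) (i : Fin (n + 1)) (S : Finset ℤ) : Submodule Qq (Fock k) :=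
  Finsupp.supported Qq Qq {Z : Diagram k | corners n i Z = S}

theorem single_mem_colourClass (Y : Diagram k) :
    Finsupp.single Y (1 : Qq) ∈ colourClass k n i (corners n i Y) :=
  Finsupp.single_mem_supported Qq _ rfl

theorem single_mem_colourClass' {Y : Diagram k} {S : Finset ℤ} (h : corners n i Y = S) :
    Finsupp.single Y (1 : Qq) ∈ colourClass k n i S := h ▸ single_mem_colourClass Y

theorem colourClass_induction {S : Finset ℤ} {r : Fock k → Prop}
    (hs : ∀ Z : Diagram k, corners n i Z = S → r (Finsupp.single Z 1)) (h0 : r 0)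
    (hadd : ∀ v w, r v → r w → r (v + w)) (hsmul : ∀ (a : Qq) v, r v → r (a • v))
    {v : Fock k} (hv : v ∈ colourClass k n i S) : r v := by
  rw [colourClass, Finsupp.supported_eq_span_single] at hv
  induction hv using Submodule.span_induction with
  | mem v hv => obtain ⟨Z, hZ, rfl⟩ := hv; exact hs Z hZ
  | zero => exact h0
  | add v w _ _ hv hw => exact hadd v w hv hw
  | smul a v _ hv => exact hsmul a v hv

/-- `T` preserves the sets of antidiagonals of the corners of colour `i`. -/
def PreservesColour (n : ℕ) (i : Fin (n + 1)) (T : Module.End Qq (Fock k)) : Prop :=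
  ∀ Y, T (Finsupp.single Y 1) ∈ colourClass k n i (corners n i Y)

theorem PreservesColour.mem {T : Module.End Qq (Fock k)} (h : PreservesColour n i T)
    {S : Finset ℤ} {v : Fock k} (hv : v ∈ colourClass k n i S) : T v ∈ colourClass k n i S :=
  colourClass_induction (r := fun v => T v ∈ colourClass k n i S)
    (fun Z hZ => by subst hZ; exact h Z)
    (by simp) (fun v w h1 h2 => by rw [map_add]; exact add_mem h1 h2)
    (fun a v h1 => by rw [map_smul]; exact Submodule.smul_mem _ _ h1) hv

theorem corners_et {P : List ℤ} (h : ∀ p ∈ P, HasColour n i p) (Y : Diagram k) :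
    corners n i (et P Y) = corners n i Y :=
  et_induction (r := fun Y Z => corners n i Z = corners n i Y) (fun _ => rfl)
    (fun b hb Y => corners_up (h b hb) Y) Y

theorem corners_ft {P : List ℤ} (h : ∀ p ∈ P, HasColour n i p) (Y : Diagram k) :
    corners n i (ft P Y) = corners n i Y :=
  ft_induction (r := fun Y Z => corners n i Z = corners n i Y) (fun _ => rfl)
    (fun b hb Y => corners_down (h b hb) Y) Y

theorem preservesColour_clebsch (x : Qq) {p : ℤ} {P : List ℤ}
    (h : ∀ b ∈ p :: P, HasColour n i b) : PreservesColour n i (clebsch (k := k) x p P) := by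
  have hp := h p (by simp)
  have hP : ∀ b ∈ P, HasColour n i b := fun b hb => h b (by simp [hb])
  intro Y
  rw [clebsch, extend_single]
  split_ifs
  · exact add_mem (Submodule.smul_mem _ _ (single_mem_colourClass _))
      (Submodule.smul_mem _ _ (single_mem_colourClass' (by rw [corners_down hp, corners_et hP])))
  · exact sub_mem (single_mem_colourClass _)
      (Submodule.smul_mem _ _ (single_mem_colourClass' (by rw [corners_up hp, corners_ft hP])))
  · exact single_mem_colourClass _

theorem preservesColour_clebschInv (x : Qq) {p : ℤ} {P : List ℤ}
    (h : ∀ b ∈ p :: P, HasColour n i b) : PreservesColour n i (clebschInv (k := k) x p P) := by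
  have hp := h p (by simp)
  have hP : ∀ b ∈ P, HasColour n i b := fun b hb => h b (by simp [hb])
  intro Y
  rw [clebschInv, extend_single]
  split_ifs
  · exact sub_mem (single_mem_colourClass _)
      (Submodule.smul_mem _ _ (single_mem_colourClass' (by rw [corners_down hp, corners_et hP])))
  · exact add_mem (Submodule.smul_mem _ _ (single_mem_colourClass _))
      (Submodule.smul_mem _ _ (single_mem_colourClass' (by rw [corners_up hp, corners_ft hP])))
  · exact single_mem_colourClass _

theorem preservesColour_strings (x : Qq) {P : List ℤ} (h : ∀ b ∈ P, HasColour n i b) :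
    PreservesColour n i (strings (k := k) x P) := by
  induction P with
  | nil => exact fun Y => single_mem_colourClass Y
  | cons p P ih =>
    exact fun Y => (ih fun b hb => h b (by simp [hb])).mem (preservesColour_clebsch x h Y)

theorem preservesColour_stringsInv (x : Qq) {P : List ℤ} (h : ∀ b ∈ P, HasColour n i b) :
    PreservesColour n i (stringsInv (k := k) x P) := by
  induction P with
  | nil => exact fun Y => single_mem_colourClass Y
  | cons p P ih =>
    exact fun Y => (preservesColour_clebschInv x h).mem (ih (fun b hb => h b (by simp [hb])) Y)

/-- The operator that acts on each diagram by the member of the family `T` given by its corners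
of colour `i`. -/
def glue (n : ℕ) (i : Fin (n + 1)) (T : List ℤ → Module.End Qq (Fock k)) :
    Module.End Qq (Fock k) :=
  extend fun Y => T (cornerList n i Y) (Finsupp.single Y 1)

theorem glue_single (T : List ℤ → Module.End Qq (Fock k)) (Y : Diagram k) :
    glue n i T (Finsupp.single Y 1) = T (cornerList n i Y) (Finsupp.single Y 1) :=
  extend_single _ _

theorem eq_of_mem_colourClass {T U : Module.End Qq (Fock k)} {S : Finset ℤ}
    (h : ∀ Z : Diagram k, corners n i Z = S → T (Finsupp.single Z 1) = U (Finsupp.single Z 1))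
    {v : Fock k} (hv : v ∈ colourClass k n i S) : T v = U v :=
  colourClass_induction (r := fun v => T v = U v) h (by simp)
    (fun v w h1 h2 => by rw [map_add, map_add, h1, h2])
    (fun a v h1 => by rw [map_smul, map_smul, h1]) hv

theorem glue_apply (T : List ℤ → Module.End Qq (Fock k)) {Y : Diagram k} {v : Fock k}
    (hv : v ∈ colourClass k n i (corners n i Y)) : glue n i T v = T (cornerList n i Y) v :=
  eq_of_mem_colourClass (fun Z hZ => by rw [glue_single, cornerList, hZ, cornerList]) hv

theorem eList_eq_sum {x : Qq} {P : List ℤ} (hP : Spread P) :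
    eList (k := k) x P =
      (P.map fun m => kList x (P.filter (m < ·)) ∘ₗ stepUp m).sum := by
  induction P with
  | nil => rfl
  | cons p P ih =>
    have hlt : ∀ b ∈ P, p + 1 < b := (List.pairwise_cons.1 hP).1
    rw [eList, ih hP.tail, List.map_cons, List.sum_cons]
    congr 1
    · rw [List.filter_cons_of_neg (by simp), List.filter_eq_self.2]
      intro b hb
      have := hlt b hb
      exact decide_eq_true (by omega)
    · congr 1
      refine List.map_congr_left fun m hm => ?_
      have := hlt m hm
      rw [List.filter_cons_of_neg (by simp; omega)]

theorem fList_eq_sum {x : Qq} (hx : x ≠ 0) {P : List ℤ} (hP : Spread P) :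
    fList (k := k) x P =
      (P.map fun m => diag (fun Y => x ^ (-wtSum (P.filter (· < m)) Y)) ∘ₗ stepDown m).sum := by
  induction P with
  | nil => rfl
  | cons p P ih =>
    have hlt : ∀ b ∈ P, p + 1 < b := (List.pairwise_cons.1 hP).1
    rw [fList, ih hP.tail, List.map_cons, List.sum_cons]
    congr 1
    · rw [List.filter_cons_of_neg (by simp), List.filter_eq_nil_iff.2]
      · refine fock_hom_ext fun Y => ?_
        rw [LinearMap.comp_apply, stepDown_single]
        split_ifs
        · simp [diag_single, wtSum]
        · simp
      · intro b hb
        have := hlt b hb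
        simp; omega
    · rw [← Module.End.mul_eq_comp, ← List.sum_map_mul_left]
      congr 1
      refine List.map_congr_left fun m hm => ?_
      have := hlt m hm
      rw [List.filter_cons_of_pos (by simp; omega), Module.End.mul_eq_comp, ← LinearMap.comp_assoc]
      congr 1
      refine fock_hom_ext fun Y => ?_
      rw [LinearMap.comp_apply, diag_single, diag_single, map_smul, diag_single, smul_smul,
        wtSum_cons, neg_add, zpow_add₀ hx, mul_comm]

theorem diag_congr {g g' : Diagram k → Qq} {r : Diagram k → Prop} (h : ∀ Y, r Y → g Y = g' Y)
    {v : Fock k} (hv : ∀ Y, v Y ≠ 0 → r Y) : diag g v = diag g' v := by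
  rw [diag, diag, extend, extend, Finsupp.linearCombination_apply, Finsupp.linearCombination_apply]
  refine Finsupp.sum_congr fun Y hY => ?_
  rw [h Y (hv Y (Finsupp.mem_support_iff.1 hY))]

theorem sum_map_cornerList {M : Type*} [AddCommMonoid M] (g : ℤ → M) (Y : Diagram k) :
    ((cornerList n i Y).map g).sum = ∑ m ∈ corners n i Y, g m := by
  rw [cornerList, ← List.sum_toFinset _ (Finset.sort_nodup _ _), Finset.sort_toFinset]

theorem sumOver_filter (p : ℤ → Prop) [DecidablePred p] {Y Z : Diagram k}
    (h : corners n i Z = corners n i Y) :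
    sumOver (fun t => HasColour n i t ∧ p t) Z.corner =
      wtSum ((cornerList n i Y).filter (fun t => decide (p t))) Z := by
  have hnd : ((cornerList n i Y).filter (fun t => decide (p t))).Nodup :=
    (Finset.sort_nodup _ _).filter _
  classical
  refine (sumOver_eq _ _ _ subset_rfl).trans ?_
  rw [wtSum, ← List.sum_toFinset _ hnd]
  refine Finset.sum_congr ?_ fun _ _ => rfl
  ext t
  rw [Finset.mem_filter, List.mem_toFinset, List.mem_filter, cornerList, Finset.mem_sort, ← h,
    mem_corners, Finsupp.mem_support_iff, decide_eq_true_iff, and_assoc]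

theorem preservesColour_stepUp {m : ℤ} (h : HasColour n i m) :
    PreservesColour n i (stepUp (k := k) m) := by
  intro Y
  rw [stepUp_single]
  split_ifs
  · exact single_mem_colourClass' (corners_up h Y)
  · exact zero_mem _

theorem preservesColour_stepDown {m : ℤ} (h : HasColour n i m) :
    PreservesColour n i (stepDown (k := k) m) := by
  intro Y
  rw [stepDown_single]
  split_ifs
  · exact single_mem_colourClass' (corners_down h Y)
  · exact zero_mem _

theorem diag_preservesColour {T : Module.End Qq (Fock k)} (hT : PreservesColour n i T)
    {g g' : Diagram k → Qq} {Y : Diagram k}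
    (h : ∀ Z, corners n i Z = corners n i Y → g Z = g' Z) :
    diag g (T (Finsupp.single Y 1)) = diag g' (T (Finsupp.single Y 1)) :=
  diag_congr h fun _ hZ =>
    (Finsupp.mem_supported Qq _).1 (hT Y) (Finsupp.mem_support_iff.2 hZ)

theorem EUpper_eq_glue : EUpper (k := k) n i = glue n i (eList (qi n i)) := by
  refine fock_hom_ext fun Y => ?_
  rw [EUpper_single n i Y _ subset_rfl, glue_single, eList_eq_sum (spread_cornerList n i Y),
    sum_map_cornerList, LinearMap.sum_apply]
  refine Finset.sum_congr rfl fun m hm => ?_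
  rw [LinearMap.comp_apply, kList]
  refine diag_preservesColour (preservesColour_stepUp (mem_corners.1 hm).2) fun Z hZ => ?_
  rw [one_mul, ← sumOver_filter (fun t => m < t) hZ]
  rfl

theorem FUpper_eq_glue : FUpper (k := k) n i = glue n i (fList (qi n i)) := by
  refine fock_hom_ext fun Y => ?_
  rw [FUpper_single n i Y _ subset_rfl, glue_single,
    fList_eq_sum (generic_qi n i).1 (spread_cornerList n i Y),
    sum_map_cornerList, LinearMap.sum_apply]
  refine Finset.sum_congr rfl fun m hm => ?_
  rw [LinearMap.comp_apply]
  refine diag_preservesColour (preservesColour_stepDown (mem_corners.1 hm).2) fun Z hZ => ?_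
  rw [neg_one_mul, ← sumOver_filter (fun t => t < m) hZ]
  rfl

theorem sumOver_colour (Y : Diagram k) :
    sumOver (HasColour n i) Y.corner = wtSum (cornerList n i Y) Y := by
  have := sumOver_filter (n := n) (i := i) (fun _ => True) (Y := Y) (Z := Y) rfl
  simpa using this

/-! ### The string basis of the Fock space for one colour -/

theorem glue_comp {T U : List ℤ → Module.End Qq (Fock k)}
    (hU : ∀ P, (∀ p ∈ P, HasColour n i p) → PreservesColour n i (U P)) :
    glue n i T ∘ₗ glue n i U = glue n i fun P => T P ∘ₗ U P :=
  fock_hom_ext fun Y => by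
    rw [LinearMap.comp_apply, glue_single, glue_single,
      glue_apply T (hU _ (fun p hp => colour_of_mem_cornerList hp) Y), LinearMap.comp_apply]

theorem glue_congr {T U : List ℤ → Module.End Qq (Fock k)}
    (h : ∀ P, Spread P → T P = U P) : glue n i T = glue n i U :=
  fock_hom_ext fun Y => by rw [glue_single, glue_single, h _ (spread_cornerList n i Y)]

theorem glue_id : glue (k := k) n i (fun _ => LinearMap.id) = LinearMap.id :=
  fock_hom_ext fun Y => by rw [glue_single]

/-- The change of basis from diagrams to the vectors of the strings of colour `i`. -/
def stringsEquiv (k n : ℕ) (i : Fin (n + 1)) : Fock k ≃ₗ[Qq] Fock k :=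
  LinearEquiv.ofLinearMap (glue n i (strings (qi n i))) (glue n i (stringsInv (qi n i)))
    (by
      rw [glue_comp fun P hP => preservesColour_stringsInv _ hP,
        glue_congr fun P hP => strings_comp_stringsInv (generic_qi n i) hP, glue_id])
    (by
      rw [glue_comp fun P hP => preservesColour_strings _ hP,
        glue_congr fun P hP => stringsInv_comp_strings (generic_qi n i) hP, glue_id])

theorem stringsEquiv_single (Y : Diagram k) : stringsEquiv k n i (Finsupp.single Y 1) =
    strings (qi n i) (cornerList n i Y) (Finsupp.single Y 1) := glue_single _ _

theorem stringsEquiv_symm_single (Y : Diagram k) :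
    (stringsEquiv k n i).symm (Finsupp.single Y 1) =
      stringsInv (qi n i) (cornerList n i Y) (Finsupp.single Y 1) := glue_single _ _

theorem nearId_stringsEquiv : NearId (stringsEquiv k n i).toLinearMap :=
  nearId_of_single fun Y => by
    obtain ⟨w, hw, e⟩ := nearId_strings (sInt_pos n i) (cornerList n i Y) _ (single_mem_lattice Y)
    exact ⟨w, hw, (stringsEquiv_single Y).trans e⟩

theorem stringsEquiv_symm_mem {v : Fock k} (hv : v ∈ lattice k) :
    (stringsEquiv k n i).symm v ∈ lattice k :=
  map_lattice (T := (stringsEquiv k n i).symm.toLinearMap) (fun Y => by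
    have := stringsInv_mem (sInt_pos n i) (cornerList n i Y) (single_mem_lattice Y)
    rw [← qi, ← stringsEquiv_symm_single] at this
    exact this) hv

theorem EUpper_strings (Y : Diagram k) :
    EUpper n i (stringsEquiv k n i (Finsupp.single Y 1)) =
      qInt (qi n i) (eps (cornerList n i Y) Y) •
        stringsEquiv k n i (Finsupp.single (et (cornerList n i Y) Y) 1) := by
  have hP : ∀ p ∈ cornerList n i Y, HasColour n i p := fun p hp => colour_of_mem_cornerList hp
  have e := LinearMap.congr_fun (eList_strings (k := k) (generic_qi n i) (spread_cornerList n i Y))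
    (Finsupp.single Y 1)
  rw [LinearMap.comp_apply, LinearMap.comp_apply, eCrystal, mv_single, map_smul] at e
  rw [EUpper_eq_glue, stringsEquiv_single, stringsEquiv_single,
    glue_apply _ (preservesColour_strings _ hP Y), e]
  have h : cornerList n i (et (cornerList n i Y) Y) = cornerList n i Y := by
    rw [cornerList, corners_et hP, cornerList]
  rw [h]

theorem FUpper_strings (Y : Diagram k) :
    FUpper n i (stringsEquiv k n i (Finsupp.single Y 1)) =
      qInt (qi n i) (phi (cornerList n i Y) Y) •
        stringsEquiv k n i (Finsupp.single (ft (cornerList n i Y) Y) 1) := by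
  have hP : ∀ p ∈ cornerList n i Y, HasColour n i p := fun p hp => colour_of_mem_cornerList hp
  have e := LinearMap.congr_fun (fList_strings (k := k) (generic_qi n i) (spread_cornerList n i Y))
    (Finsupp.single Y 1)
  rw [LinearMap.comp_apply, LinearMap.comp_apply, fCrystal, mv_single, map_smul] at e
  rw [FUpper_eq_glue, stringsEquiv_single, stringsEquiv_single,
    glue_apply _ (preservesColour_strings _ hP Y), e]
  have h : cornerList n i (ft (cornerList n i Y) Y) = cornerList n i Y := by
    rw [cornerList, corners_ft hP, cornerList]
  rw [h]

/-- `q^{h_i}` acts on the vectors of the strings by their weights. -/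
theorem diag_cornerDiff_strings (Y : Diagram k) :
    diag (fun Z => q ^ cornerDiff n i Z) (stringsEquiv k n i (Finsupp.single Y 1)) =
      q ^ ((phi (cornerList n i Y) Y : ℤ) - eps (cornerList n i Y) Y) •
        stringsEquiv k n i (Finsupp.single Y 1) := by
  have hP : ∀ p ∈ cornerList n i Y, HasColour n i p := fun p hp => colour_of_mem_cornerList hp
  have e := LinearMap.congr_fun
    (kList_strings (k := k) (x := qi n i) q_ne_zero (spread_cornerList n i Y)) (Finsupp.single Y 1)
  rw [LinearMap.comp_apply, LinearMap.comp_apply, kList, diag_single, map_smul, wtSum_eq] at e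
  rw [stringsEquiv_single, ← e]
  refine eq_of_mem_colourClass (i := i) (fun Z hZ => ?_) (preservesColour_strings _ hP Y)
  rw [diag_single, diag_single, cornerDiff_eq, sumOver_colour, cornerList, hZ, cornerList]

end Colour

/-! ### Modules with a basis adapted to the strings of one `sl_2` -/

section StringBasis

variable {M : Type*} [AddCommGroup M] [Module Qq M] {ι : Type*}

/-- A basis `G` of `M` that is permuted, up to quantum integers, by the operators `E` and `F`: with
`ep` and `ph` the distances of `b` to the two ends of its string, `E` sends `G b` to
`[ep b] G (e b)` and `F` sends it to `[ph b] G (f b)`, while `K` (the action of `q^{h_i}`) has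
eigenvalue `q^{ph b - ep b}`. The values of `e` and `f` beyond the ends of a string are
irrelevant. -/
structure StringBasis (x : Qq) (E F K : Module.End Qq M) (ι : Type*) where
  G : Module.Basis ι Qq M
  ep : ι → ℕ
  ph : ι → ℕ
  e : ι → ι
  f : ι → ι
  E_G : ∀ b, E (G b) = qInt x (ep b) • G (e b)
  F_G : ∀ b, F (G b) = qInt x (ph b) • G (f b)
  K_G : ∀ b, K (G b) = q ^ ((ph b : ℤ) - ep b) • G b
  e_spec : ∀ b, 0 < ep b → ep (e b) + 1 = ep b ∧ ph (e b) = ph b + 1 ∧ f (e b) = b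
  f_spec : ∀ b, 0 < ph b → ep (f b) = ep b + 1 ∧ ph (f b) + 1 = ph b ∧ e (f b) = b

namespace StringBasis

variable {x : Qq} {E F K : Module.End Qq M}

/-- Exchanging the roles of `E` and `F`. -/
def swap (S : StringBasis x E F K ι) (K' : Module.End Qq M)
    (hK : ∀ b, K' (S.G b) = q ^ (-((S.ph b : ℤ) - S.ep b)) • S.G b) :
    StringBasis x F E K' ι where
  G := S.G
  ep := S.ph
  ph := S.ep
  e := S.f
  f := S.e
  E_G := S.F_G
  F_G := S.E_G
  K_G b := by rw [hK, neg_sub]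
  e_spec b hb := by
    obtain ⟨h1, h2, h3⟩ := S.f_spec b hb
    exact ⟨h2, h1, h3⟩
  f_spec b hb := by
    obtain ⟨h1, h2, h3⟩ := S.e_spec b hb
    exact ⟨h2, h1, h3⟩

variable (S : StringBasis x E F K ι)

theorem repr_E (v : M) (b : ι) : S.G.repr (E v) b =
    if 0 < S.ph b then qInt x (S.ep b + 1) * S.G.repr v (S.f b) else 0 := by
  classical
  have key : Finsupp.lapply b ∘ₗ S.G.repr.toLinearMap ∘ₗ E =
      (if 0 < S.ph b then qInt x (S.ep b + 1) else 0) •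
        (Finsupp.lapply (S.f b) ∘ₗ S.G.repr.toLinearMap) := by
    refine S.G.ext fun b' => ?_
    simp only [LinearMap.comp_apply, LinearMap.smul_apply, LinearEquiv.coe_coe, S.E_G, map_smul,
      Module.Basis.repr_self, Finsupp.lapply_apply, Finsupp.single_apply, smul_eq_mul]
    by_cases h1 : 0 < S.ep b'
    · obtain ⟨g1, g2, g3⟩ := S.e_spec b' h1
      by_cases h2 : S.e b' = b
      · subst h2
        rw [if_pos rfl, if_pos (by omega), if_pos g3.symm, g1]
      · rw [if_neg h2, mul_zero]
        split_ifs with h3 h4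
        · subst h4
          exact absurd (S.f_spec b h3).2.2 h2
        all_goals simp
    · have h0 : S.ep b' = 0 := by omega
      rw [h0, qInt_zero, zero_mul]
      split_ifs with h3 h4
      · subst h4
        have := (S.f_spec b h3).1
        omega
      all_goals simp
  have := LinearMap.congr_fun key v
  simp only [LinearMap.comp_apply, LinearMap.smul_apply, LinearEquiv.coe_coe,
    Finsupp.lapply_apply, smul_eq_mul] at this
  rw [this]
  split_ifs <;> simp

theorem repr_K (v : M) (b : ι) :
    S.G.repr (K v) b = q ^ ((S.ph b : ℤ) - S.ep b) * S.G.repr v b := by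
  classical
  have key : Finsupp.lapply b ∘ₗ S.G.repr.toLinearMap ∘ₗ K =
      (q ^ ((S.ph b : ℤ) - S.ep b)) • (Finsupp.lapply b ∘ₗ S.G.repr.toLinearMap) := by
    refine S.G.ext fun b' => ?_
    simp only [LinearMap.comp_apply, LinearMap.smul_apply, LinearEquiv.coe_coe, S.K_G, map_smul,
      Module.Basis.repr_self, Finsupp.lapply_apply, Finsupp.single_apply, smul_eq_mul]
    split_ifs with h
    · rw [h]
    · simp
  exact LinearMap.congr_fun key v

theorem ep_eq_zero (hx : Generic x) {u : M} (hu : E u = 0) {b : ι} (hb : S.G.repr u b ≠ 0) :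
    S.ep b = 0 := by
  by_contra h
  obtain ⟨h1, h2, h3⟩ := S.e_spec b (Nat.pos_of_ne_zero h)
  have := S.repr_E u (S.e b)
  rw [hu, map_zero, Finsupp.zero_apply, if_pos (by omega), h3] at this
  rcases mul_eq_zero.1 this.symm with h' | h'
  · exact hx.qInt_ne_zero (Nat.succ_pos _) h'
  · exact hb h'

theorem ph_sub_ep {u : M} {w : ℤ} (hu : K u = q ^ w • u) {b : ι} (hb : S.G.repr u b ≠ 0) :
    (S.ph b : ℤ) - S.ep b = w := by
  have := S.repr_K u b
  rw [hu, map_smul, Finsupp.smul_apply, smul_eq_mul] at this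
  exact (q_zpow_injective (mul_right_cancel₀ hb this)).symm

theorem induction_of_repr {r : M → Prop} {c : ι → Prop} {u : M}
    (hc : ∀ b, S.G.repr u b ≠ 0 → c b) (h0 : r 0) (hadd : ∀ v w, r v → r w → r (v + w))
    (hsmul : ∀ (a : Qq) v, r v → r (a • v)) (hG : ∀ b, c b → r (S.G b)) : r u := by
  rw [← S.G.linearCombination_repr u, Finsupp.linearCombination_apply, Finsupp.sum]
  refine Finset.sum_induction _ r hadd h0 fun b hb => hsmul _ _ (hG b (hc b ?_))
  exact Finsupp.mem_support_iff.1 hb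

/-! #### Highest weight vectors and Kashiwara operators -/

theorem iterate_f_spec {b : ι} {m : ℕ} (hm : m ≤ S.ph b) :
    S.ep (S.f^[m] b) = S.ep b + m ∧ S.ph (S.f^[m] b) + m = S.ph b := by
  induction m with
  | zero => simp
  | succ m ih =>
    obtain ⟨h1, h2⟩ := ih (by omega)
    obtain ⟨g1, g2, -⟩ := S.f_spec (S.f^[m] b) (by omega)
    rw [Function.iterate_succ_apply']
    omega

/-- The coefficient of `f^{(m)}` applied to a highest weight vector of weight `l`. -/
def stringCoeff (x : Qq) (l m : ℕ) : Qq := (qFact x m)⁻¹ * ∏ j ∈ Finset.range m, qInt x (l - j)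

theorem stringCoeff_succ (hx : Generic x) (l m : ℕ) :
    stringCoeff x l (m + 1) * qInt x (m + 1) = stringCoeff x l m * qInt x (l - m) := by
  rw [stringCoeff, stringCoeff, qFact_succ, Finset.prod_range_succ, mul_inv]
  have := hx.qInt_ne_zero (Nat.succ_pos m)
  field_simp

theorem pow_F_G {b : ι} {m : ℕ} (hm : m ≤ S.ph b) :
    (F ^ m) (S.G b) = (∏ j ∈ Finset.range m, qInt x (S.ph b - j)) • S.G (S.f^[m] b) := by
  induction m with
  | zero => simp
  | succ m ih =>
    have h2 := (S.iterate_f_spec (b := b) (m := m) (by omega)).2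
    rw [pow_succ', Module.End.mul_apply, ih (by omega), map_smul, S.F_G, smul_smul,
      Function.iterate_succ_apply', Finset.prod_range_succ,
      show S.ph (S.f^[m] b) = S.ph b - m by omega]

theorem divided_F_G {b : ι} {m : ℕ} (hm : m ≤ S.ph b) :
    ((qFact x m)⁻¹ • F ^ m) (S.G b) = stringCoeff x (S.ph b) m • S.G (S.f^[m] b) := by
  rw [LinearMap.smul_apply, S.pow_F_G hm, smul_smul, stringCoeff]

/-- The operator `G b ↦ r(b) G(e b)`, which is zero at the end of a string. -/
def eOp (r : ι → Qq) : Module.End Qq M :=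
  S.G.constr Qq fun b => if S.ep b = 0 then 0 else r b • S.G (S.e b)

/-- The operator `G b ↦ r(b) G(f b)`, which is zero at the end of a string. -/
def fOp (r : ι → Qq) : Module.End Qq M :=
  S.G.constr Qq fun b => if S.ph b = 0 then 0 else r b • S.G (S.f b)

theorem eOp_G (r : ι → Qq) (b : ι) :
    S.eOp r (S.G b) = if S.ep b = 0 then 0 else r b • S.G (S.e b) := S.G.constr_basis Qq _ b

theorem fOp_G (r : ι → Qq) (b : ι) :
    S.fOp r (S.G b) = if S.ph b = 0 then 0 else r b • S.G (S.f b) := S.G.constr_basis Qq _ b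

theorem eOp_eq_zero (hx : Generic x) (r : ι → Qq) {u : M} (hu : E u = 0) : S.eOp r u = 0 :=
  S.induction_of_repr (r := fun u => S.eOp r u = 0) (fun _ hb => S.ep_eq_zero hx hu hb) (by simp)
    (fun v w h1 h2 => by rw [map_add, h1, h2, add_zero])
    (fun a v h => by rw [map_smul, h, smul_zero]) fun b hb => by rw [S.eOp_G, if_pos hb]

theorem highest_induction (hx : Generic x) {r : M → Prop} {u : M} {l : ℕ} (hu : E u = 0)
    (hK : K u = q ^ (l : ℤ) • u) (h0 : r 0) (hadd : ∀ v w, r v → r w → r (v + w))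
    (hsmul : ∀ (a : Qq) v, r v → r (a • v)) (hG : ∀ b, S.ep b = 0 → S.ph b = l → r (S.G b)) :
    r u :=
  S.induction_of_repr (c := fun b => S.ep b = 0 ∧ S.ph b = l) (fun b hb => by
    have h1 := S.ep_eq_zero hx hu hb
    have h2 := S.ph_sub_ep hK hb
    exact ⟨h1, by omega⟩) h0 hadd hsmul fun b hb => hG b hb.1 hb.2

theorem eOp_divided (hx : Generic x) {r : ι → Qq} {s : Qq} {u : M} {l m : ℕ} (hu : E u = 0)
    (hK : K u = q ^ (l : ℤ) • u) (hm : m < l)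
    (hr : ∀ b, S.ep b = m + 1 → S.ph b = l - (m + 1) →
      r b * stringCoeff x l (m + 1) = s * stringCoeff x l m) :
    S.eOp r (((qFact x (m + 1))⁻¹ • F ^ (m + 1)) u) = s • ((qFact x m)⁻¹ • F ^ m) u := by
  refine S.highest_induction (r := fun u => S.eOp r (((qFact x (m + 1))⁻¹ • F ^ (m + 1)) u) =
    s • ((qFact x m)⁻¹ • F ^ m) u) hx hu hK (by simp) ?_ ?_ ?_
  · intro v w h1 h2
    simp only [map_add, smul_add, h1, h2]
  · intro a v h
    simp only [map_smul, h]
    rw [smul_comm]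
  · rintro b h1 rfl
    obtain ⟨g1, g2⟩ := S.iterate_f_spec (b := b) (m := m + 1) hm
    rw [S.divided_F_G (by omega), S.divided_F_G (by omega), map_smul, S.eOp_G, if_neg (by omega),
      smul_smul, smul_smul, mul_comm, hr _ (by omega) (by omega), Function.iterate_succ_apply']
    obtain ⟨g1, g2⟩ := S.iterate_f_spec (b := b) (m := m) (by omega)
    rw [(S.f_spec (S.f^[m] b) (by omega)).2.2]

theorem fOp_divided (hx : Generic x) {r : ι → Qq} {s : Qq} {u : M} {l m : ℕ} (hu : E u = 0)
    (hK : K u = q ^ (l : ℤ) • u) (hm : m < l)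
    (hr : ∀ b, S.ep b = m → S.ph b = l - m →
      r b * stringCoeff x l m = s * stringCoeff x l (m + 1)) :
    S.fOp r (((qFact x m)⁻¹ • F ^ m) u) = s • ((qFact x (m + 1))⁻¹ • F ^ (m + 1)) u := by
  refine S.highest_induction (r := fun u => S.fOp r (((qFact x m)⁻¹ • F ^ m) u) =
    s • ((qFact x (m + 1))⁻¹ • F ^ (m + 1)) u) hx hu hK (by simp) ?_ ?_ ?_
  · intro v w h1 h2
    simp only [map_add, smul_add, h1, h2]
  · intro a v h
    simp only [map_smul, h]
    rw [smul_comm]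
  · rintro b h1 rfl
    obtain ⟨g1, g2⟩ := S.iterate_f_spec (b := b) (m := m) (by omega)
    rw [S.divided_F_G (by omega), S.divided_F_G (by omega), map_smul, S.fOp_G, if_neg (by omega),
      smul_smul, smul_smul, mul_comm, hr _ (by omega) (by omega), Function.iterate_succ_apply']

theorem fOp_divided_last (hx : Generic x) {r : ι → Qq} {u : M} {l : ℕ} (hu : E u = 0)
    (hK : K u = q ^ (l : ℤ) • u) : S.fOp r (((qFact x l)⁻¹ • F ^ l) u) = 0 := by
  refine S.highest_induction (r := fun u => S.fOp r (((qFact x l)⁻¹ • F ^ l) u) = 0) hx hu hK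
    (by simp) ?_ ?_ ?_
  · intro v w h1 h2
    simp only [map_add, h1, h2, add_zero]
  · intro a v h
    simp only [map_smul, h, smul_zero]
  · rintro b h1 rfl
    obtain ⟨g1, g2⟩ := S.iterate_f_spec (b := b) (m := S.ph b) le_rfl
    rw [S.divided_F_G le_rfl, map_smul, S.fOp_G, if_pos (by omega), smul_zero]

/-! #### Commutators and quantum Serre relations -/

theorem commutator_G (hx : Generic x) (b : ι) :
    E (F (S.G b)) - F (E (S.G b)) = qIntZ x ((S.ph b : ℤ) - S.ep b) • S.G b := by
  have h1 : E (F (S.G b)) = (qInt x (S.ph b) * qInt x (S.ep b + 1)) • S.G b := by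
    rw [S.F_G, map_smul, S.E_G, smul_smul]
    rcases Nat.eq_zero_or_pos (S.ph b) with h | h
    · rw [h, qInt_zero, zero_mul, zero_mul, zero_smul, zero_smul]
    · obtain ⟨g1, -, g3⟩ := S.f_spec b h
      rw [g1, g3]
  have h2 : F (E (S.G b)) = (qInt x (S.ep b) * qInt x (S.ph b + 1)) • S.G b := by
    rw [S.E_G, map_smul, S.F_G, smul_smul]
    rcases Nat.eq_zero_or_pos (S.ep b) with h | h
    · rw [h, qInt_zero, zero_mul, zero_mul, zero_smul, zero_smul]
    · obtain ⟨-, g1, g3⟩ := S.e_spec b h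
      rw [g1, g3]
  rw [h1, h2, ← sub_smul]
  congr 1
  have := qIntZ_mul_sub hx.1 (S.ep b) (S.ph b)
  rw [hx.qIntZ_one, one_mul] at this
  rw [← this, qInt_eq, qInt_eq, qInt_eq, qInt_eq]
  push_cast
  ring

theorem commutator (S : StringBasis x E F K ι) (hx : Generic x) {v : M} {w : ℤ}
    (hv : K v = q ^ w • v) :
    E (F v) = F (E v) + qIntZ x w • v :=
  S.induction_of_repr (r := fun v => E (F v) = F (E v) + qIntZ x w • v)
    (fun _ hb => S.ph_sub_ep hv hb) (by simp)
    (fun v w h1 h2 => by simp only [map_add, h1, h2, smul_add]; abel)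
    (fun a v h => by simp only [map_smul, h, smul_add, smul_comm a]) fun b hb => by
      rw [← hb, ← S.commutator_G hx]; abel

theorem K_E (S : StringBasis x E F K ι) (v : M) : K (E v) = q ^ (2 : ℤ) • E (K v) := by
  have : K ∘ₗ E = q ^ (2 : ℤ) • (E ∘ₗ K) := by
    refine S.G.ext fun b => ?_
    simp only [LinearMap.comp_apply, LinearMap.smul_apply, S.E_G, S.K_G, map_smul]
    rcases Nat.eq_zero_or_pos (S.ep b) with h | h
    · rw [h, qInt_zero]; simp
    · obtain ⟨g1, g2, -⟩ := S.e_spec b h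
      rw [g2, ← g1, smul_comm, smul_smul, smul_smul, smul_smul,
        ← zpow_add₀ q_ne_zero]
      congr 3
      push_cast; ring
  exact LinearMap.congr_fun this v

theorem K_pow_E (S : StringBasis x E F K ι) {v : M} {w : ℤ} (hv : K v = q ^ w • v) (m : ℕ) :
    K ((E ^ m) v) = q ^ (w + 2 * m) • (E ^ m) v := by
  induction m with
  | zero => simpa using hv
  | succ m ih =>
    rw [pow_succ', Module.End.mul_apply, S.K_E, ih, map_smul, smul_smul, ← zpow_add₀ q_ne_zero]
    congr 2
    push_cast; ring

theorem pow_E_F (S : StringBasis x E F K ι) (hx : Generic x) {v : M} {w : ℤ}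
    (hv : K v = q ^ w • v) (m : ℕ) :
    (E ^ (m + 1)) (F v) = F ((E ^ (m + 1)) v) +
      (qInt x (m + 1) * qIntZ x (w + m)) • (E ^ m) v := by
  induction m with
  | zero => simpa [hx.qInt_one] using S.commutator hx hv
  | succ m ih =>
    rw [pow_succ' E (m + 1), Module.End.mul_apply, ih, map_add, map_smul,
      S.commutator hx (S.K_pow_E hv (m + 1)), Module.End.mul_apply, add_assoc]
    congr 1
    rw [← Module.End.mul_apply E, ← pow_succ' E m, ← add_smul]
    congr 1
    have := qIntZ_mul_sub hx.1 (m + 1) (-(w + m + 1))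
    rw [hx.qIntZ_one, one_mul, qIntZ_neg, show -(w + m + 1) + 1 = -(w + m) by ring, qIntZ_neg,
      show -(w + m + 1) - (m + 1) = -(w + 2 * ((m + 1 : ℕ) : ℤ)) by push_cast; ring,
      qIntZ_neg] at this
    rw [qInt_eq, qInt_eq]
    push_cast at this ⊢
    rw [show w + ((m : ℤ) + 1) = w + m + 1 by ring]
    linear_combination this

/-- The quantum Serre polynomial of degree `N` in `E`, applied to `X`. -/
def serreOp (x : Qq) (E X : Module.End Qq M) (N : ℕ) : Module.End Qq M :=
  ∑ r ∈ Finset.range (N + 1), ((-1) ^ r * qBinom x N r) • (E ^ (N - r) * X * E ^ r)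

/-- If `X` commutes with `F` and shifts weights by `1 - N`, then the Serre polynomial commutes
with `F`. -/
theorem serreOp_F (S : StringBasis x E F K ι) (hx : Generic x) {X : Module.End Qq M} {N : ℕ}
    (hXF : ∀ v, X (F v) = F (X v))
    (hKX : ∀ v (w : ℤ), K v = q ^ w • v → K (X v) = q ^ (w + (1 - N)) • X v) (v : M) :
    serreOp x E X N (F v) = F (serreOp x E X N v) := by
  suffices h : serreOp x E X N ∘ₗ F = F ∘ₗ serreOp x E X N from LinearMap.congr_fun h v
  refine S.G.ext fun b => ?_
  set v := S.G b
  set w : ℤ := (S.ph b : ℤ) - S.ep b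
  have hv : K v = q ^ w • v := S.K_G b
  -- Moving `F` through the `r`-th term produces multiples of `T r` and `T (r - 1)`; the recursion for
  -- quantum binomials makes the sum over `r` telescope. For `r = 0` and `r = N` the junk values
  -- `T (-1)` and `T N` come with the coefficients `[0] = 0`.
  let T : ℕ → M := fun r => (E ^ (N - 1 - r)) (X ((E ^ r) v))
  have key : ∀ r ∈ Finset.range (N + 1), (E ^ (N - r) * X * E ^ r) (F v) =
      F ((E ^ (N - r) * X * E ^ r) v) + (qInt x (N - r) * qIntZ x (w + r)) • T r +
        (qInt x r * qIntZ x (w + r - 1)) • T (r - 1) := by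
    intro r hr
    have hrN : r ≤ N := by have := Finset.mem_range.1 hr; omega
    simp only [Module.End.mul_apply]
    have h1 : (E ^ (N - r)) (F (X ((E ^ r) v))) = F ((E ^ (N - r)) (X ((E ^ r) v))) +
        (qInt x (N - r) * qIntZ x (w + r)) • T r := by
      rcases Nat.eq_zero_or_pos (N - r) with h | h
      · rw [h, qInt_zero]; simp
      · obtain ⟨m, hm⟩ : ∃ m, N - r = m + 1 := ⟨N - r - 1, by omega⟩
        have hT : T r = (E ^ m) (X ((E ^ r) v)) := by
          simp only [T]; congr 2; omega
        rw [hT, hm, S.pow_E_F hx (hKX _ _ (S.K_pow_E hv r)),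
          show w + 2 * (r : ℤ) + (1 - N) + m = w + r by omega]
    rcases r with _ | r
    · rw [qInt_zero]
      simp only [pow_zero, Module.End.one_apply, hXF] at h1 ⊢
      rw [h1]; simp
    · rw [S.pow_E_F hx hv r, map_add, map_smul, map_add, map_smul, hXF, h1]
      congr 2
      · push_cast; ring_nf
      · simp only [T]; congr 2; omega
  rw [LinearMap.comp_apply, LinearMap.comp_apply, serreOp, LinearMap.sum_apply,
    LinearMap.sum_apply, map_sum]
  simp only [LinearMap.smul_apply, map_smul]
  rw [Finset.sum_congr rfl fun r hr => by rw [key r hr]]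
  simp only [smul_add, Finset.sum_add_distrib]
  rw [add_assoc]
  refine (add_eq_left).2 ?_
  rw [Finset.sum_range_succ, Finset.sum_range_succ']
  simp only [Nat.sub_self, qInt_zero, zero_mul, zero_smul, smul_zero, add_zero,
    ← Finset.sum_add_distrib]
  refine Finset.sum_eq_zero fun r hr => ?_
  have hr' := Finset.mem_range.1 hr
  have hb := qBinom_succ_mul hx hr'
  rw [Nat.add_sub_cancel, smul_smul, smul_smul, ← add_smul]
  rw [show w + ((r + 1 : ℕ) : ℤ) - 1 = w + r by push_cast; ring]
  have : (-1) ^ r * qBinom x N r * (qInt x (N - r) * qIntZ x (w + r)) +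
      (-1) ^ (r + 1) * qBinom x N (r + 1) * (qInt x (r + 1) * qIntZ x (w + r)) = 0 := by
    rw [pow_succ]
    linear_combination (-(-1) ^ r * qIntZ x (w + r)) * hb
  rw [this, zero_smul]

/-- `F^m` is injective on combinations of basis vectors that are at least `m` steps away from the
end of their string. -/
theorem pow_F_injective (hx : Generic x) (m : ℕ) (v : M)
    (hv : ∀ b, S.G.repr v b ≠ 0 → m ≤ S.ph b) (h : (F ^ m) v = 0) : v = 0 := by
  let S' : StringBasis x F E _ ι := S.swap (S.G.constr Qq fun b =>
    q ^ (-((S.ph b : ℤ) - S.ep b)) • S.G b) fun b => S.G.constr_basis Qq _ b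
  induction m generalizing v with
  | zero => simpa using h
  | succ m ih =>
    have hF : F v = 0 := by
      refine ih (F v) (fun b hb => ?_) (by rwa [pow_succ, Module.End.mul_apply] at h)
      have h1 : S.G.repr (F v) b = if 0 < S.ep b then qInt x (S.ph b + 1) * S.G.repr v (S.e b)
        else 0 := S'.repr_E v b
      rw [h1] at hb
      split_ifs at hb with h2
      · have := hv _ (right_ne_zero_of_mul hb)
        have := (S.e_spec b h2).2.1
        omega
      · exact absurd rfl hb
    refine S.G.repr.map_eq_zero_iff.1 (Finsupp.ext fun b => ?_)
    by_contra hb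
    have h1 : S.ph b = 0 := S'.ep_eq_zero hx hF hb
    have h2 := hv b hb
    omega

/-- The quantum Serre relations hold in a module with a string basis: the Serre polynomial commutes
with `F` and raises the weight so far that it has to kill all highest weight vectors. -/
theorem serreOp_eq_zero (S : StringBasis x E F K ι) (hx : Generic x) {X : Module.End Qq M} {N : ℕ}
    (hN : 0 < N)
    (hXF : ∀ v, X (F v) = F (X v))
    (hKX : ∀ v (w : ℤ), K v = q ^ w • v → K (X v) = q ^ (w + (1 - N)) • X v) :
    serreOp x E X N = 0 := by
  have hF := S.serreOp_F hx hXF hKX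
  refine S.G.ext fun b => ?_
  rw [LinearMap.zero_apply]
  induction hd : S.ep b generalizing b with
  | zero =>
    have hFm : ∀ (m : ℕ) v, serreOp x E X N ((F ^ m) v) = (F ^ m) (serreOp x E X N v) := by
      intro m v
      induction m with
      | zero => rfl
      | succ m ih => rw [pow_succ', Module.End.mul_apply, hF, ih, Module.End.mul_apply]
    have hK : K (serreOp x E X N (S.G b)) =
        q ^ ((S.ph b : ℤ) + (N + 1)) • serreOp x E X N (S.G b) := by
      rw [serreOp, LinearMap.sum_apply, map_sum, Finset.smul_sum]
      refine Finset.sum_congr rfl fun r hr => ?_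
      have hrN : r ≤ N := by have := Finset.mem_range.1 hr; omega
      rw [LinearMap.smul_apply, map_smul, smul_comm (q ^ _)]
      simp only [Module.End.mul_apply]
      rw [S.K_pow_E (hKX _ _ (S.K_pow_E (S.K_G b) r))]
      congr 3
      rw [hd]; omega
    -- The image of the highest weight vector `G b` has weight `φ(b) + N + 1`, where `F^{φ(b)+1}` is
    -- injective, although `F^{φ(b)+1}` kills `G b`.
    refine S.pow_F_injective hx (S.ph b + 1) _ (fun b' hb' => ?_) ?_
    · have := S.ph_sub_ep hK hb'
      omega
    · rw [← hFm, pow_succ', Module.End.mul_apply, S.pow_F_G le_rfl, map_smul, S.F_G]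
      have := (S.iterate_f_spec (b := b) (m := S.ph b) le_rfl).2
      rw [show S.ph (S.f^[S.ph b] b) = 0 by omega, qInt_zero, zero_smul, smul_zero, map_zero]
  | succ d ih =>
    obtain ⟨g1, g2, g3⟩ := S.e_spec b (by omega)
    have h1 : F (S.G (S.e b)) = qInt x (S.ph b + 1) • S.G b := by rw [S.F_G, g2, g3]
    have h2 := hF (S.G (S.e b))
    rw [h1, ih (S.e b) (by omega), map_zero, map_smul] at h2
    exact (smul_eq_zero.1 h2).resolve_left (hx.qInt_ne_zero (Nat.succ_pos _))

/-! #### Local finiteness -/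

theorem iterate_e_spec {b : ι} {m : ℕ} (hm : m ≤ S.ep b) :
    S.ph (S.e^[m] b) = S.ph b + m ∧ S.ep (S.e^[m] b) + m = S.ep b := by
  induction m with
  | zero => simp
  | succ m ih =>
    obtain ⟨h1, h2⟩ := ih (by omega)
    obtain ⟨g1, g2, -⟩ := S.e_spec (S.e^[m] b) (by omega)
    rw [Function.iterate_succ_apply']
    omega

theorem exists_string (b : ι) : ∃ T : Set ι, T.Finite ∧ b ∈ T ∧
    ∀ c ∈ T, (0 < S.ep c → S.e c ∈ T) ∧ (0 < S.ph c → S.f c ∈ T) := by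
  refine ⟨(fun j => S.e^[j] b) '' Set.Iic (S.ep b) ∪ (fun j => S.f^[j] b) '' Set.Iic (S.ph b),
    ((Set.finite_Iic _).image _).union ((Set.finite_Iic _).image _),
    Or.inl ⟨0, by simp, rfl⟩, ?_⟩
  rintro c (⟨j, hj, rfl⟩ | ⟨j, hj, rfl⟩)
  · simp only [Set.mem_Iic] at hj
    have h1 := S.iterate_e_spec hj
    dsimp only
    refine ⟨fun h => Or.inl ⟨j + 1, Set.mem_Iic.2 (by omega), Function.iterate_succ_apply' _ _ _⟩,
      fun h => ?_⟩
    rcases j with _ | j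
    · exact Or.inr ⟨1, Set.mem_Iic.2 h, rfl⟩
    · refine Or.inl ⟨j, Set.mem_Iic.2 (by omega), ?_⟩
      have h2 := S.iterate_e_spec (b := b) (m := j) (by omega)
      simp only [Function.iterate_succ_apply']
      exact (S.e_spec _ (by omega)).2.2.symm
  · simp only [Set.mem_Iic] at hj
    have h1 := S.iterate_f_spec hj
    dsimp only
    refine ⟨fun h => ?_,
      fun h => Or.inr ⟨j + 1, Set.mem_Iic.2 (by omega), Function.iterate_succ_apply' _ _ _⟩⟩
    rcases j with _ | j
    · exact Or.inl ⟨1, Set.mem_Iic.2 h, rfl⟩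
    · refine Or.inr ⟨j, Set.mem_Iic.2 (by omega), ?_⟩
      have h2 := S.iterate_f_spec (b := b) (m := j) (by omega)
      simp only [Function.iterate_succ_apply']
      exact (S.f_spec _ (by omega)).2.2.symm

theorem locally_finite {K' : Module.End Qq M}
    (hK' : ∀ b, K' (S.G b) = q ^ (-((S.ph b : ℤ) - S.ep b)) • S.G b) (u : M) :
    ∃ N : Submodule Qq M, u ∈ N ∧ Module.Finite Qq N ∧
      ∀ v ∈ N, E v ∈ N ∧ F v ∈ N ∧ K v ∈ N ∧ K' v ∈ N := by
  refine S.induction_of_repr (c := fun _ => True) (r := fun u => ∃ N : Submodule Qq M, u ∈ N ∧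
    Module.Finite Qq N ∧ ∀ v ∈ N, E v ∈ N ∧ F v ∈ N ∧ K v ∈ N ∧ K' v ∈ N) (fun _ _ => trivial)
    ⟨⊥, zero_mem _, inferInstance, ?_⟩ ?_ ?_ ?_
  · rintro v hv
    rw [Submodule.mem_bot] at hv
    simp [hv]
  · rintro v w ⟨N, hv, hN, h⟩ ⟨N', hw, hN', h'⟩
    refine ⟨N ⊔ N', Submodule.add_mem_sup hv hw, inferInstance, fun z hz => ?_⟩
    obtain ⟨a, ha, b, hb, rfl⟩ := Submodule.mem_sup.1 hz
    obtain ⟨h1, h2, h3, h4⟩ := h a ha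
    obtain ⟨g1, g2, g3, g4⟩ := h' b hb
    simp only [map_add]
    exact ⟨Submodule.add_mem_sup h1 g1, Submodule.add_mem_sup h2 g2, Submodule.add_mem_sup h3 g3,
      Submodule.add_mem_sup h4 g4⟩
  · rintro a v ⟨N, hv, hN, h⟩
    exact ⟨N, N.smul_mem a hv, hN, h⟩
  · intro b _
    obtain ⟨T, hT, hb, hclosed⟩ := S.exists_string b
    refine ⟨Submodule.span Qq (S.G '' T), Submodule.subset_span ⟨b, hb, rfl⟩,
      Module.Finite.span_of_finite Qq (hT.image _), fun v hv => ?_⟩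
    induction hv using Submodule.span_induction with
    | mem v hv =>
      obtain ⟨c, hc, rfl⟩ := hv
      have hG : ∀ c ∈ T, S.G c ∈ Submodule.span Qq (S.G '' T) :=
        fun c hc => Submodule.subset_span ⟨c, hc, rfl⟩
      refine ⟨?_, ?_, ?_, ?_⟩
      · rw [S.E_G]
        rcases Nat.eq_zero_or_pos (S.ep c) with h | h
        · rw [h, qInt_zero, zero_smul]; exact zero_mem _
        · exact Submodule.smul_mem _ _ (hG _ ((hclosed c hc).1 h))
      · rw [S.F_G]
        rcases Nat.eq_zero_or_pos (S.ph c) with h | h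
        · rw [h, qInt_zero, zero_smul]; exact zero_mem _
        · exact Submodule.smul_mem _ _ (hG _ ((hclosed c hc).2 h))
      · rw [S.K_G]; exact Submodule.smul_mem _ _ (hG c hc)
      · rw [hK']; exact Submodule.smul_mem _ _ (hG c hc)
    | zero => simp
    | add v w _ _ h1 h2 =>
      simp only [map_add]
      exact ⟨add_mem h1.1 h2.1, add_mem h1.2.1 h2.2.1, add_mem h1.2.2.1 h2.2.2.1,
        add_mem h1.2.2.2 h2.2.2.2⟩
    | smul a v _ h =>
      simp only [map_smul]
      exact ⟨Submodule.smul_mem _ _ h.1, Submodule.smul_mem _ _ h.2.1,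
        Submodule.smul_mem _ _ h.2.2.1, Submodule.smul_mem _ _ h.2.2.2⟩

end StringBasis

end StringBasis

/-! ### Colours and the Cartan matrix -/

section RootData

variable {k n : ℕ}

theorem hasColour_iff {i : Fin (n + 1)} {t r : ℤ} (h0 : 0 ≤ r) (hr : r < 2 * n) :
    HasColour n i (2 * n * t + r) ↔ r = i.val ∨ r + i.val = 2 * n ∨ (r = 0 ∧ i.val = 0) := by
  have hi := i.2
  have e1 : (2 * n * t + r) % (2 * n : ℤ) = r := by
    rw [Int.mul_add_emod_self_left, Int.emod_eq_of_lt h0 hr]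
  have e2 : (i.val : ℤ) % (2 * n : ℤ) = i.val := Int.emod_eq_of_lt (by omega) (by omega)
  rw [HasColour, Int.ModEq, Int.ModEq, e1, e2]
  by_cases hi0 : i.val = 0
  · have e3 : (-(i.val : ℤ)) % (2 * n : ℤ) = 0 := by simp [hi0]
    rw [e3]; omega
  · have e3 : (-(i.val : ℤ)) % (2 * n : ℤ) = 2 * n - i.val := by
      have : (-(i.val : ℤ)) = 2 * n * (-1) + (2 * n - i.val) := by ring
      rw [this, Int.mul_add_emod_self_left, Int.emod_eq_of_lt (by omega) (by omega)]
    rw [e3]; omega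

theorem exists_residue (hn : 2 ≤ n) (m : ℤ) : ∃ t r : ℤ, 0 ≤ r ∧ r < 2 * n ∧ m = 2 * n * t + r :=
  ⟨m / (2 * n), m % (2 * n), Int.emod_nonneg _ (by omega), Int.emod_lt_of_pos _ (by omega),
    (Int.mul_ediv_add_emod m (2 * n)).symm⟩

theorem exists_colour (hn : 2 ≤ n) (m : ℤ) : ∃ i : Fin (n + 1), HasColour n i m := by
  obtain ⟨t, r, h0, h1, rfl⟩ := exists_residue hn m
  by_cases h : r ≤ n
  · refine ⟨⟨r.toNat, by omega⟩, (hasColour_iff h0 h1).2 (Or.inl ?_)⟩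
    dsimp only; omega
  · refine ⟨⟨(2 * n - r).toNat, by omega⟩, (hasColour_iff h0 h1).2 (Or.inr (Or.inl ?_))⟩
    dsimp only; omega

theorem HasColour.unique (hn : 2 ≤ n) {i j : Fin (n + 1)} {m : ℤ} (hi : HasColour n i m)
    (hj : HasColour n j m) : i = j := by
  obtain ⟨t, r, h0, h1, rfl⟩ := exists_residue hn m
  rw [hasColour_iff h0 h1] at hi hj
  have := i.2
  have := j.2
  exact Fin.ext (by omega)

theorem hasColour_succ_iff {i : Fin (n + 1)} {t r : ℤ} (h0 : 0 ≤ r) (hr : r < 2 * n) :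
    HasColour n i (2 * n * t + r + 1) ↔
      (r + 1 < 2 * n ∧ (r + 1 = i.val ∨ r + 1 + i.val = 2 * n)) ∨ (r + 1 = 2 * n ∧ i.val = 0) := by
  have hi := i.2
  by_cases h : r + 1 < 2 * n
  · rw [add_assoc, hasColour_iff (by omega) h]; omega
  · rw [show 2 * n * t + r + 1 = 2 * n * (t + 1) + 0 by
      rw [mul_add, mul_one]; omega, hasColour_iff le_rfl (by omega)]; omega

theorem hasColour_pred_iff {i : Fin (n + 1)} {t r : ℤ} (h0 : 0 ≤ r) (hr : r < 2 * n) :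
    HasColour n i (2 * n * t + r - 1) ↔
      (0 < r ∧ (r - 1 = i.val ∨ r - 1 + i.val = 2 * n)) ∨ (r = 1 ∧ i.val = 0) ∨
        (r = 0 ∧ i.val = 1) := by
  have hi := i.2
  by_cases h : 0 < r
  · rw [add_sub_assoc, hasColour_iff (by omega) (by omega)]; omega
  · rw [show 2 * n * t + r - 1 = 2 * n * (t - 1) + (2 * n - 1) by
      rw [mul_sub, mul_one]; omega, hasColour_iff (by omega) (by omega)]; omega

/-- Removing a corner of colour `j` changes the corners of colour `i` by `a_{ij}`. -/
theorem sumOver_colour_rootVec (hn : 2 ≤ n) {i j : Fin (n + 1)} {m : ℤ} (hm : HasColour n j m) :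
    sumOver (HasColour n i) (rootVec m) = cartan n i j := by
  obtain ⟨t, r, h0, h1, rfl⟩ := exists_residue hn m
  have hi := i.2
  have hj := j.2
  rw [hasColour_iff h0 h1] at hm
  rw [sumOver_rootVec, cartan]
  simp only [hasColour_iff h0 h1, hasColour_succ_iff h0 h1, hasColour_pred_iff h0 h1, Fin.ext_iff]
  generalize i.val = a at *
  generalize j.val = b at *
  have hcases : a = b ∨ a + 1 = b ∨ b + 1 = a ∨ (a ≠ b ∧ a + 1 ≠ b ∧ b + 1 ≠ a) := by omega
  rcases hcases with h | h | h | ⟨h, h', h''⟩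
  · rw [if_pos (by omega), if_neg (by omega), if_neg (by omega), if_pos h]; rfl
  · rw [if_neg (by omega), if_neg (by omega : ¬ a = b), if_pos (Or.inl h)]
    split_ifs <;> omega
  · rw [if_neg (by omega), if_neg (by omega : ¬ a = b), if_pos (Or.inr h)]
    split_ifs <;> omega
  · rw [if_neg (by omega), if_neg (by omega), if_neg (by omega), if_neg h, if_neg (by omega)]; rfl

theorem cartan_symm (hn : 2 ≤ n) (i j : Fin (n + 1)) :
    (sInt n i : ℤ) * cartan n i j = sInt n j * cartan n j i := by
  have hi := i.2
  have hj := j.2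
  simp only [sInt, cartan, Fin.ext_iff]
  split_ifs <;> omega

theorem cartan_nonpos {i j : Fin (n + 1)} (h : i ≠ j) : cartan n i j ≤ 0 := by
  rw [cartan, if_neg h]
  split_ifs <;> norm_num

/-! ### Weights -/

theorem simpleRoot_apply (j : Fin (n + 1)) (h : Coweight n) :
    simpleRoot n j h = ∑ i, h.1 i * cartan n i j + if j = 0 then h.2 else 0 := by
  simp only [simpleRoot, LinearMap.add_apply, LinearMap.sum_apply, LinearMap.smul_apply,
    LinearMap.comp_apply, LinearMap.fst_apply, LinearMap.snd_apply, LinearMap.proj_apply,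
    smul_eq_mul, mul_comm (cartan n _ j)]
  congr 1
  split_ifs <;> simp

theorem simpleRoot_hElt (i j : Fin (n + 1)) : simpleRoot n j (hElt n i) = cartan n i j := by
  rw [simpleRoot_apply]
  simp [hElt, Pi.single_apply]

/-- The weight of a diagram. -/
def wt (n : ℕ) (Y : Diagram k) : Weight n :=
  ∑ i, cornerDiff n i Y • (LinearMap.proj i ∘ₗ LinearMap.fst ℤ (Fin (n + 1) → ℤ) ℤ)
    - (zeroBoxes n Y : ℤ) • LinearMap.snd ℤ (Fin (n + 1) → ℤ) ℤ

theorem wt_apply (Y : Diagram k) (h : Coweight n) :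
    wt n Y h = (∑ i, h.1 i * cornerDiff n i Y) - h.2 * (zeroBoxes n Y : ℤ) := by
  simp only [wt, LinearMap.sub_apply, LinearMap.sum_apply, LinearMap.smul_apply,
    LinearMap.comp_apply, LinearMap.fst_apply, LinearMap.snd_apply, LinearMap.proj_apply,
    smul_eq_mul, mul_comm (cornerDiff n _ _), mul_comm (zeroBoxes n Y : ℤ)]

theorem wt_hElt (Y : Diagram k) (i : Fin (n + 1)) : wt n Y (hElt n i) = cornerDiff n i Y := by
  rw [wt_apply]
  simp [hElt, Pi.single_apply]

theorem qpowOp_eq (h : Coweight n) : qpowOp (k := k) n h = diag fun Y => q ^ wt n Y h := by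
  refine fock_hom_ext fun Y => ?_
  rw [qpowOp, extend_single, diag_single, wt_apply]

theorem qpowOp_single (h : Coweight n) (Y : Diagram k) :
    qpowOp n h (Finsupp.single Y 1) = q ^ wt n Y h • Finsupp.single Y 1 := by
  rw [qpowOp_eq, diag_single]

theorem Diagram.le_y_of_zero (Y : Diagram k) (l : ℕ) : Y.y 0 ≤ Y.y l :=
  monotone_nat_of_le_succ Y.le_succ (Nat.zero_le l)

theorem finite_boxes (Y : Diagram k) : {s : ℕ × ℤ | Y.y s.1 < s.2 ∧ s.2 ≤ k}.Finite := by
  obtain ⟨N, hN⟩ := Y.eventually_eq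
  refine ((Set.finite_Iio N).prod (Set.finite_Ioc (Y.y 0) k)).subset ?_
  rintro ⟨l, m⟩ ⟨h1, h2⟩
  dsimp only at h1 h2
  have := Y.le_y_of_zero l
  refine ⟨?_, by simp only [Set.mem_Ioc]; omega⟩
  by_contra h
  have := hN l (by simpa using h)
  omega

theorem Diagram.y_le (Y : Diagram k) (l : ℕ) : Y.y l ≤ k := by
  obtain ⟨N, hN⟩ := Y.eventually_eq
  have h1 := monotone_nat_of_le_succ Y.le_succ (le_max_left l N)
  rw [hN _ (le_max_right l N)] at h1
  exact h1

open Classical in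
theorem zeroBoxes_up {m : ℤ} {Y : Diagram k} (h : Y.corner m = -1) :
    zeroBoxes n Y = zeroBoxes n (Y.up m) + if HasColour n 0 m then 1 else 0 := by
  obtain ⟨s, rfl, hs⟩ := Diagram.exists_isConvex h
  rw [← Diagram.remove_eq_up hs]
  obtain ⟨h1, h2, h3⟩ := hs
  have hy : ∀ l, (Y.remove s ⟨h1, h2, h3⟩).y l = if l = s.1 - 1 then s.2 + 1 else Y.y l :=
    fun l => Function.update_apply _ _ _ _
  have hk : s.2 + 1 ≤ k := by
    have ha := Y.y_le s.1
    have hb := Y.le_succ (s.1 - 1)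
    rw [Nat.sub_add_cancel h1] at hb
    omega
  have hfin : ∀ Z : Diagram k,
      {s : ℕ × ℤ | Z.y s.1 < s.2 ∧ s.2 ≤ k ∧ HasColour n 0 (s.1 + s.2)}.Finite := fun Z =>
    (finite_boxes Z).subset fun s hs => ⟨hs.1, hs.2.1⟩
  have hsum : (((s.1 - 1, s.2 + 1) : ℕ × ℤ).1 : ℤ) + ((s.1 - 1, s.2 + 1) : ℕ × ℤ).2 =
      siteSum s := by simp only [siteSum]; omega
  unfold zeroBoxes
  split_ifs with hc
  · rw [← Set.ncard_insert_of_notMem (a := ((s.1 - 1, s.2 + 1) : ℕ × ℤ)) ?_ (hfin _)]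
    · congr 1
      ext ⟨l, t⟩
      simp only [Set.mem_insert_iff, Set.mem_ofPred_eq, hy, Prod.mk.injEq]
      constructor
      · rintro ⟨g1, g2, g3⟩
        by_cases hl : l = s.1 - 1
        · subst hl
          rw [if_pos rfl]
          by_cases ht : t = s.2 + 1
          · exact Or.inl ⟨rfl, ht⟩
          · exact Or.inr ⟨by omega, g2, g3⟩
        · rw [if_neg hl]; exact Or.inr ⟨g1, g2, g3⟩
      · rintro (⟨rfl, rfl⟩ | ⟨g1, g2, g3⟩)
        · exact ⟨by omega, hk, by rw [hsum]; exact hc⟩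
        · refine ⟨?_, g2, g3⟩
          split_ifs at g1 with hl
          · subst hl; omega
          · exact g1
    · simp [hy]
  · rw [add_zero]
    congr 1
    ext ⟨l, t⟩
    simp only [Set.mem_ofPred_eq, hy]
    refine ⟨?_, ?_⟩
    · rintro ⟨g1, g2, g3⟩
      refine ⟨?_, g2, g3⟩
      split_ifs with hl
      · subst hl
        by_contra hlt
        have ht : t = s.2 + 1 := by omega
        subst ht
        rw [hsum] at g3
        exact hc g3
      · exact g1
    · rintro ⟨g1, g2, g3⟩
      refine ⟨?_, g2, g3⟩
      split_ifs at g1 with hl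
      · subst hl; omega
      · exact g1

theorem wt_up (hn : 2 ≤ n) {j : Fin (n + 1)} {m : ℤ} {Y : Diagram k} (hm : HasColour n j m)
    (h : Y.corner m = -1) : wt n (Y.up m) = wt n Y + simpleRoot n j := by
  classical
  refine LinearMap.ext fun h' => ?_
  rw [LinearMap.add_apply, wt_apply, wt_apply, simpleRoot_apply, zeroBoxes_up (n := n) h]
  have h0 : HasColour n 0 m ↔ j = 0 := ⟨fun h => hm.unique hn h, fun h => h ▸ hm⟩
  simp only [cornerDiff_eq, Diagram.corner_up h, map_add, sumOver_colour_rootVec hn hm, mul_add,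
    Finset.sum_add_distrib, h0]
  split_ifs <;> push_cast <;> ring

theorem wt_down (hn : 2 ≤ n) {j : Fin (n + 1)} {m : ℤ} {Y : Diagram k} (hm : HasColour n j m)
    (h : Y.corner m = 1) : wt n (Y.down m) = wt n Y - simpleRoot n j := by
  have := wt_up hn hm (Diagram.corner_down_self h)
  rw [Diagram.up_down h] at this
  rw [this, add_sub_cancel_right]

/-! ### Commutation relations on the Fock space -/

open Classical in
/-- The term of `E_i Y` that removes the corner on the antidiagonal `s`. -/
def eTerm (n : ℕ) (i : Fin (n + 1)) (s : ℤ) (Y : Diagram k) : Fock k :=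
  if HasColour n i s ∧ Y.corner s = -1 then
    qi n i ^ (sumOver (above n i s) (Y.up s).corner) • Finsupp.single (Y.up s) 1 else 0

open Classical in
/-- The term of `F_j Y` that fills the corner on the antidiagonal `t`. -/
def fTerm (n : ℕ) (j : Fin (n + 1)) (t : ℤ) (Y : Diagram k) : Fock k :=
  if HasColour n j t ∧ Y.corner t = 1 then
    qi n j ^ (-sumOver (below n j t) (Y.down t).corner) • Finsupp.single (Y.down t) 1 else 0

theorem EUpper_eq_sum (i : Fin (n + 1)) {Y : Diagram k} {R : Finset ℤ}
    (hR : Y.corner.support ⊆ R) : EUpper n i (Finsupp.single Y 1) = ∑ s ∈ R, eTerm n i s Y := by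
  classical
  rw [EUpper_single n i Y R hR, Finset.sum_filter]
  refine Finset.sum_congr rfl fun s _ => ?_
  rw [eTerm, stepUp_single]
  by_cases h1 : HasColour n i s <;> by_cases h2 : Y.corner s = -1 <;>
    simp [h1, h2, diag_single]

theorem FUpper_eq_sum (j : Fin (n + 1)) {Y : Diagram k} {R : Finset ℤ}
    (hR : Y.corner.support ⊆ R) : FUpper n j (Finsupp.single Y 1) = ∑ t ∈ R, fTerm n j t Y := by
  classical
  rw [FUpper_single n j Y R hR, Finset.sum_filter]
  refine Finset.sum_congr rfl fun s _ => ?_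
  rw [fTerm, stepDown_single]
  by_cases h1 : HasColour n j s <;> by_cases h2 : Y.corner s = 1 <;>
    simp [h1, h2, diag_single]

theorem sumOver_below_rootVec (hn : 2 ≤ n) {i j : Fin (n + 1)} (hij : i ≠ j) {s t : ℤ}
    (hs : HasColour n i s) (h : Far s t) :
    sumOver (below n j t) (rootVec s) = if s < t then cartan n j i else 0 := by
  classical
  have hs' : ¬ HasColour n j s := fun h => hij (hs.unique hn h)
  rw [← sumOver_colour_rootVec hn hs, sumOver_rootVec, sumOver_rootVec]
  unfold Far at h
  simp only [below, hs', false_and, if_false]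
  by_cases hst : s < t
  · rw [if_pos hst]
    simp only [show s - 1 < t by omega, show s + 1 < t by omega, and_true]
  · rw [if_neg hst]
    simp only [show ¬ s - 1 < t by omega, show ¬ s + 1 < t by omega, and_false, if_false, sub_zero]

theorem sumOver_above_rootVec (hn : 2 ≤ n) {i j : Fin (n + 1)} (hij : i ≠ j) {s t : ℤ}
    (ht : HasColour n j t) (h : Far s t) :
    sumOver (above n i s) (rootVec t) = if s < t then cartan n i j else 0 := by
  classical
  have ht' : ¬ HasColour n i t := fun h => hij (h.unique hn ht)
  rw [← sumOver_colour_rootVec hn ht, sumOver_rootVec, sumOver_rootVec]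
  unfold Far at h
  simp only [above, ht', false_and, if_false]
  by_cases hst : s < t
  · rw [if_pos hst]
    simp only [show s < t - 1 by omega, show s < t + 1 by omega, and_true]
  · rw [if_neg hst]
    simp only [show ¬ s < t - 1 by omega, show ¬ s < t + 1 by omega, and_false, if_false, sub_zero]

open Classical in
/-- The terms of `E_i F_j` and of `F_j E_i` agree one by one when `i ≠ j`. -/
theorem eTerm_fTerm_comm (hn : 2 ≤ n) {i j : Fin (n + 1)} (hij : i ≠ j) (s t : ℤ)
    (Y : Diagram k) :
    (if HasColour n j t ∧ Y.corner t = 1 then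
      qi n j ^ (-sumOver (below n j t) (Y.down t).corner) • eTerm n i s (Y.down t) else 0) =
    (if HasColour n i s ∧ Y.corner s = -1 then
      qi n i ^ (sumOver (above n i s) (Y.up s).corner) • fTerm n j t (Y.up s) else 0) := by
  by_cases hs : HasColour n i s
  swap
  · simp [eTerm, hs]
  by_cases ht : HasColour n j t
  swap
  · simp [fTerm, ht]
  simp only [hs, ht, true_and, eTerm, fTerm]
  have hst : s ≠ t := fun h => hij (hs.unique hn (h ▸ ht))
  by_cases hfar : Far s t
  · -- Distant corners do not interact, and the two exponents change by `s_i a_{ij} = s_j a_{ji}`.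
    rw [Diagram.corner_down_far hfar.symm, Diagram.corner_up_far hfar]
    by_cases h1 : Y.corner t = 1
    swap
    · simp [h1]
    by_cases h2 : Y.corner s = -1
    swap
    · simp [h2]
    rw [if_pos h1, if_pos h2, if_pos h2, if_pos h1, smul_smul, smul_smul,
      ← Diagram.up_down_comm hfar,
      Diagram.corner_down (Y := Y.up s) (by rwa [Diagram.corner_up_far hfar]),
      Diagram.corner_up h2, Diagram.corner_down h1]
    congr 1
    simp only [map_sub, map_add, sumOver_below_rootVec hn hij hs hfar,
      sumOver_above_rootVec hn hij ht hfar, qi, ← zpow_natCast, ← zpow_mul, ← zpow_add₀ q_ne_zero]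
    congr 1
    have := cartan_symm hn i j
    split_ifs <;> linarith
  · have hroot : rootVec t s = -1 ∧ rootVec s t = -1 := by
      unfold Far at hfar
      rw [rootVec_apply, rootVec_apply]
      exact ⟨by rw [if_neg (by omega), if_pos (by omega)],
        by rw [if_neg (by omega), if_pos (by omega)]⟩
    have hl : Y.corner t = 1 → (Y.down t).corner s ≠ -1 := by
      intro h1 h2
      rw [Diagram.corner_down h1, Finsupp.sub_apply, hroot.1] at h2
      have := Y.corner_cases s
      omega
    have hr : Y.corner s = -1 → (Y.up s).corner t ≠ 1 := by
      intro h1 h2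
      rw [Diagram.corner_up h1, Finsupp.add_apply, hroot.2] at h2
      have := Y.corner_cases t
      omega
    rw [ite_eq_right_iff.2 fun h => by rw [if_neg (hl h), smul_zero],
      ite_eq_right_iff.2 fun h => by rw [if_neg (hr h), smul_zero]]

theorem EUpper_FUpper_comm (hn : 2 ≤ n) {i j : Fin (n + 1)} (hij : i ≠ j) :
    EUpper (k := k) n i ∘ₗ FUpper n j = FUpper n j ∘ₗ EUpper n i := by
  classical
  refine fock_hom_ext fun Y => ?_
  -- A finite set of antidiagonals that contains the corners of `Y` and of all its neighbours.
  let R : Finset ℤ := Y.corner.support.biUnion fun m =>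
    {m} ∪ (Y.up m).corner.support ∪ (Y.down m).corner.support
  have hR : ∀ m ∈ Y.corner.support,
      {m} ∪ (Y.up m).corner.support ∪ (Y.down m).corner.support ⊆ R := fun m hm =>
    Finset.subset_biUnion_of_mem
      (fun m => {m} ∪ (Y.up m).corner.support ∪ (Y.down m).corner.support) hm
  have h0 : Y.corner.support ⊆ R := fun m hm => hR m hm (by simp)
  have hup : ∀ m, Y.corner m = -1 → (Y.up m).corner.support ⊆ R := fun m hm =>
    (Finset.subset_union_right.trans Finset.subset_union_left).trans
      (hR m (Finsupp.mem_support_iff.2 (by omega)))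
  have hdown : ∀ m, Y.corner m = 1 → (Y.down m).corner.support ⊆ R := fun m hm =>
    Finset.subset_union_right.trans (hR m (Finsupp.mem_support_iff.2 (by omega)))
  rw [LinearMap.comp_apply, LinearMap.comp_apply, FUpper_eq_sum j h0, EUpper_eq_sum i h0, map_sum,
    map_sum]
  have hE : ∀ t, EUpper n i (fTerm n j t Y) = ∑ s ∈ R,
      if HasColour n j t ∧ Y.corner t = 1 then
        qi n j ^ (-sumOver (below n j t) (Y.down t).corner) • eTerm n i s (Y.down t) else 0 := by
    intro t
    rw [fTerm]
    split_ifs with h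
    · rw [map_smul, EUpper_eq_sum i (hdown t h.2), Finset.smul_sum]
    · rw [map_zero, Finset.sum_const_zero]
  have hF : ∀ s, FUpper n j (eTerm n i s Y) = ∑ t ∈ R,
      if HasColour n i s ∧ Y.corner s = -1 then
        qi n i ^ (sumOver (above n i s) (Y.up s).corner) • fTerm n j t (Y.up s) else 0 := by
    intro s
    rw [eTerm]
    split_ifs with h
    · rw [map_smul, FUpper_eq_sum j (hup s h.2), Finset.smul_sum]
    · rw [map_zero, Finset.sum_const_zero]
  simp only [hE, hF]
  rw [Finset.sum_comm]
  exact Finset.sum_congr rfl fun s _ => Finset.sum_congr rfl fun t _ =>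
    eTerm_fTerm_comm hn hij s t Y

end RootData

/-! ### The action of `U_q(𝔤)` from string bases for all colours -/

section Action

variable {k n : ℕ}

theorem qpowOp_zero : qpowOp (k := k) n 0 = 1 := by
  refine fock_hom_ext fun Y => ?_
  rw [qpowOp_single, map_zero, zpow_zero, one_smul, Module.End.one_apply]

theorem qpowOp_add (h h' : Coweight n) :
    qpowOp (k := k) n (h + h') = qpowOp n h * qpowOp n h' := by
  refine fock_hom_ext fun Y => ?_
  rw [Module.End.mul_apply, qpowOp_single, qpowOp_single, map_smul, qpowOp_single, smul_smul,
    map_add, zpow_add₀ q_ne_zero, mul_comm]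

theorem qpowOp_apply_add (h h' : Coweight n) (v : Fock k) :
    qpowOp n (h + h') v = qpowOp n h (qpowOp n h' v) :=
  LinearMap.congr_fun (qpowOp_add h h') v

theorem qpowOp_neg_of_eq {h : Coweight n} {v : Fock k} {w : ℤ} (hv : qpowOp n h v = q ^ w • v) :
    qpowOp n (-h) v = q ^ (-w) • v := by
  have e : qpowOp n (-h) (qpowOp n h v) = v := by
    rw [← qpowOp_apply_add, neg_add_cancel, qpowOp_zero, Module.End.one_apply]
  rw [hv, map_smul] at e
  nth_rewrite 2 [← e]
  rw [smul_smul, ← zpow_add₀ q_ne_zero, neg_add_cancel, zpow_zero, one_smul]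

theorem qpowOp_nsmul_of_eq {h : Coweight n} {v : Fock k} {w : ℤ} (hv : qpowOp n h v = q ^ w • v)
    (s : ℕ) : qpowOp n ((s : ℤ) • h) v = (q ^ s) ^ w • v := by
  rw [← zpow_natCast, ← zpow_mul]
  induction s with
  | zero => simp [qpowOp_zero]
  | succ s ih =>
    rw [Nat.cast_succ, add_smul, one_smul, qpowOp_apply_add, hv, map_smul, ih, smul_smul,
      ← zpow_add₀ q_ne_zero]
    congr 2
    ring

theorem qpowOp_comm (h h' : Coweight n) (v : Fock k) :
    qpowOp n h (qpowOp n h' v) = qpowOp n h' (qpowOp n h v) := by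
  rw [← qpowOp_apply_add, add_comm, qpowOp_apply_add]

/-- Operators `E_i`, `F_i` on the Fock space that shift weights by `± α_i`, that satisfy
`E_i F_j = F_j E_i` for `i ≠ j`, and that possess a basis of strings for each `i`. -/
structure FockAction (k n : ℕ) where
  E : Fin (n + 1) → Module.End Qq (Fock k)
  F : Fin (n + 1) → Module.End Qq (Fock k)
  strings : ∀ i, StringBasis (qi n i) (E i) (F i) (qpowOp n (hElt n i)) (Diagram k)
  qpow_E : ∀ i h v, qpowOp n h (E i v) = q ^ simpleRoot n i h • E i (qpowOp n h v)
  qpow_F : ∀ i h v, qpowOp n h (F i v) = q ^ (-simpleRoot n i h) • F i (qpowOp n h v)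
  comm : ∀ i j, i ≠ j → ∀ v, E i (F j v) = F j (E i v)

namespace FockAction

variable (Φ : FockAction k n)

theorem E_F_same (i : Fin (n + 1)) : Φ.E i * Φ.F i - Φ.F i * Φ.E i =
    (qi n i - (qi n i)⁻¹)⁻¹ •
      (qpowOp n ((sInt n i : ℤ) • hElt n i) - qpowOp n (-((sInt n i : ℤ) • hElt n i))) := by
  refine fock_hom_ext fun Y => ?_
  have hK : qpowOp n (hElt n i) (Finsupp.single Y (1 : Qq)) =
      q ^ cornerDiff n i Y • Finsupp.single Y 1 := by rw [qpowOp_single, wt_hElt]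
  rw [LinearMap.sub_apply, Module.End.mul_apply, Module.End.mul_apply,
    (Φ.strings i).commutator (generic_qi n i) hK, add_sub_cancel_left, LinearMap.smul_apply,
    LinearMap.sub_apply, qpowOp_single, qpowOp_single, ← sub_smul, smul_smul, map_neg, map_smul,
    wt_hElt, smul_eq_mul, qIntZ, div_eq_inv_mul]
  simp only [qi, ← zpow_natCast, ← zpow_mul, mul_neg]

theorem swap_K (i : Fin (n + 1)) (Y : Diagram k) :
    qpowOp n (-hElt n i) ((Φ.strings i).G Y) =
      q ^ (-(((Φ.strings i).ph Y : ℤ) - (Φ.strings i).ep Y)) • (Φ.strings i).G Y :=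
  qpowOp_neg_of_eq ((Φ.strings i).K_G Y)

theorem toNat_one_sub_cartan {i j : Fin (n + 1)} (hij : i ≠ j) :
    0 < (1 - cartan n i j).toNat ∧ (1 - ((1 - cartan n i j).toNat : ℤ)) = cartan n i j := by
  have := cartan_nonpos (n := n) hij
  omega

theorem serre_E {i j : Fin (n + 1)} (hij : i ≠ j) :
    StringBasis.serreOp (qi n i) (Φ.E i) (Φ.E j) (1 - cartan n i j).toNat = 0 := by
  obtain ⟨h0, h1⟩ := toNat_one_sub_cartan hij
  refine (Φ.strings i).serreOp_eq_zero (generic_qi n i) h0 (Φ.comm j i hij.symm) fun v w hv => ?_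
  rw [Φ.qpow_E, hv, map_smul, smul_smul, ← zpow_add₀ q_ne_zero, h1, simpleRoot_hElt, add_comm]

theorem serre_F {i j : Fin (n + 1)} (hij : i ≠ j) :
    StringBasis.serreOp (qi n i) (Φ.F i) (Φ.F j) (1 - cartan n i j).toNat = 0 := by
  obtain ⟨h0, h1⟩ := toNat_one_sub_cartan hij
  refine ((Φ.strings i).swap _ (Φ.swap_K i)).serreOp_eq_zero (generic_qi n i) h0
    (fun v => (Φ.comm i j hij v).symm) fun v w hv => ?_
  rw [Φ.qpow_F, hv, map_smul, smul_smul, ← zpow_add₀ q_ne_zero, h1, map_neg, simpleRoot_hElt,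
    neg_neg, add_comm]

/-- The images of the generators. -/
def onGen : Gen n → Module.End Qq (Fock k)
  | .e i => Φ.E i
  | .f i => Φ.F i
  | .qpow h => qpowOp n h

theorem lift_serre (x : Fin (n + 1) → FreeAlgebra Qq (Gen n)) (i j : Fin (n + 1)) :
    FreeAlgebra.lift Qq Φ.onGen (serre n x i j) =
      StringBasis.serreOp (qi n i) (FreeAlgebra.lift Qq Φ.onGen (x i))
        (FreeAlgebra.lift Qq Φ.onGen (x j)) (1 - cartan n i j).toNat := by
  simp only [serre, StringBasis.serreOp, map_sum, map_smul, map_mul, map_pow]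

theorem lift_rel {a b : FreeAlgebra Qq (Gen n)} (h : Rel n a b) :
    FreeAlgebra.lift Qq Φ.onGen a = FreeAlgebra.lift Qq Φ.onGen b := by
  cases h with
  | qpow_zero => simpa [onGen] using qpowOp_zero
  | qpow_add h h' => simpa [onGen] using (qpowOp_add h h').symm
  | qpow_e h i =>
    simp only [map_mul, map_smul, FreeAlgebra.lift_ι_apply, onGen]
    refine LinearMap.ext fun v => ?_
    rw [Module.End.mul_apply, Module.End.mul_apply, Φ.qpow_E, ← qpowOp_apply_add, add_neg_cancel,
      qpowOp_zero, Module.End.one_apply, LinearMap.smul_apply]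
  | qpow_f h i =>
    simp only [map_mul, map_smul, FreeAlgebra.lift_ι_apply, onGen]
    refine LinearMap.ext fun v => ?_
    rw [Module.End.mul_apply, Module.End.mul_apply, Φ.qpow_F, ← qpowOp_apply_add, add_neg_cancel,
      qpowOp_zero, Module.End.one_apply, LinearMap.smul_apply]
  | e_f_same i =>
    simp only [map_mul, map_smul, map_sub, FreeAlgebra.lift_ι_apply, onGen]
    exact Φ.E_F_same i
  | e_f_ne i j hij =>
    simp only [map_mul, map_sub, map_zero, FreeAlgebra.lift_ι_apply, onGen]
    exact sub_eq_zero.2 (LinearMap.ext fun v => Φ.comm i j hij v)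
  | serre_e i j hij =>
    rw [lift_serre, map_zero]
    simp only [FreeAlgebra.lift_ι_apply, onGen]
    exact Φ.serre_E hij
  | serre_f i j hij =>
    rw [lift_serre, map_zero]
    simp only [FreeAlgebra.lift_ι_apply, onGen]
    exact Φ.serre_F hij

/-- The representation of `U_q(𝔤)` on the Fock space. -/
def rep : Uq n →ₐ[Qq] Module.End Qq (Fock k) :=
  RingQuot.liftAlgHom Qq ⟨FreeAlgebra.lift Qq Φ.onGen, fun _ _ h => Φ.lift_rel h⟩

theorem rep_e (i : Fin (n + 1)) : Φ.rep (Uq.e n i) = Φ.E i := by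
  rw [rep, Uq.e, RingQuot.liftAlgHom_mkAlgHom_apply, FreeAlgebra.lift_ι_apply, onGen]

theorem rep_f (i : Fin (n + 1)) : Φ.rep (Uq.f n i) = Φ.F i := by
  rw [rep, Uq.f, RingQuot.liftAlgHom_mkAlgHom_apply, FreeAlgebra.lift_ι_apply, onGen]

theorem rep_qpow (h : Coweight n) : Φ.rep (Uq.qpow n h) = qpowOp n h := by
  rw [rep, Uq.qpow, RingQuot.liftAlgHom_mkAlgHom_apply, FreeAlgebra.lift_ι_apply, onGen]

end FockAction

end Action

/-! ### The two actions on the Fock space -/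

section TwoActions

variable {k n : ℕ}

theorem qpowOp_eTerm (hn : 2 ≤ n) (i : Fin (n + 1)) (h : Coweight n) (s : ℤ) (Y : Diagram k) :
    qpowOp n h (eTerm n i s Y) = q ^ (simpleRoot n i h + wt n Y h) • eTerm n i s Y := by
  rw [eTerm]
  split_ifs with hs
  · rw [map_smul, qpowOp_single, wt_up hn hs.1 hs.2, smul_comm, LinearMap.add_apply, add_comm]
  · rw [map_zero, smul_zero]

theorem qpowOp_fTerm (hn : 2 ≤ n) (i : Fin (n + 1)) (h : Coweight n) (s : ℤ) (Y : Diagram k) :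
    qpowOp n h (fTerm n i s Y) = q ^ (-simpleRoot n i h + wt n Y h) • fTerm n i s Y := by
  rw [fTerm]
  split_ifs with hs
  · rw [map_smul, qpowOp_single, wt_down hn hs.1 hs.2, smul_comm, LinearMap.sub_apply,
      sub_eq_add_neg, add_comm]
  · rw [map_zero, smul_zero]

theorem qpowOp_EUpper (hn : 2 ≤ n) (i : Fin (n + 1)) (h : Coweight n) (v : Fock k) :
    qpowOp n h (EUpper n i v) = q ^ simpleRoot n i h • EUpper n i (qpowOp n h v) := by
  suffices e : qpowOp n h ∘ₗ EUpper (k := k) n i =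
      q ^ simpleRoot n i h • (EUpper n i ∘ₗ qpowOp n h) from LinearMap.congr_fun e v
  refine fock_hom_ext fun Y => ?_
  rw [LinearMap.comp_apply, LinearMap.smul_apply, LinearMap.comp_apply, qpowOp_single, map_smul,
    smul_smul, ← zpow_add₀ q_ne_zero, EUpper_eq_sum i subset_rfl, map_sum, Finset.smul_sum]
  exact Finset.sum_congr rfl fun s _ => qpowOp_eTerm hn i h s Y

theorem qpowOp_FUpper (hn : 2 ≤ n) (i : Fin (n + 1)) (h : Coweight n) (v : Fock k) :
    qpowOp n h (FUpper n i v) = q ^ (-simpleRoot n i h) • FUpper n i (qpowOp n h v) := by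
  suffices e : qpowOp n h ∘ₗ FUpper (k := k) n i =
      q ^ (-simpleRoot n i h) • (FUpper n i ∘ₗ qpowOp n h) from LinearMap.congr_fun e v
  refine fock_hom_ext fun Y => ?_
  rw [LinearMap.comp_apply, LinearMap.smul_apply, LinearMap.comp_apply, qpowOp_single, map_smul,
    smul_smul, ← zpow_add₀ q_ne_zero, FUpper_eq_sum i subset_rfl, map_sum, Finset.smul_sum]
  exact Finset.sum_congr rfl fun s _ => qpowOp_fTerm hn i h s Y

theorem sumOver_below_add_above {i : Fin (n + 1)} {m : ℤ} (hm : HasColour n i m) (c : ℤ →₀ ℤ) :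
    sumOver (below n i m) c + sumOver (above n i m) c + c m = sumOver (HasColour n i) c := by
  classical
  have key : sumOver (below n i m) + sumOver (above n i m) + Finsupp.applyAddHom m =
      sumOver (HasColour n i) := by
    refine Finsupp.addHom_ext fun a b => ?_
    simp only [AddMonoidHom.add_apply, sumOver_single, Finsupp.applyAddHom_apply,
      Finsupp.single_apply, below, above]
    by_cases ha : HasColour n i a
    · simp only [ha, true_and]
      rcases lt_trichotomy a m with h | h | h
      · rw [if_pos h, if_neg (by omega), if_neg (by omega)]; simp
      · rw [if_neg (by omega), if_neg (by omega), if_pos h]; simp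
      · rw [if_neg (by omega), if_pos h, if_neg (by omega)]; simp
    · have : a ≠ m := fun h => ha (h ▸ hm)
      simp [ha, this]
  exact DFunLike.congr_fun key c

theorem qpowOp_sInt_single (i : Fin (n + 1)) (Y : Diagram k) :
    qpowOp n ((sInt n i : ℤ) • hElt n i) (Finsupp.single Y 1) =
      qi n i ^ (sumOver (HasColour n i) Y.corner) • Finsupp.single Y 1 := by
  rw [qpowOp_single, map_smul, wt_hElt, cornerDiff_eq, qi, ← zpow_natCast, ← zpow_mul, smul_eq_mul]

theorem qpowOp_neg_sInt_single (i : Fin (n + 1)) (Y : Diagram k) :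
    qpowOp n (-((sInt n i : ℤ) • hElt n i)) (Finsupp.single Y 1) =
      qi n i ^ (-sumOver (HasColour n i) Y.corner) • Finsupp.single Y 1 := by
  rw [qpowOp_single, map_neg, map_smul, wt_hElt, cornerDiff_eq, qi, ← zpow_natCast, ← zpow_mul,
    smul_eq_mul, mul_neg]

/-- `E_i' = q_i k_i^{-1} E_i`. -/
theorem ELower_eq (i : Fin (n + 1)) (v : Fock k) :
    ELower n i v = qi n i • qpowOp n (-((sInt n i : ℤ) • hElt n i)) (EUpper n i v) := by
  classical
  suffices e : ELower (k := k) n i =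
      qi n i • (qpowOp n (-((sInt n i : ℤ) • hElt n i)) ∘ₗ EUpper n i) from LinearMap.congr_fun e v
  refine fock_hom_ext fun Y => ?_
  rw [LinearMap.smul_apply, LinearMap.comp_apply, ELower_single n i Y _ subset_rfl,
    EUpper_single n i Y _ subset_rfl, map_sum, Finset.smul_sum]
  refine Finset.sum_congr rfl fun m hm => ?_
  rw [stepUp_single]
  split_ifs with h
  · have hs := sumOver_below_add_above (Finset.mem_filter.1 hm).2 (Y.up m).corner
    rw [Diagram.corner_up_self h] at hs
    rw [diag_single, diag_single, map_smul, qpowOp_neg_sInt_single, smul_smul, smul_smul]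
    congr 1
    have hx := (generic_qi n i).ne_zero
    rw [← hs, ← zpow_one_add₀ hx, ← zpow_add₀ hx]
    congr 1
    ring
  · simp

/-- `F_i' = q_i k_i F_i`. -/
theorem FLower_eq (i : Fin (n + 1)) (v : Fock k) :
    FLower n i v = qi n i • qpowOp n ((sInt n i : ℤ) • hElt n i) (FUpper n i v) := by
  classical
  suffices e : FLower (k := k) n i =
      qi n i • (qpowOp n ((sInt n i : ℤ) • hElt n i) ∘ₗ FUpper n i) from LinearMap.congr_fun e v
  refine fock_hom_ext fun Y => ?_
  rw [LinearMap.smul_apply, LinearMap.comp_apply, FLower_single n i Y _ subset_rfl,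
    FUpper_single n i Y _ subset_rfl, map_sum, Finset.smul_sum]
  refine Finset.sum_congr rfl fun m hm => ?_
  rw [stepDown_single]
  split_ifs with h
  · have hs := sumOver_below_add_above (Finset.mem_filter.1 hm).2 (Y.down m).corner
    rw [Diagram.corner_down_self h] at hs
    rw [diag_single, diag_single, map_smul, qpowOp_sInt_single, smul_smul, smul_smul]
    congr 1
    have hx := (generic_qi n i).ne_zero
    rw [← hs, ← zpow_one_add₀ hx, ← zpow_add₀ hx]
    congr 1
    ring
  · simp

theorem cornerList_et (i : Fin (n + 1)) (Y : Diagram k) :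
    cornerList n i (et (cornerList n i Y) Y) = cornerList n i Y := by
  rw [cornerList, corners_et fun p hp => colour_of_mem_cornerList hp, cornerList]

theorem cornerList_ft (i : Fin (n + 1)) (Y : Diagram k) :
    cornerList n i (ft (cornerList n i Y) Y) = cornerList n i Y := by
  rw [cornerList, corners_ft fun p hp => colour_of_mem_cornerList hp, cornerList]

/-- The basis of strings for the operators `E_i`, `F_i`. -/
def upperStrings (k n : ℕ) (i : Fin (n + 1)) :
    StringBasis (qi n i) (EUpper (k := k) n i) (FUpper n i) (qpowOp n (hElt n i)) (Diagram k) where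
  G := Finsupp.basisSingleOne.map (stringsEquiv k n i)
  ep Y := eps (cornerList n i Y) Y
  ph Y := phi (cornerList n i Y) Y
  e Y := et (cornerList n i Y) Y
  f Y := ft (cornerList n i Y) Y
  E_G Y := by simpa using EUpper_strings Y
  F_G Y := by simpa using FUpper_strings Y
  K_G Y := by
    have h : qpowOp (k := k) n (hElt n i) = diag fun Z => q ^ cornerDiff n i Z := by
      simp only [qpowOp_eq, wt_hElt]
    rw [h]
    simpa using diag_cornerDiff_strings (n := n) (i := i) Y
  e_spec Y h := by
    simp only [cornerList_et]
    exact et_spec (spread_cornerList n i Y) Y h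
  f_spec Y h := by
    simp only [cornerList_ft]
    exact ft_spec (spread_cornerList n i Y) Y h

theorem upperStrings_G (i : Fin (n + 1)) (Y : Diagram k) :
    (upperStrings k n i).G Y = stringsEquiv k n i (Finsupp.single Y 1) := by
  simp [upperStrings]

/-- Replacing `E`, `F` by `x k⁻¹ E`, `x k F` rescales the vector `G b` by `x^{ε(b) φ(b)}`. -/
def StringBasis.twist {M ι : Type*} [AddCommGroup M] [Module Qq M] {x : Qq}
    {E F K E' F' T T' : Module.End Qq M} (S : StringBasis x E F K ι) (hx : x ≠ 0)
    (hT : ∀ b, T (S.G b) = x ^ ((S.ph b : ℤ) - S.ep b) • S.G b)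
    (hT' : ∀ b, T' (S.G b) = x ^ (-((S.ph b : ℤ) - S.ep b)) • S.G b)
    (hE : ∀ v, E' v = x • T' (E v)) (hF : ∀ v, F' v = x • T (F v)) :
    StringBasis x E' F' K ι where
  G := S.G.unitsSMul fun b => Units.mk0 (x ^ (S.ep b * S.ph b)) (pow_ne_zero _ hx)
  ep := S.ep
  ph := S.ph
  e := S.e
  f := S.f
  E_G b := by
    simp only [Module.Basis.unitsSMul_apply, Units.smul_def, Units.val_mk0]
    rw [map_smul, hE, S.E_G, map_smul, hT']
    rcases Nat.eq_zero_or_pos (S.ep b) with h | h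
    · simp [h, qInt_zero]
    · obtain ⟨h1, h2, -⟩ := S.e_spec b h
      simp only [smul_smul, ← h1, h2]
      congr 1
      have e : x ^ ((S.ep (S.e b) + 1) * S.ph b) *
          (x * x ^ (-(((S.ph b + 1 : ℕ) : ℤ) - S.ep (S.e b)))) =
            x ^ (S.ep (S.e b) * (S.ph b + 1)) := by
        simp only [← zpow_natCast]
        rw [← zpow_one_add₀ hx, ← zpow_add₀ hx]
        congr 1
        push_cast
        ring
      rw [← e]
      ring
  F_G b := by
    simp only [Module.Basis.unitsSMul_apply, Units.smul_def, Units.val_mk0]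
    rw [map_smul, hF, S.F_G, map_smul, hT]
    rcases Nat.eq_zero_or_pos (S.ph b) with h | h
    · simp [h, qInt_zero]
    · obtain ⟨h1, h2, -⟩ := S.f_spec b h
      simp only [smul_smul, ← h2, h1]
      congr 1
      have e : x ^ (S.ep b * (S.ph (S.f b) + 1)) *
          (x * x ^ ((S.ph (S.f b) : ℤ) - (S.ep b + 1 : ℕ))) =
            x ^ ((S.ep b + 1) * S.ph (S.f b)) := by
        simp only [← zpow_natCast]
        rw [← zpow_one_add₀ hx, ← zpow_add₀ hx]
        congr 1
        push_cast
        ring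
      rw [← e]
      ring
  K_G b := by
    simp only [Module.Basis.unitsSMul_apply, Units.smul_def]
    rw [map_smul, S.K_G, smul_comm]
  e_spec := S.e_spec
  f_spec := S.f_spec

/-- The action on the Fock space by `E_i`, `F_i`. -/
def upperAction (k n : ℕ) (hn : 2 ≤ n) : FockAction k n where
  E := EUpper n
  F := FUpper n
  strings := upperStrings k n
  qpow_E := qpowOp_EUpper hn
  qpow_F := qpowOp_FUpper hn
  comm _ _ hij v := LinearMap.congr_fun (EUpper_FUpper_comm hn hij) v

theorem qpowOp_ELower (hn : 2 ≤ n) (i : Fin (n + 1)) (h : Coweight n) (v : Fock k) :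
    qpowOp n h (ELower n i v) = q ^ simpleRoot n i h • ELower n i (qpowOp n h v) := by
  rw [ELower_eq, ELower_eq, map_smul, qpowOp_comm, qpowOp_EUpper hn, map_smul,
    smul_comm (q ^ simpleRoot n i h)]

theorem qpowOp_FLower (hn : 2 ≤ n) (i : Fin (n + 1)) (h : Coweight n) (v : Fock k) :
    qpowOp n h (FLower n i v) = q ^ (-simpleRoot n i h) • FLower n i (qpowOp n h v) := by
  rw [FLower_eq, FLower_eq, map_smul, qpowOp_comm, qpowOp_FUpper hn, map_smul,
    smul_comm (q ^ (-simpleRoot n i h))]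

theorem ELower_FLower_comm (hn : 2 ≤ n) {i j : Fin (n + 1)} (hij : i ≠ j) (v : Fock k) :
    ELower n i (FLower n j v) = FLower n j (ELower n i v) := by
  have hE : ∀ (h : Coweight n) (u : Fock k), EUpper n i (qpowOp n h u) =
      q ^ (-simpleRoot n i h) • qpowOp n h (EUpper n i u) := fun h u => by
    rw [qpowOp_EUpper hn, smul_smul, ← zpow_add₀ q_ne_zero, neg_add_cancel, zpow_zero, one_smul]
  have hF : ∀ (h : Coweight n) (u : Fock k), FUpper n j (qpowOp n h u) =
      q ^ simpleRoot n j h • qpowOp n h (FUpper n j u) := fun h u => by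
    rw [qpowOp_FUpper hn, smul_smul, ← zpow_add₀ q_ne_zero, add_neg_cancel, zpow_zero, one_smul]
  have hc : simpleRoot n i ((sInt n j : ℤ) • hElt n j) =
      simpleRoot n j ((sInt n i : ℤ) • hElt n i) := by
    rw [map_smul, map_smul, simpleRoot_hElt, simpleRoot_hElt, smul_eq_mul, smul_eq_mul,
      cartan_symm hn]
  have e : EUpper n i (FUpper n j v) = FUpper n j (EUpper n i v) :=
    LinearMap.congr_fun (EUpper_FUpper_comm hn hij) v
  rw [FLower_eq, ELower_eq, ELower_eq, FLower_eq, map_smul, map_smul, map_smul, map_smul, hE, hF, e,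
    map_smul, hc, map_neg, qpowOp_comm, smul_comm (qi n i)]
  simp only [map_smul]

/-- The basis of strings for the operators `E_i'`, `F_i'`. -/
def lowerStrings (k n : ℕ) (i : Fin (n + 1)) :
    StringBasis (qi n i) (ELower (k := k) n i) (FLower n i) (qpowOp n (hElt n i)) (Diagram k) :=
  (upperStrings k n i).twist (generic_qi n i).ne_zero
    (fun b => qpowOp_nsmul_of_eq ((upperStrings k n i).K_G b) (sInt n i))
    (fun b => by
      rw [← smul_neg]
      exact qpowOp_nsmul_of_eq (qpowOp_neg_of_eq ((upperStrings k n i).K_G b)) (sInt n i))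
    (ELower_eq i) (FLower_eq i)

/-- The action on the Fock space by `E_i'`, `F_i'`. -/
def lowerAction (k n : ℕ) (hn : 2 ≤ n) : FockAction k n where
  E := ELower n
  F := FLower n
  strings := lowerStrings k n
  qpow_E := qpowOp_ELower hn
  qpow_F := qpowOp_FLower hn
  comm _ _ hij := ELower_FLower_comm hn hij

end TwoActions

/-! ### Finiteness of the set of diagrams of a given weight -/

section Finiteness

variable {k n : ℕ}

/-- If the `b + 1` boxes `c 0, …, c b` of `Y` are distinct and of colour `0`, then `Y` has more
than `b` boxes of colour `0`. -/
theorem lt_zeroBoxes {Y : Diagram k} {b : ℕ} (c : ℕ → ℕ × ℤ) (hc : Function.Injective c)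
    (h : ∀ t ≤ b, Y.y (c t).1 < (c t).2 ∧ (c t).2 ≤ k ∧ HasColour n 0 ((c t).1 + (c t).2)) :
    b < zeroBoxes n Y := by
  have hfin : {s : ℕ × ℤ | Y.y s.1 < s.2 ∧ s.2 ≤ k ∧ HasColour n 0 (s.1 + s.2)}.Finite :=
    (finite_boxes Y).subset fun s hs => ⟨hs.1, hs.2.1⟩
  have h1 : c '' Set.Iic b ⊆ {s : ℕ × ℤ | Y.y s.1 < s.2 ∧ s.2 ≤ k ∧ HasColour n 0 (s.1 + s.2)} := by
    rintro _ ⟨t, ht, rfl⟩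
    exact h t ht
  have h2 := Set.ncard_le_ncard h1 hfin
  rw [Set.ncard_image_of_injective _ hc, ← Finset.coe_Iic, Set.ncard_coe_finset, Nat.card_Iic] at h2
  exact h2

theorem hasColour_zero_of_dvd {m : ℤ} (h : (2 * n : ℤ) ∣ m) : HasColour n 0 m :=
  Or.inl ((Int.modEq_zero_iff_dvd).2 h)

/-- Along its first column, a diagram has a box of colour `0` in any `2n` consecutive ones. -/
theorem le_y_zero (hn : 2 ≤ n) (Y : Diagram k) :
    (k : ℤ) - 2 * n * (zeroBoxes n Y + 1) ≤ Y.y 0 := by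
  by_contra! hlt
  set b := zeroBoxes n Y with hb
  have h0 : (0 : ℤ) ≤ (k : ℤ) % (2 * n) := Int.emod_nonneg _ (by omega)
  have h1 : (k : ℤ) % (2 * n) < 2 * n := Int.emod_lt_of_pos _ (by omega)
  have hk := Int.mul_ediv_add_emod (k : ℤ) (2 * n)
  refine lt_irrefl b (hb ▸ lt_zeroBoxes (n := n) (Y := Y) (b := b)
    (fun t => (0, k - (k : ℤ) % (2 * n) - 2 * n * t)) ?_ ?_)
  · intro s t hst
    have h2 : (2 * n : ℤ) * s = 2 * n * t := by
      have := (Prod.mk.inj hst).2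
      linarith
    exact_mod_cast mul_left_cancel₀ (by omega) h2
  · intro t ht
    have ht' : (2 * n : ℤ) * t ≤ 2 * n * b := by gcongr
    have ht0 : (0 : ℤ) ≤ 2 * n * t := by positivity
    refine ⟨?_, ?_, hasColour_zero_of_dvd ⟨(k : ℤ) / (2 * n) - t, ?_⟩⟩
    · dsimp only; linarith
    · dsimp only; linarith
    · dsimp only; push_cast; linarith

/-- Along its first row, a diagram has a box of colour `0` in any `2n` consecutive ones. -/
theorem y_eq_of_le (hn : 2 ≤ n) (Y : Diagram k) {l : ℕ} (hl : 2 * n * (zeroBoxes n Y + 1) ≤ l) :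
    Y.y l = k := by
  refine le_antisymm (Y.y_le l) ?_
  by_contra! hlt
  set b := zeroBoxes n Y with hb
  have h0 : (0 : ℤ) ≤ (-(k : ℤ)) % (2 * n) := Int.emod_nonneg _ (by omega)
  have h1 : (-(k : ℤ)) % (2 * n) < 2 * n := Int.emod_lt_of_pos _ (by omega)
  have hk := Int.mul_ediv_add_emod (-(k : ℤ)) (2 * n)
  obtain ⟨r, hr⟩ := Int.eq_ofNat_of_zero_le h0
  rw [hr] at h1 hk
  have h1' : r < 2 * n := by exact_mod_cast h1
  refine lt_irrefl b (hb ▸ lt_zeroBoxes (n := n) (Y := Y) (b := b)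
    (fun t => (r + 2 * n * t, k)) ?_ ?_)
  · intro s t hst
    have h2 : 2 * n * s = 2 * n * t := Nat.add_left_cancel (Prod.mk.inj hst).1
    exact Nat.eq_of_mul_eq_mul_left (by omega) h2
  · intro t ht
    have ht' : 2 * n * t ≤ 2 * n * b := by gcongr
    have hle : r + 2 * n * t ≤ l := by linarith
    refine ⟨lt_of_le_of_lt (monotone_nat_of_le_succ Y.le_succ hle) hlt, le_rfl,
      hasColour_zero_of_dvd ⟨t - (-(k : ℤ)) / (2 * n), ?_⟩⟩
    dsimp only; push_cast; linarith

theorem finite_zeroBoxes (hn : 2 ≤ n) (b : ℕ) : {Y : Diagram k | zeroBoxes n Y = b}.Finite := by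
  let N := 2 * n * (b + 1)
  let φ : {Y : Diagram k | zeroBoxes n Y = b} → (Fin N → Set.Icc ((k : ℤ) - N) k) := fun Y l =>
    ⟨Y.1.y l, by
      have h := le_y_zero hn Y.1
      rw [show zeroBoxes n Y.1 = b from Y.2] at h
      have h' : ((k : ℤ) - N) = (k : ℤ) - 2 * n * (b + 1) := by simp only [N]; push_cast; ring
      exact ⟨(h' ▸ h).trans (Y.1.le_y_of_zero l), Y.1.y_le l⟩⟩
  refine Finite.of_injective φ fun Y Z hYZ => Subtype.ext (Diagram.ext (funext fun l => ?_))
  by_cases hl : l < N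
  · exact congrArg Subtype.val (congrFun hYZ ⟨l, hl⟩)
  · rw [y_eq_of_le hn Y.1 (by rw [show zeroBoxes n Y.1 = b from Y.2]; omega),
      y_eq_of_le hn Z.1 (by rw [show zeroBoxes n Z.1 = b from Z.2]; omega)]

end Finiteness

/-! ### Integrability -/

section Integrable

variable {k n : ℕ}

/-- The empty diagram. -/
def emptyDiagram (k : ℕ) : Diagram k where
  y _ := k
  le_succ _ := le_rfl
  eventually_eq := ⟨0, fun _ _ => rfl⟩

/-- Removing boxes one by one, one sees that weights lie in `wt(∅) - ∑ ℕ α_i`. -/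
theorem exists_wt_eq (hn : 2 ≤ n) (Y : Diagram k) :
    ∃ c : Fin (n + 1) → ℕ, wt n Y = wt n (emptyDiagram k) - ∑ i, c i • simpleRoot n i := by
  induction hN : Set.ncard {s : ℕ × ℤ | Y.y s.1 < s.2 ∧ s.2 ≤ k} using Nat.strong_induction_on
    generalizing Y with
  | _ N ih =>
    by_cases h : ∃ l, Y.y l ≠ Y.y (l + 1)
    · obtain ⟨l, hl⟩ := h
      have hs : Y.IsConvex (l + 1, Y.y l) := ⟨by simp, rfl, hl⟩
      have hc := hs.corner
      obtain ⟨j, hj⟩ := exists_colour hn (siteSum (l + 1, Y.y l))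
      have hy : ∀ l', (Y.remove _ hs).y l' = if l' = l then Y.y l + 1 else Y.y l' :=
        fun l' => Function.update_apply _ _ _ _
      have hlt : Set.ncard {s : ℕ × ℤ | (Y.remove _ hs).y s.1 < s.2 ∧ s.2 ≤ k} < N := by
        rw [← hN]
        refine Set.ncard_lt_ncard ⟨?_, fun hsub => ?_⟩ (finite_boxes Y)
        · rintro ⟨a, m⟩ ⟨h1, h2⟩
          refine ⟨?_, h2⟩
          rw [hy] at h1
          dsimp only at h1 ⊢
          split_ifs at h1 with hal
          · subst hal; omega
          · exact h1
        · have hk := Y.y_le (l + 1)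
          have hle := Y.le_succ l
          have := (hsub (a := (l, Y.y l + 1)) ⟨by simp, by dsimp only; omega⟩).1
          rw [hy] at this
          simp at this
      obtain ⟨c, h⟩ := ih _ hlt _ rfl
      refine ⟨c + Pi.single j 1, ?_⟩
      rw [Diagram.remove_eq_up hs, wt_up hn hj hc] at h
      simp only [Pi.add_apply, add_smul, Finset.sum_add_distrib]
      rw [← sub_sub, ← h]
      simp [Pi.single_apply, ite_smul]
    · push Not at h
      have hY : Y = emptyDiagram k := by
        obtain ⟨M, hM⟩ := Y.eventually_eq
        have hconst : ∀ l, Y.y l = Y.y 0 := fun l => by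
          induction l with
          | zero => rfl
          | succ l ih' => rw [← h, ih']
        ext l
        rw [hconst, ← hconst M, hM M le_rfl, emptyDiagram]
      exact ⟨0, by simp [hY]⟩

namespace FockAction

variable (Φ : FockAction k n)

theorem weightSpace_eq (μ : Weight n) :
    weightSpace Φ.rep μ = Finsupp.supported Qq Qq {Y | wt n Y = μ} := by
  have hcoord : ∀ (h : Coweight n) (v : Fock k) (Y : Diagram k),
      qpowOp n h v Y = q ^ wt n Y h * v Y := by
    intro h v Y
    classical
    have key : Finsupp.lapply Y ∘ₗ qpowOp n h = q ^ wt n Y h • Finsupp.lapply (R := Qq) Y := by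
      refine Finsupp.basisSingleOne.ext fun Z => ?_
      rw [Finsupp.coe_basisSingleOne, LinearMap.comp_apply, qpowOp_single, LinearMap.smul_apply,
        map_smul, Finsupp.lapply_apply,
        Finsupp.single_apply]
      split_ifs with hZ
      · rw [hZ]
      · simp
    exact LinearMap.congr_fun key v
  ext v
  constructor
  · intro hv Y hY
    refine LinearMap.ext fun h => ?_
    have := DFunLike.congr_fun (hv h) Y
    rw [rep_qpow, hcoord, Finsupp.smul_apply, smul_eq_mul] at this
    exact q_zpow_injective (mul_right_cancel₀ (Finsupp.mem_support_iff.1 hY) this)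
  · intro hv h
    ext Y
    rw [rep_qpow, hcoord, Finsupp.smul_apply, smul_eq_mul]
    by_cases hY : v Y = 0
    · rw [hY, mul_zero, mul_zero]
    · rw [show wt n Y = μ from hv (Finsupp.mem_support_iff.2 hY)]

theorem single_mem_weightSpace (Y : Diagram k) :
    Finsupp.single Y (1 : Qq) ∈ weightSpace Φ.rep (wt n Y) := by
  rw [weightSpace_eq]
  exact Finsupp.single_mem_supported Qq _ rfl

theorem iSup_weightSpace_ne_le (μ : Weight n) : ⨆ (ν) (_ : ν ≠ μ), weightSpace Φ.rep ν ≤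
    Finsupp.supported Qq Qq {Y | wt n Y ≠ μ} :=
  iSup₂_le fun ν hν => by
    rw [weightSpace_eq]
    exact Finsupp.supported_mono fun Y hY => by
      rw [Set.mem_ofPred_eq] at hY ⊢
      rwa [hY]

theorem disjoint_supported_wt (μ : Weight n) :
    Disjoint (weightSpace Φ.rep μ) (Finsupp.supported Qq Qq {Y | wt n Y ≠ μ}) := by
  rw [weightSpace_eq]
  exact Finsupp.disjoint_supported_supported
    (Set.disjoint_left.2 fun Y (h : wt n Y = μ) (h' : wt n Y ≠ μ) => h' h)

theorem isIntegrable (hn : 2 ≤ n) : IsIntegrable Φ.rep where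
  indep μ := (Φ.disjoint_supported_wt μ).mono_right (Φ.iSup_weightSpace_ne_le μ)
  iSup_eq_top := by
    simp only [weightSpace_eq, ← Finsupp.supported_iUnion]
    rw [Set.iUnion_eq_univ_iff.2 fun Y => ⟨wt n Y, rfl⟩, Finsupp.supported_univ]
  finite μ := by
    rw [weightSpace_eq]
    have hfin : {Y : Diagram k | wt n Y = μ}.Finite := by
      refine (finite_zeroBoxes hn (-μ (0, 1)).toNat).subset fun Y hY => ?_
      rw [Set.mem_ofPred_eq] at hY ⊢
      rw [← hY, wt_apply]
      simp
    have : Finite {Y : Diagram k | wt n Y = μ} := hfin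
    exact Module.Finite.equiv (Finsupp.supportedEquivFinsupp (R := Qq) (M := Qq) _).symm
  locally_finite i u := by
    simp only [rep_e, rep_f, rep_qpow]
    exact (Φ.strings i).locally_finite (Φ.swap_K i) u
  bounded := by
    refine ⟨{wt n (emptyDiagram k)}, fun μ hμ => ⟨_, Finset.mem_singleton_self _, ?_⟩⟩
    obtain ⟨v, hv, hv0⟩ := Submodule.exists_mem_ne_zero_of_ne_bot hμ
    obtain ⟨Y, hY⟩ := Finsupp.ne_iff.1 hv0
    rw [weightSpace_eq] at hv
    rw [← show wt n Y = μ from hv (Finsupp.mem_support_iff.2 hY)]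
    exact exists_wt_eq hn Y

end FockAction

end Integrable

open scoped TensorProduct

/-! ### The lattice and its reduction modulo `q` -/

section Reduction

variable {k : ℕ}

theorem eq_zero_of_algebraMap_eq_q_mul {c : ℚ} {a : Qq} (ha : a ∈ A)
    (h : algebraMap ℚ Qq c = q * a) : c = 0 := by
  obtain ⟨f, g, hg, rfl⟩ := ha
  have hg0 := algebraMap_ne_zero_of_eval hg
  rw [mul_div_assoc', eq_div_iff hg0, IsScalarTower.algebraMap_apply ℚ (Polynomial ℚ) Qq, q,
    ← RatFunc.algebraMap_X, ← map_mul, ← map_mul] at h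
  have := congrArg (Polynomial.eval 0) (RatFunc.algebraMap_injective ℚ h)
  simpa [hg] using this

/-- Every element of `A` is a rational number plus an element of `qA`. -/
theorem exists_eq_algebraMap_add {a : Qq} (ha : a ∈ A) :
    ∃ c : ℚ, ∃ b ∈ A, a = algebraMap ℚ Qq c + q * b := by
  obtain ⟨f, g, hg, rfl⟩ := ha
  have hg0 := algebraMap_ne_zero_of_eval hg
  obtain ⟨d, hd⟩ : Polynomial.X ∣ f - Polynomial.C (f.eval 0 / g.eval 0) * g := by
    rw [Polynomial.X_dvd_iff, Polynomial.coeff_zero_eq_eval_zero]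
    simp [hg]
  refine ⟨f.eval 0 / g.eval 0, _, ⟨d, g, hg, rfl⟩, ?_⟩
  have e : f = Polynomial.C (f.eval 0 / g.eval 0) * g + Polynomial.X * d := by rw [← hd]; ring
  have e' := congrArg (algebraMap (Polynomial ℚ) Qq) e
  rw [map_add, map_mul, map_mul, RatFunc.algebraMap_X] at e'
  rw [e', add_div, mul_div_cancel_right₀ _ hg0, mul_div_assoc,
    IsScalarTower.algebraMap_apply ℚ (Polynomial ℚ) Qq]
  rfl

theorem coord_mem_A {v : Fock k} (hv : v ∈ lattice k) (Y : Diagram k) : v Y ∈ A := by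
  classical
  induction hv using Submodule.span_induction with
  | mem v hv =>
    obtain ⟨Z, rfl⟩ := hv
    dsimp only
    rw [Finsupp.single_apply]
    split_ifs
    · exact one_mem _
    · exact zero_mem _
  | zero => exact zero_mem _
  | add v w _ _ hv hw => exact add_mem hv hw
  | smul a v _ hv => exact mul_mem a.2 hv

theorem mkQ_eq_mkQ_iff {x y : lattice k} :
    (qMul (lattice k)).mkQ x = (qMul (lattice k)).mkQ y ↔
      ∃ w ∈ lattice k, (x : Fock k) = y + q • w := by
  rw [Submodule.mkQ_apply, Submodule.mkQ_apply, Submodule.Quotient.eq]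
  constructor
  · rintro ⟨w, hw⟩
    refine ⟨w, w.2, ?_⟩
    rw [← sub_eq_iff_eq_add']
    exact (congrArg Subtype.val hw).symm
  · rintro ⟨w, hw, e⟩
    refine ⟨⟨w, hw⟩, Subtype.ext ?_⟩
    exact (sub_eq_iff_eq_add'.2 e).symm

theorem linearIndependent_diagramClass : LinearIndependent ℚ (diagramClass (k := k)) := by
  classical
  rw [linearIndependent_iff]
  intro l hl
  let s : Diagram k → lattice k := fun Y => ⟨Finsupp.single Y 1, single_mem_lattice Y⟩
  let π : lattice k →ₗ[ℚ] ModQ (lattice k) := (qMul (lattice k)).mkQ.restrictScalars ℚ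
  have h1 : π (Finsupp.linearCombination ℚ s l) = π 0 := by
    rw [map_zero, ← hl, Finsupp.apply_linearCombination]
    rfl
  obtain ⟨w, hw, e⟩ := mkQ_eq_mkQ_iff.1 h1
  ext Y
  refine eq_zero_of_algebraMap_eq_q_mul (coord_mem_A hw Y) ?_
  have e' := DFunLike.congr_fun e Y
  rw [ZeroMemClass.coe_zero, zero_add, Finsupp.smul_apply, smul_eq_mul] at e'
  rw [← e', Finsupp.linearCombination_apply, Finsupp.sum, AddSubmonoidClass.coe_finsetSum,
    Finsupp.finsetSum_apply]
  have h2 : ∀ Z, ((l Z • s Z : lattice k) : Fock k) Y =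
      if Z = Y then algebraMap ℚ Qq (l Y) else 0 := by
    intro Z
    rw [Submodule.coe_smul_of_tower, Finsupp.smul_apply, Finsupp.single_apply]
    split_ifs with h
    · rw [h, Algebra.algebraMap_eq_smul_one]
    · rw [smul_zero]
  simp only [h2, Finset.sum_ite_eq']
  split_ifs with h
  · rfl
  · rw [Finsupp.notMem_support_iff.1 h, map_zero]

theorem span_diagramBasis : Submodule.span ℚ (diagramBasis k) = ⊤ := by
  rw [eq_top_iff]
  rintro b -
  obtain ⟨⟨v, hv⟩, rfl⟩ := (qMul (lattice k)).mkQ_surjective b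
  induction hv using Submodule.span_induction with
  | mem v hv =>
    obtain ⟨Y, rfl⟩ := hv
    exact Submodule.subset_span ⟨Y, rfl⟩
  | zero => exact zero_mem _
  | add v w hv hw h1 h2 => exact add_mem h1 h2
  | smul a v hv h =>
    obtain ⟨c, b, hb, e⟩ := exists_eq_algebraMap_add a.2
    have h3 : (qMul (lattice k)).mkQ ⟨a • v, (lattice k).smul_mem a hv⟩ =
        (qMul (lattice k)).mkQ (c • ⟨v, hv⟩) := by
      rw [mkQ_eq_mkQ_iff]
      refine ⟨b • v, smul_mem_lattice hb hv, ?_⟩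
      change (a : Qq) • v = c • v + q • b • v
      rw [e, add_smul, algebraMap_smul, mul_smul]
    have h4 : (qMul (lattice k)).mkQ (c • ⟨v, hv⟩) = c • (qMul (lattice k)).mkQ ⟨v, hv⟩ := rfl
    exact (h3.trans h4) ▸ Submodule.smul_mem _ c h

/-- The diagrams form an `A`-basis of the lattice. -/
def latticeBasis (k : ℕ) : Module.Basis (Diagram k) A (lattice k) :=
  Module.Basis.span ((Finsupp.linearIndependent_single_one Qq (Diagram k)).restrict_scalars
    (by
      intro a b h
      simpa [Algebra.smul_def] using h))

theorem coe_latticeBasis (Y : Diagram k) : (latticeBasis k Y : Fock k) = Finsupp.single Y 1 :=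
  congrArg Subtype.val (Module.Basis.span_apply _ _)

theorem isBaseChange_lattice : IsBaseChange Qq (lattice k).subtype := by
  refine (IsBaseChange.iff_of_equiv_comm (latticeBasis k).repr.symm (LinearEquiv.refl Qq (Fock k))
    ?_).1 (IsBaseChange.of_basis A (Finsupp.basisSingleOne (R := Qq) (ι := Diagram k)))
  refine Finsupp.lhom_ext' fun Y => LinearMap.ext_ring ?_
  simp [coe_latticeBasis]

end Reduction

/-! ### Operators that permute the diagrams modulo `q` -/

section Permute

variable {k n : ℕ}

/-- An operator `T` that permutes the vectors of the strings of colour `i` up to factors in `1 + qA`,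
or sends them to zero, preserves the lattice. -/
theorem mem_lattice_of_strings {i : Fin (n + 1)} {T : Module.End Qq (Fock k)}
    {d : Diagram k → ℕ} {σ : Diagram k → Diagram k}
    (h : ∀ Y, ∃ r, OneModQ r ∧ T (stringsEquiv k n i (Finsupp.single Y 1)) =
      if d Y = 0 then 0 else r • stringsEquiv k n i (Finsupp.single (σ Y) 1)) :
    ∀ v ∈ lattice k, T v ∈ lattice k := by
  intro v hv
  rw [← (stringsEquiv k n i).apply_symm_apply v]
  refine map_lattice (T := T ∘ₗ (stringsEquiv k n i).toLinearMap) (fun Y => ?_)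
    (stringsEquiv_symm_mem hv)
  obtain ⟨r, hr, e⟩ := h Y
  rw [LinearMap.comp_apply, LinearEquiv.coe_coe, e]
  split_ifs
  · exact zero_mem _
  · exact smul_mem_lattice hr.mem (nearId_stringsEquiv.mem (single_mem_lattice _))

/-- If `T` sends the vector of the strings attached to `Y` to the one attached to `σ Y`, up to a
factor in `1 + qA`, then `T` sends `Y` to `σ Y` modulo `q`, because diagrams and vectors of the
strings agree modulo `q`. -/
theorem apply_single_of_strings {i : Fin (n + 1)} {T : Module.End Qq (Fock k)}
    {d : Diagram k → ℕ} {σ : Diagram k → Diagram k}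
    (h : ∀ Y, ∃ r, OneModQ r ∧ T (stringsEquiv k n i (Finsupp.single Y 1)) =
      if d Y = 0 then 0 else r • stringsEquiv k n i (Finsupp.single (σ Y) 1)) (Y : Diagram k) :
    ∃ w ∈ lattice k, T (Finsupp.single Y 1) =
      (if d Y = 0 then 0 else Finsupp.single (σ Y) 1) + q • w := by
  have hT := mem_lattice_of_strings h
  obtain ⟨w, hw, e⟩ := nearId_stringsEquiv (n := n) (i := i) _ (single_mem_lattice Y)
  obtain ⟨r, ⟨a, ha, rfl⟩, e1⟩ := h Y
  rw [LinearEquiv.coe_coe] at e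
  have e2 : T (Finsupp.single Y 1) =
      T (stringsEquiv k n i (Finsupp.single Y 1)) - q • T w := by
    rw [e, map_add, map_smul, add_sub_cancel_right]
  rw [e2, e1]
  split_ifs
  · exact ⟨-T w, neg_mem (hT w hw), by rw [smul_neg, sub_eq_add_neg]⟩
  · obtain ⟨w', hw', e'⟩ := nearId_stringsEquiv (n := n) (i := i) _ (single_mem_lattice (σ Y))
    rw [LinearEquiv.coe_coe] at e'
    refine ⟨w' + a • stringsEquiv k n i (Finsupp.single (σ Y) 1) - T w, ?_, ?_⟩
    · exact sub_mem (add_mem hw' (smul_mem_lattice ha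
        (nearId_stringsEquiv.mem (single_mem_lattice _)))) (hT w hw)
    · rw [add_smul, one_smul, smul_sub, smul_add, mul_smul, add_sub_assoc']
      nth_rewrite 1 [e']
      abel

theorem inducedOp_diagramClass {T : Module.End Qq (Fock k)}
    (hT : ∀ x ∈ lattice k, T x ∈ lattice k) {Y : Diagram k} {d : ℕ} {Z : Diagram k}
    (h : ∃ w ∈ lattice k, T (Finsupp.single Y 1) =
      (if d = 0 then 0 else Finsupp.single Z 1) + q • w) :
    inducedOp (lattice k) T hT (diagramClass Y) = if d = 0 then 0 else diagramClass Z := by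
  have e : inducedOp (lattice k) T hT (diagramClass Y) =
    (qMul (lattice k)).mkQ ⟨T (Finsupp.single Y 1), hT _ (single_mem_lattice Y)⟩ := rfl
  rw [e]
  split_ifs at h ⊢
  · rw [← map_zero (qMul (lattice k)).mkQ]
    exact mkQ_eq_mkQ_iff.2 h
  · exact mkQ_eq_mkQ_iff.2 h

theorem diagramClass_injective : Function.Injective (diagramClass (k := k)) :=
  linearIndependent_diagramClass.injective

theorem diagramClass_ne_zero (Y : Diagram k) : diagramClass Y ≠ 0 :=
  linearIndependent_diagramClass.ne_zero Y

end Permute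

/-! ### Crystal bases -/

section CrystalBase

variable {k n : ℕ}

namespace FockAction

/-- The lattice and the diagrams form a crystal pair for any operators that act on the strings of
each colour like `ẽ_i` and `f̃_i`, up to factors in `1 + qA`. -/
theorem isCrystalPair (Φ : FockAction k n) {et ft : Fin (n + 1) → Module.End Qq (Fock k)}
    (he : ∀ i Y, ∃ r, OneModQ r ∧ et i (stringsEquiv k n i (Finsupp.single Y 1)) =
      if (upperStrings k n i).ep Y = 0 then 0
        else r • stringsEquiv k n i (Finsupp.single ((upperStrings k n i).e Y) 1))
    (hf : ∀ i Y, ∃ r, OneModQ r ∧ ft i (stringsEquiv k n i (Finsupp.single Y 1)) =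
      if (upperStrings k n i).ph Y = 0 then 0
        else r • stringsEquiv k n i (Finsupp.single ((upperStrings k n i).f Y) 1)) :
    IsCrystalPair Φ.rep et ft (lattice k) (diagramBasis k) where
  free := Module.Free.of_basis (latticeBasis k)
  baseChange := isBaseChange_lattice
  linearIndependent := linearIndependent_diagramClass.linearIndepOn_id
  span_eq_top := span_diagramBasis
  e_lattice i := mem_lattice_of_strings (he i)
  f_lattice i := mem_lattice_of_strings (hf i)
  e_basis i := by
    rintro _ ⟨Y, rfl⟩
    rw [inducedOp_diagramClass _ (apply_single_of_strings (he i) Y)]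
    split_ifs
    · exact Or.inr rfl
    · exact Or.inl ⟨_, rfl⟩
  f_basis i := by
    rintro _ ⟨Y, rfl⟩
    rw [inducedOp_diagramClass _ (apply_single_of_strings (hf i) Y)]
    split_ifs
    · exact Or.inr rfl
    · exact Or.inl ⟨_, rfl⟩
  weight_indep μ := by
    rw [Submodule.disjoint_def]
    intro v hv hv'
    have hle : ⨆ (ν) (_ : ν ≠ μ), lattice k ⊓ (weightSpace Φ.rep ν).restrictScalars A ≤
        (⨆ (ν) (_ : ν ≠ μ), weightSpace Φ.rep ν).restrictScalars A :=
      iSup₂_le fun ν hν x hx => le_iSup₂ (f := fun ν (_ : ν ≠ μ) => weightSpace Φ.rep ν) ν hν hx.2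
    exact (Submodule.disjoint_def.1 (Φ.disjoint_supported_wt μ)) v hv.2
      (Φ.iSup_weightSpace_ne_le μ (hle hv'))
  weight_iSup := by
    refine le_antisymm (iSup_le fun μ => inf_le_left) (Submodule.span_le.2 ?_)
    rintro _ ⟨Y, rfl⟩
    exact Submodule.mem_iSup_of_mem (wt n Y) ⟨single_mem_lattice Y, Φ.single_mem_weightSpace Y⟩
  basis_weight := by
    rintro _ ⟨Y, rfl⟩
    refine ⟨wt n Y, ⟨⟨_, single_mem_lattice Y⟩, Φ.single_mem_weightSpace Y, rfl⟩, ?_⟩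
    rintro μ ⟨x, hx, e⟩
    obtain ⟨w, hw, e'⟩ := (mkQ_eq_mkQ_iff (y := ⟨_, single_mem_lattice Y⟩)).1 e
    -- The coefficient of `Y` in `x` lies in `1 + qA`.
    have hY : (x : Fock k) Y ≠ 0 := by
      rw [e', Finsupp.add_apply, Finsupp.single_eq_same, Finsupp.smul_apply, smul_eq_mul]
      intro h0
      have := eq_zero_of_algebraMap_eq_q_mul (c := 1) (neg_mem (coord_mem_A hw Y))
        (by rw [map_one, mul_neg]; exact eq_neg_of_add_eq_zero_left h0)
      exact one_ne_zero this
    rw [weightSpace_eq] at hx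
    exact (hx (Finsupp.mem_support_iff.2 hY)).symm
  e_iff_f i := by
    rintro _ ⟨Y, rfl⟩ _ ⟨Z, rfl⟩
    rw [inducedOp_diagramClass _ (apply_single_of_strings (hf i) Y),
      inducedOp_diagramClass _ (apply_single_of_strings (he i) Z)]
    constructor
    · intro h
      split_ifs at h with hp
      · exact absurd h (diagramClass_ne_zero Z)
      · obtain ⟨h1, -, h3⟩ := (upperStrings k n i).f_spec Y (Nat.pos_of_ne_zero hp)
        rw [diagramClass_injective h, if_neg (by omega), h3]
    · intro h
      split_ifs at h with hp
      · exact absurd h (diagramClass_ne_zero Y)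
      · obtain ⟨-, h1, h3⟩ := (upperStrings k n i).e_spec Z (Nat.pos_of_ne_zero hp)
        rw [diagramClass_injective h, if_neg (by omega), h3]

theorem fDiv_rep (Φ : FockAction k n) (i : Fin (n + 1)) (m : ℕ) :
    fDiv Φ.rep i m = (qFact (qi n i) m)⁻¹ • Φ.F i ^ m := by
  rw [fDiv, rep_f]

theorem qpowOp_of_mem_weightSpace (Φ : FockAction k n) {μ : Weight n} {u : Fock k}
    (hu : u ∈ weightSpace Φ.rep μ) {i : Fin (n + 1)} {l : ℕ} (hl : μ (hElt n i) = l) :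
    qpowOp n (hElt n i) u = q ^ (l : ℤ) • u := by
  rw [← rep_qpow Φ, hu, hl]

/-- `f^{(m)} u` has in the basis of strings the coefficients `stringCoeff`, whose ratios are the
scalars of the upper Kashiwara operators; so these move the basis vectors without a factor. -/
theorem isUpperKashiwara (Φ : FockAction k n) (i : Fin (n + 1)) :
    IsUpperKashiwara Φ.rep i ((Φ.strings i).eOp fun _ => 1) ((Φ.strings i).fOp fun _ => 1) where
  e_zero μ u _ h := (Φ.strings i).eOp_eq_zero (generic_qi n i) _ (by rwa [rep_e] at h)
  e_succ μ u hu h l m hl hm := by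
    rw [rep_e] at h
    rw [fDiv_rep, fDiv_rep]
    refine (Φ.strings i).eOp_divided (generic_qi n i) h (Φ.qpowOp_of_mem_weightSpace hu hl) hm
      fun b _ _ => ?_
    rw [one_mul, div_mul_eq_mul_div, eq_div_iff ((generic_qi n i).qInt_ne_zero (by omega)),
      StringBasis.stringCoeff_succ (generic_qi n i), mul_comm]
  f_lt μ u hu h l m hl hm := by
    rw [rep_e] at h
    rw [fDiv_rep, fDiv_rep]
    refine (Φ.strings i).fOp_divided (generic_qi n i) h (Φ.qpowOp_of_mem_weightSpace hu hl) hm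
      fun b _ _ => ?_
    rw [one_mul, div_mul_eq_mul_div, eq_div_iff ((generic_qi n i).qInt_ne_zero (by omega)),
      ← StringBasis.stringCoeff_succ (generic_qi n i), mul_comm]
  f_last μ u hu h l hl := by
    rw [rep_e] at h
    rw [fDiv_rep]
    exact (Φ.strings i).fOp_divided_last (generic_qi n i) h (Φ.qpowOp_of_mem_weightSpace hu hl)

/-- The scalars of the lower Kashiwara operators undo the ratios of consecutive coefficients of
`f^{(m)} u` in the basis of strings. -/
theorem isLowerKashiwara (Φ : FockAction k n) (i : Fin (n + 1)) :
    IsLowerKashiwara Φ.rep i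
      ((Φ.strings i).eOp fun b =>
        qInt (qi n i) ((Φ.strings i).ep b) / qInt (qi n i) ((Φ.strings i).ph b + 1))
      ((Φ.strings i).fOp fun b =>
        qInt (qi n i) ((Φ.strings i).ph b) / qInt (qi n i) ((Φ.strings i).ep b + 1)) where
  e_zero μ u _ h := (Φ.strings i).eOp_eq_zero (generic_qi n i) _ (by rwa [rep_e] at h)
  e_succ μ u hu h l m hl hm := by
    rw [rep_e] at h
    rw [fDiv_rep, fDiv_rep, ← one_smul Qq (((qFact (qi n i) m)⁻¹ • Φ.F i ^ m) u)]
    refine (Φ.strings i).eOp_divided (generic_qi n i) h (Φ.qpowOp_of_mem_weightSpace hu hl) hm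
      fun b h1 h2 => ?_
    rw [h1, h2, show l - (m + 1) + 1 = l - m by omega, one_mul, div_mul_eq_mul_div,
      div_eq_iff ((generic_qi n i).qInt_ne_zero (by omega)), mul_comm,
      StringBasis.stringCoeff_succ (generic_qi n i)]
  f_lt μ u hu h l m hl hm := by
    rw [rep_e] at h
    rw [fDiv_rep, fDiv_rep, ← one_smul Qq (((qFact (qi n i) (m + 1))⁻¹ • Φ.F i ^ (m + 1)) u)]
    refine (Φ.strings i).fOp_divided (generic_qi n i) h (Φ.qpowOp_of_mem_weightSpace hu hl) hm
      fun b h1 h2 => ?_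
    rw [h1, h2, one_mul, div_mul_eq_mul_div,
      div_eq_iff ((generic_qi n i).qInt_ne_zero (by omega)), mul_comm,
      StringBasis.stringCoeff_succ (generic_qi n i)]
  f_last μ u hu h l hl := by
    rw [rep_e] at h
    rw [fDiv_rep]
    exact (Φ.strings i).fOp_divided_last (generic_qi n i) h (Φ.qpowOp_of_mem_weightSpace hu hl)

end FockAction

theorem isUpperCrystalBase (hn : 2 ≤ n) :
    IsUpperCrystalBase (upperAction k n hn).rep (lattice k) (diagramBasis k) :=
  ⟨_, _, (upperAction k n hn).isUpperKashiwara, (upperAction k n hn).isCrystalPair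
    (fun i Y => ⟨1, oneModQ_one, by
      have h := (upperStrings k n i).eOp_G (fun _ => 1) Y
      rw [upperStrings_G, upperStrings_G] at h
      exact h⟩)
    (fun i Y => ⟨1, oneModQ_one, by
      have h := (upperStrings k n i).fOp_G (fun _ => 1) Y
      rw [upperStrings_G, upperStrings_G] at h
      exact h⟩)⟩

theorem lowerStrings_G (i : Fin (n + 1)) (Y : Diagram k) :
    (lowerStrings k n i).G Y = qi n i ^ ((upperStrings k n i).ep Y * (upperStrings k n i).ph Y) •
      stringsEquiv k n i (Finsupp.single Y 1) := by
  rw [← upperStrings_G]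
  exact Module.Basis.unitsSMul_apply _

theorem stringsEquiv_eq_smul_lowerStrings_G (i : Fin (n + 1)) (Y : Diagram k) :
    stringsEquiv k n i (Finsupp.single Y 1) =
      (qi n i ^ ((upperStrings k n i).ep Y * (upperStrings k n i).ph Y))⁻¹ •
        (lowerStrings k n i).G Y := by
  rw [lowerStrings_G, inv_smul_smul₀ (pow_ne_zero _ (generic_qi n i).ne_zero)]

/-- In the basis of the strings for `E_i`, `F_i`, the lower Kashiwara operators of the modified
action have coefficients `[a+1] x^a / ([b+1] x^b)`. -/
theorem oneModQ_lower {s : ℕ} (hs : 0 < s) (a b : ℕ) :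
    OneModQ (((q ^ s) ^ ((a + 1) * b))⁻¹ *
      (qInt (q ^ s) (a + 1) / qInt (q ^ s) (b + 1) * (q ^ s) ^ (a * (b + 1)))) := by
  convert (oneModQ_qInt hs a).mul (oneModQ_qInt hs b).inv using 1
  have hx := generic_q_pow hs
  have := hx.qInt_ne_zero (Nat.succ_pos b)
  have := hx.ne_zero
  generalize q ^ s = x at *
  field_simp
  ring

theorem isLowerCrystalBase (hn : 2 ≤ n) :
    IsLowerCrystalBase (lowerAction k n hn).rep (lattice k) (diagramBasis k) := by
  refine ⟨_, _, (lowerAction k n hn).isLowerKashiwara, (lowerAction k n hn).isCrystalPair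
    (fun i Y => ?_) (fun i Y => ?_)⟩
  · have h := (lowerStrings k n i).eOp_G (fun b => qInt (qi n i) ((lowerStrings k n i).ep b) /
      qInt (qi n i) ((lowerStrings k n i).ph b + 1)) Y
    by_cases h0 : (upperStrings k n i).ep Y = 0
    · refine ⟨1, oneModQ_one, ?_⟩
      rw [if_pos h0, stringsEquiv_eq_smul_lowerStrings_G, map_smul]
      exact (congrArg _ (h.trans (if_pos h0))).trans (smul_zero _)
    · obtain ⟨h1, h2⟩ : (upperStrings k n i).ep ((upperStrings k n i).e Y) + 1 =
          (upperStrings k n i).ep Y ∧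
          (upperStrings k n i).ph ((upperStrings k n i).e Y) = (upperStrings k n i).ph Y + 1 := by
        obtain ⟨h1, h2, -⟩ := (upperStrings k n i).e_spec Y (Nat.pos_of_ne_zero h0)
        exact ⟨by omega, by omega⟩
      refine ⟨_, oneModQ_lower (sInt_pos n i) ((upperStrings k n i).ep ((upperStrings k n i).e Y))
        ((upperStrings k n i).ph Y), ?_⟩
      rw [if_neg h0, stringsEquiv_eq_smul_lowerStrings_G i Y, map_smul]
      refine (congrArg _ (h.trans (if_neg h0))).trans ?_
      change _ • (qInt (qi n i) ((upperStrings k n i).ep Y) /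
        qInt (qi n i) ((upperStrings k n i).ph Y + 1)) •
          (lowerStrings k n i).G ((upperStrings k n i).e Y) = _
      rw [lowerStrings_G, smul_smul, smul_smul, h2, ← h1, mul_assoc]
      rfl
  · have h := (lowerStrings k n i).fOp_G (fun b => qInt (qi n i) ((lowerStrings k n i).ph b) /
      qInt (qi n i) ((lowerStrings k n i).ep b + 1)) Y
    by_cases h0 : (upperStrings k n i).ph Y = 0
    · refine ⟨1, oneModQ_one, ?_⟩
      rw [if_pos h0, stringsEquiv_eq_smul_lowerStrings_G, map_smul]
      exact (congrArg _ (h.trans (if_pos h0))).trans (smul_zero _)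
    · obtain ⟨h1, h2⟩ : (upperStrings k n i).ph ((upperStrings k n i).f Y) + 1 =
          (upperStrings k n i).ph Y ∧
          (upperStrings k n i).ep ((upperStrings k n i).f Y) = (upperStrings k n i).ep Y + 1 := by
        obtain ⟨h1, h2, -⟩ := (upperStrings k n i).f_spec Y (Nat.pos_of_ne_zero h0)
        exact ⟨by omega, by omega⟩
      refine ⟨_, oneModQ_lower (sInt_pos n i) ((upperStrings k n i).ph ((upperStrings k n i).f Y))
        ((upperStrings k n i).ep Y), ?_⟩
      rw [if_neg h0, stringsEquiv_eq_smul_lowerStrings_G i Y, map_smul]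
      refine (congrArg _ (h.trans (if_neg h0))).trans ?_
      change _ • (qInt (qi n i) ((upperStrings k n i).ph Y) /
        qInt (qi n i) ((upperStrings k n i).ep Y + 1)) •
          (lowerStrings k n i).G ((upperStrings k n i).f Y) = _
      rw [lowerStrings_G, smul_smul, smul_smul, h2, ← h1, mul_assoc,
        mul_comm ((upperStrings k n i).ep Y) (_ + 1),
        mul_comm ((upperStrings k n i).ep Y + 1) ((upperStrings k n i).ph _)]
      rfl

end CrystalBase

end FockC

end

theorem theorem3p1 (n : ℕ) (hn : 2 ≤ n) (k : ℕ) (hk : k ≤ n) :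
    Function.Injective (diagramClass (k := k)) ∧
    (∃ ρ : Uq n →ₐ[Qq] Module.End Qq (Fock k),
      (∀ i, ρ (Uq.e n i) = EUpper n i) ∧ (∀ i, ρ (Uq.f n i) = FUpper n i) ∧
      (∀ h, ρ (Uq.qpow n h) = qpowOp n h) ∧
      IsIntegrable ρ ∧ IsUpperCrystalBase ρ (lattice k) (diagramBasis k)) ∧
    (∃ ρ : Uq n →ₐ[Qq] Module.End Qq (Fock k),
      (∀ i, ρ (Uq.e n i) = ELower n i) ∧ (∀ i, ρ (Uq.f n i) = FLower n i) ∧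
      (∀ h, ρ (Uq.qpow n h) = qpowOp n h) ∧
      IsIntegrable ρ ∧ IsLowerCrystalBase ρ (lattice k) (diagramBasis k)) :=
  ⟨diagramClass_injective,
    ⟨(upperAction k n hn).rep, (upperAction k n hn).rep_e, (upperAction k n hn).rep_f,
      (upperAction k n hn).rep_qpow, (upperAction k n hn).isIntegrable hn, isUpperCrystalBase hn⟩,
    ⟨(lowerAction k n hn).rep, (lowerAction k n hn).rep_e, (lowerAction k n hn).rep_f,
      (lowerAction k n hn).rep_qpow, (lowerAction k n hn).isIntegrable hn, isLowerCrystalBase hn⟩⟩
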